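/- Let $F$ be a field that is complete with respect to a nontrivial non-Archimedean absolute value, let $F^\circ=\{x\in F:|x|\le 1\}$, and fix $\pi\in F$ with $0<|\pi|<1$. **Notation.** For $R\in\{F,F^\circ\}$, a Banach $R$-module is a complete ultrametric normed abelian group $M$ with an $R$-module structure such that $\|rm\|\le C\,|r|\,\|m\|$ for some constant $C$. Morphisms are the bounded $R$-linear maps. $\mathrm{Ban}_R$ is symmetric monoidal for the completed projective tensor product $\widehat\otimes_R$ (the completion of $M\otimes_R N$ for the seminorm $\inf\max_i\|m_i\|\|n_i\|$ over all presentations $\sum_i m_i\otimes n_i$). Let $\mathrm{IndBan}_R=\mathrm{Ind}(\mathrm{Ban}_R)$, whose objects are the formal small filtered colimits "colim"$_i M_i$, with $\mathrm{Hom}=\lim_i\mathrm{colim}_j\mathrm{Hom}(M_i,N_j)$ and with the symmetric monoidal structure "colim"$_iM_i\,\widehat\otimes\,$"colim"$_jN_j=$"colim"$_{(i,j)}M_i\widehat\otimes_RN_j$. For a Banach space $V$ over $F$ put $V^\circ=\{v\in V:\|rv\|\le 1\text{ for all }r\in F^\circ\}$ (the unit ball, if the norm satisfies $\|rv\|=|r|\|v\|$).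 For $V=$"colim"$_iV_i$ in $\mathrm{IndBan}_F$ let $\underline V=$"colim"$_{(i,n)}\,\pi^{-n}V_i^\circ$ in $\mathrm{IndBan}_{F^\circ}$ (the formal colimit over $n\in\mathbb N$ along the inclusions; equivalently, for a Banach space $V$, the formal colimit of $V^\circ$ along multiplication by $\pi$). The maps $\pi^{-n}V_i^\circ\,\widehat\otimes_{F^\circ}\,\pi^{-m}W_j^\circ\to V_i\widehat\otimes_FW_j$ induce natural morphisms $\underline V\widehat\otimes_{F^\circ}\underline W\to\underline{V\widehat\otimes_FW}$. They make $\underline F$ a commutative monoid and each $\underline V$ an $\underline F$-module. Let $\mathrm{IndBan}_{\underline F}$ be the category of $\underline F$-modules in $\mathrm{IndBan}_{F^\circ}$, with the relative tensor product $M\widehat\otimes_{\underline F}N=\mathrm{coeq}\bigl(M\widehat\otimes_{F^\circ}\underline F\widehat\otimes_{F^\circ}N\rightrightarrows M\widehat\otimes_{F^\circ}N\bigr)$. Let $\mathrm{CBorn}_F\subseteq\mathrm{IndBan}_F$ be the full subcategory of complete bornological spaces, i.e. of the essentially monomorphic objects (those isomorphic to some "colim"$_iE_i$ with all transition maps monomorphisms).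 It is reflective, and is given the symmetric monoidal structure for which the reflector is strongly monoidal: $V\widehat\otimes_FW$ is the reflection of the tensor product in $\mathrm{IndBan}_F$. The vector space underlying $E\in\mathrm{CBorn}_F$ is $|E|=\mathrm{colim}_i|E_i|$; a subset is bounded if it lies in the image of a norm-bounded subset of some $E_i$. A sequence $(e_n)$ in $|E|$ converges to $e$ if there is a bounded $B$ such that for each $\lambda\in F\setminus\{0\}$ one has $e-e_n\in\lambda B$ for all large $n$; a subset is closed if it contains every limit of every convergent sequence of its elements. $E$ is proper if there is a collection of closed bounded subsets such that every bounded subset is contained in a finite union of its members. In a category with zero morphisms, $0\to X\xrightarrow{i}Y\xrightarrow{p}Z\to0$ is strictly short exact if $i$ is a kernel of $p$ and $p$ is a cokernel of $i$. A functor is exact if it preserves strictly short exact sequences, and strongly left exact if it preserves kernels of arbitrary morphisms. **Proposition.** 1. The functor $\mathrm{IndBan}_F\to\mathrm{IndBan}_{\underline F}$, $V\mapsto\underline V$, is strongly monoidal: for its canonical lax symmetric monoidal structure, the unit morphism from the monoidal unit to $\underline F$, and the natural morphism $\underline V\widehat\otimes_{\underline F}\underline W\to\underline{V\widehat\otimes_FW}$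 for all $V,W\in\mathrm{IndBan}_F$, are isomorphisms. 2. This functor is exact. 3. This functor is a reflective embedding: it is fully faithful and has a left adjoint. 4. The composite $\mathrm{CBorn}_F\hookrightarrow\mathrm{IndBan}_F\to\mathrm{IndBan}_{\underline F}$ is strongly monoidal on proper complete bornological spaces: for its canonical lax monoidal structure, the unit morphism, and the natural morphism $\underline V\widehat\otimes_{\underline F}\underline W\to\underline{V\widehat\otimes_FW}$ for all proper $V,W\in\mathrm{CBorn}_F$ (with $\widehat\otimes_F$ the tensor product of $\mathrm{CBorn}_F$), are isomorphisms. 5. This composite is strongly left exact. -/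

import Mathlib

open CategoryTheory MonoidalCategory TensorProduct

universe v w u

namespace IndBanach

noncomputable section

/-! ### Banach modules over an ultrametric Banach ring -/

/-- A Banach module over a (commutative, non-Archimedean) Banach ring `R`: a complete ultrametric
normed abelian group with an `R`-module structure such that `‖r • m‖ ≤ C ‖r‖ ‖m‖` for some `C`. -/
structure BanMod (R : Type u) [NormedCommRing R] : Type (u + 1) where
  carrier : Type u
  [normed : NormedAddCommGroup carrier]
  [module : Module R carrier]
  [ultra : IsUltrametricDist carrier]
  [complete : CompleteSpace carrier]
  smul_bound : ∃ C : ℝ, ∀ (r : R) (m : carrier), ‖r • m‖ ≤ C * ‖r‖ * ‖m‖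

namespace BanMod

instance (R : Type u) [NormedCommRing R] : CoeSort (BanMod R) (Type u) := ⟨carrier⟩

attribute [instance] normed module ultra complete

section

variable {R : Type u} [NormedCommRing R]

/-- Morphisms of Banach modules: bounded `R`-linear maps. -/
@[ext]
structure Hom (M N : BanMod R) where
  toLin : M →ₗ[R] N
  bound : ∃ C : ℝ, ∀ m : M, ‖toLin m‖ ≤ C * ‖m‖

instance : Category (BanMod R) where
  Hom := Hom
  id M := ⟨LinearMap.id, 1, fun m => by simp⟩
  comp f g := ⟨g.toLin ∘ₗ f.toLin, by
    obtain ⟨C, hC⟩ := f.bound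
    obtain ⟨D, hD⟩ := g.bound
    refine ⟨|D| * C, fun m => (hD _).trans ?_⟩
    calc D * ‖f.toLin m‖ ≤ |D| * ‖f.toLin m‖ := by gcongr; exact le_abs_self D
      _ ≤ |D| * (C * ‖m‖) := by gcongr; exact hC m
      _ = _ := by ring⟩

/-- The `R`-linear map underlying a morphism. -/
def lin {M N : BanMod R} (f : M ⟶ N) : M →ₗ[R] N := Hom.toLin f

/-- The morphism given by a bounded `R`-linear map. -/
def ofLin {M N : BanMod R} (f : M →ₗ[R] N) (h : ∃ C : ℝ, ∀ m : M, ‖f m‖ ≤ C * ‖m‖) : M ⟶ N :=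
  Hom.mk f h

@[simp] lemma lin_ofLin {M N : BanMod R} (f : M →ₗ[R] N) (h) : lin (ofLin f h) = f := rfl

@[simp] lemma lin_id (M : BanMod R) (m : M) : lin (𝟙 M) m = m := rfl

@[simp] lemma lin_comp {M N P : BanMod R} (f : M ⟶ N) (g : N ⟶ P) (m : M) :
    lin (f ≫ g) m = lin g (lin f m) := rfl

@[ext] lemma hom_ext {M N : BanMod R} {f g : M ⟶ N} (h : ∀ m, lin f m = lin g m) : f = g :=
  Hom.ext (LinearMap.ext h)

lemma exists_bound {M N : BanMod R} (f : M ⟶ N) :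
    ∃ C : ℝ, 0 ≤ C ∧ ∀ m, ‖lin f m‖ ≤ C * ‖m‖ := by
  obtain ⟨C, hC⟩ := Hom.bound f
  exact ⟨|C|, abs_nonneg C, fun m => (hC m).trans (by gcongr; exact le_abs_self C)⟩

lemma exists_smul_bound (M : BanMod R) :
    ∃ C : ℝ, 0 ≤ C ∧ ∀ (r : R) (m : M), ‖r • m‖ ≤ C * ‖r‖ * ‖m‖ := by
  obtain ⟨C, hC⟩ := M.smul_bound
  exact ⟨|C|, abs_nonneg C, fun r m => (hC r m).trans (by gcongr; exact le_abs_self C)⟩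

lemma continuous_of_bound {M N : Type*} [SeminormedAddCommGroup M] [SeminormedAddCommGroup N]
    (f : M →+ N) (h : ∃ C : ℝ, ∀ m, ‖f m‖ ≤ C * ‖m‖) : Continuous f := by
  obtain ⟨C, hC⟩ := h
  exact AddMonoidHomClass.continuous_of_bound f C hC

lemma bound_lin {M N : BanMod R} (f : M ⟶ N) : ∃ C : ℝ, ∀ m, ‖lin f m‖ ≤ C * ‖m‖ := Hom.bound f

lemma continuous_lin {M N : BanMod R} (f : M ⟶ N) : Continuous (lin f) :=
  continuous_of_bound (lin f).toAddMonoidHom (Hom.bound f)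

instance : Limits.HasZeroMorphisms (BanMod R) where
  zero M N := ⟨ofLin 0 ⟨0, fun m => by simp⟩⟩
  comp_zero _ _ := rfl
  zero_comp _ _ _ f := by
    ext m
    exact map_zero (lin f)

@[simp] lemma lin_zero {M N : BanMod R} (m : M) : lin (0 : M ⟶ N) m = 0 := rfl

/-- The forgetful functor from Banach modules to modules. -/
def forgetModule : BanMod R ⥤ ModuleCat.{u} R where
  obj M := ModuleCat.of R M
  map f := ModuleCat.ofHom (lin f)

/-! ### The completed projective tensor product -/

/-- The algebraic tensor product, to be equipped with the projective seminorm. -/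
def PTensor (M N : BanMod R) : Type u := M ⊗[R] N

instance (M N : BanMod R) : AddCommGroup (PTensor M N) := inferInstanceAs (AddCommGroup (M ⊗[R] N))
instance (M N : BanMod R) : Module R (PTensor M N) := inferInstanceAs (Module R (M ⊗[R] N))

/-- The subgroup of those `∑ mᵢ ⊗ nᵢ` with `‖mᵢ‖ ‖nᵢ‖ ≤ c` for all `i`. -/
def ptBall (M N : BanMod R) (c : ℝ) : AddSubgroup (PTensor M N) :=
  AddSubgroup.closure {t | ∃ (m : M) (n : N), ‖m‖ * ‖n‖ ≤ c ∧ t = m ⊗ₜ[R] n}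

lemma ptBall_mono (M N : BanMod R) {c d : ℝ} (h : c ≤ d) : ptBall M N c ≤ ptBall M N d :=
  AddSubgroup.closure_mono (by
    rintro _ ⟨m, n, hmn, rfl⟩
    exact ⟨m, n, hmn.trans h, rfl⟩)

lemma exists_mem_ptBall {M N : BanMod R} (t : PTensor M N) : ∃ c : ℝ, 0 ≤ c ∧ t ∈ ptBall M N c := by
  refine TensorProduct.induction_on (motive := fun t : M ⊗[R] N =>
    ∃ c : ℝ, 0 ≤ c ∧ (t : PTensor M N) ∈ ptBall M N c) t ⟨0, le_rfl, zero_mem _⟩ ?_ ?_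
  · intro m n
    exact ⟨‖m‖ * ‖n‖, by positivity, AddSubgroup.subset_closure ⟨m, n, le_rfl, rfl⟩⟩
  · rintro x y ⟨c, hc, hx⟩ ⟨d, hd, hy⟩
    exact ⟨max c d, le_max_of_le_left hc, add_mem (ptBall_mono M N (le_max_left _ _) hx)
      (ptBall_mono M N (le_max_right _ _) hy)⟩

/-- The projective seminorm `inf max ‖mᵢ‖ ‖nᵢ‖` over all presentations `t = ∑ mᵢ ⊗ nᵢ`. -/
def ptNorm {M N : BanMod R} (t : PTensor M N) : ℝ := sInf {c : ℝ | 0 ≤ c ∧ t ∈ ptBall M N c}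

lemma ptNorm_nonneg {M N : BanMod R} (t : PTensor M N) : 0 ≤ ptNorm t :=
  Real.sInf_nonneg fun _ h => h.1

lemma ptNorm_le {M N : BanMod R} {t : PTensor M N} {c : ℝ} (hc : 0 ≤ c) (h : t ∈ ptBall M N c) :
    ptNorm t ≤ c :=
  csInf_le ⟨0, fun _ h => h.1⟩ ⟨hc, h⟩

lemma mem_ptBall_of_lt {M N : BanMod R} {t : PTensor M N} {c : ℝ} (h : ptNorm t < c) :
    t ∈ ptBall M N c := by
  obtain ⟨d, hd, hdc⟩ := exists_lt_of_csInf_lt (exists_mem_ptBall t) h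
  exact ptBall_mono M N hdc.le hd.2

lemma ptNorm_add_le {M N : BanMod R} (s t : PTensor M N) :
    ptNorm (s + t) ≤ max (ptNorm s) (ptNorm t) := by
  refine le_of_forall_gt fun c hc => ?_
  obtain ⟨d, hd, hdc⟩ := exists_between hc
  have hd0 : 0 ≤ d := (ptNorm_nonneg s).trans ((le_max_left _ _).trans hd.le)
  exact (ptNorm_le hd0 (add_mem (mem_ptBall_of_lt ((le_max_left _ _).trans_lt hd))
    (mem_ptBall_of_lt ((le_max_right _ _).trans_lt hd)))).trans_lt hdc

/-- The projective seminorm as a seminorm of groups. -/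
def ptSeminorm (M N : BanMod R) : AddGroupSeminorm (PTensor M N) where
  toFun := ptNorm
  map_zero' := le_antisymm (ptNorm_le le_rfl (zero_mem _)) (ptNorm_nonneg _)
  add_le' s t := (ptNorm_add_le s t).trans
    (max_le_add_of_nonneg (ptNorm_nonneg s) (ptNorm_nonneg t))
  neg' t := by simp only [ptNorm, neg_mem_iff]

instance (M N : BanMod R) : SeminormedAddCommGroup (PTensor M N) :=
  (ptSeminorm M N).toSeminormedAddCommGroup

lemma norm_pt {M N : BanMod R} (t : PTensor M N) : ‖t‖ = ptNorm t := rfl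

lemma norm_smul_pt_le (M N : BanMod R) :
    ∃ C : ℝ, 0 ≤ C ∧ ∀ (r : R) (t : PTensor M N), ‖r • t‖ ≤ C * ‖r‖ * ‖t‖ := by
  obtain ⟨C, hC, h⟩ := M.exists_smul_bound
  refine ⟨C, hC, fun r t => ?_⟩
  have key : ∀ c : ℝ, ‖t‖ < c → ‖r • t‖ ≤ C * ‖r‖ * c := by
    intro c hc
    have hc0 : 0 ≤ c := (norm_nonneg t).trans hc.le
    refine ptNorm_le (by positivity) ?_
    refine AddSubgroup.closure_induction (p := fun t _ => r • t ∈ ptBall M N (C * ‖r‖ * c))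
      ?_ ?_ ?_ ?_ (mem_ptBall_of_lt (M := M) (N := N) hc)
    · rintro _ ⟨m, n, hmn, rfl⟩
      refine AddSubgroup.subset_closure ⟨r • m, n, ?_, rfl⟩
      calc ‖r • m‖ * ‖n‖ ≤ (C * ‖r‖ * ‖m‖) * ‖n‖ := by gcongr; exact h r m
        _ = C * ‖r‖ * (‖m‖ * ‖n‖) := by ring
        _ ≤ _ := by gcongr
    · rw [smul_zero]; exact zero_mem _
    · intro x y _ _ hx hy; rw [smul_add]; exact add_mem hx hy
    · intro x _ hx; rw [smul_neg]; exact neg_mem hx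
  refine le_of_forall_pos_le_add fun e he => ?_
  have hK : 0 < C * ‖r‖ + 1 := by positivity
  refine (key (‖t‖ + e / (C * ‖r‖ + 1)) (by linarith [div_pos he hK])).trans ?_
  rw [mul_add]
  gcongr
  rw [mul_div_assoc', div_le_iff₀ hK]
  nlinarith

instance (M N : BanMod R) : UniformContinuousConstSMul R (PTensor M N) where
  uniformContinuous_const_smul r := by
    obtain ⟨C, -, h⟩ := norm_smul_pt_le M N
    exact uniformContinuous_addMonoidHom_of_continuous
      (f := DistribSMul.toAddMonoidHom (PTensor M N) r)
      (continuous_of_bound _ ⟨C * ‖r‖, fun t => h r t⟩)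

instance (M N : BanMod R) : IsUltrametricDist (PTensor M N) :=
  IsUltrametricDist.isUltrametricDist_of_forall_norm_add_le_max_norm ptNorm_add_le

lemma ultra_completion (E : Type u) [SeminormedAddCommGroup E] [IsUltrametricDist E] :
    IsUltrametricDist (UniformSpace.Completion E) :=
  IsUltrametricDist.isUltrametricDist_of_forall_norm_add_le_max_norm fun x y => by
    induction x, y using UniformSpace.Completion.induction_on₂ with
    | hp =>
      exact isClosed_le (continuous_fst.add continuous_snd).norm
        (continuous_fst.norm.max continuous_snd.norm)
    | ih s t =>
      rw [← UniformSpace.Completion.coe_add]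
      simp only [UniformSpace.Completion.norm_coe]
      exact IsUltrametricDist.norm_add_le_max s t

lemma smul_completion (E : Type u) [SeminormedAddCommGroup E] [Module R E]
    [UniformContinuousConstSMul R E]
    (h : ∃ C : ℝ, 0 ≤ C ∧ ∀ (r : R) (t : E), ‖r • t‖ ≤ C * ‖r‖ * ‖t‖) :
    ∃ C : ℝ, ∀ (r : R) (t : UniformSpace.Completion E), ‖r • t‖ ≤ C * ‖r‖ * ‖t‖ := by
  obtain ⟨C, -, h⟩ := h
  refine ⟨C, fun r t => ?_⟩
  induction t using UniformSpace.Completion.induction_on with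
  | hp => exact isClosed_le (continuous_const_smul r).norm (continuous_const.mul continuous_norm)
  | ih t =>
    rw [← UniformSpace.Completion.coe_smul]
    simp only [UniformSpace.Completion.norm_coe]
    exact h r t

/-- The completed projective tensor product of two Banach modules. -/
def tensor (M N : BanMod R) : BanMod R where
  carrier := UniformSpace.Completion (PTensor M N)
  ultra := ultra_completion _
  smul_bound := smul_completion _ (norm_smul_pt_le M N)

/-- The canonical map from the algebraic to the completed tensor product. -/
def toTensor (M N : BanMod R) : M ⊗[R] N →ₗ[R] tensor M N where
  toFun t := ((show PTensor M N from t : PTensor M N) : UniformSpace.Completion (PTensor M N))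
  map_add' s t := UniformSpace.Completion.coe_add (α := PTensor M N) s t
  map_smul' r t := UniformSpace.Completion.coe_smul (X := PTensor M N) r t

/-- The pure tensor `m ⊗ n` in the completed tensor product. -/
def tmul {M N : BanMod R} (m : M) (n : N) : tensor M N := toTensor M N (m ⊗ₜ[R] n)

lemma norm_tmul_le {M N : BanMod R} (m : M) (n : N) : ‖tmul m n‖ ≤ ‖m‖ * ‖n‖ := by
  refine (UniformSpace.Completion.norm_coe (E := PTensor M N) _).trans_le ?_
  exact ptNorm_le (by positivity) (AddSubgroup.subset_closure ⟨m, n, le_rfl, rfl⟩)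

lemma tmul_add {M N : BanMod R} (m : M) (n n' : N) : tmul m (n + n') = tmul m n + tmul m n' := by
  simp [tmul, TensorProduct.tmul_add]

lemma add_tmul {M N : BanMod R} (m m' : M) (n : N) : tmul (m + m') n = tmul m n + tmul m' n := by
  simp [tmul, TensorProduct.add_tmul]

lemma smul_tmul {M N : BanMod R} (r : R) (m : M) (n : N) : tmul (r • m) n = r • tmul m n := by
  simp [tmul, ← TensorProduct.smul_tmul']

lemma tmul_smul {M N : BanMod R} (r : R) (m : M) (n : N) : tmul m (r • n) = r • tmul m n := by
  simp [tmul]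

lemma tensor_induction {M N : BanMod R} {p : tensor M N → Prop} (hp : IsClosed {t | p t})
    (h0 : p 0) (hadd : ∀ s t, p s → p t → p (s + t)) (ht : ∀ m n, p (tmul m n)) (t) : p t := by
  refine UniformSpace.Completion.induction_on (α := PTensor M N) t hp fun t => ?_
  refine TensorProduct.induction_on (motive := fun t : M ⊗[R] N => p (toTensor M N t)) t ?_ ?_ ?_
  · rwa [map_zero]
  · exact ht
  · intro x y hx hy
    rw [map_add]
    exact hadd _ _ hx hy

lemma tensor_ext {M N P : BanMod R} {f g : tensor M N ⟶ P}
    (h : ∀ m n, lin f (tmul m n) = lin g (tmul m n)) : f = g := by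
  ext t
  refine tensor_induction (p := fun t => lin f t = lin g t)
    (isClosed_eq (continuous_lin f) (continuous_lin g)) (by simp) ?_ h t
  intro s t hs ht
  rw [map_add, map_add, hs, ht]

lemma liftAux_bound {M N P : BanMod R} (b : M →ₗ[R] N →ₗ[R] P) {C : ℝ} (hC : 0 ≤ C)
    (h : ∀ m n, ‖b m n‖ ≤ C * ‖m‖ * ‖n‖) (t : PTensor M N) :
    ‖TensorProduct.lift b t‖ ≤ C * ‖t‖ := by
  have key : ∀ c : ℝ, ‖t‖ < c → ‖TensorProduct.lift b t‖ ≤ C * c := by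
    intro c hc
    have hc0 : 0 ≤ c := (norm_nonneg t).trans hc.le
    refine AddSubgroup.closure_induction (G := PTensor M N)
      (p := fun t _ => ‖TensorProduct.lift b t‖ ≤ C * c)
      ?_ ?_ ?_ ?_ (mem_ptBall_of_lt (M := M) (N := N) hc)
    · rintro _ ⟨m, n, hmn, rfl⟩
      rw [TensorProduct.lift.tmul]
      exact (h m n).trans (by rw [mul_assoc]; gcongr)
    · refine (norm_zero (E := P)).le.trans' ?_ |>.trans (by positivity)
      exact (congrArg norm (map_zero (TensorProduct.lift b))).le
    · intro x y _ _ hx hy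
      refine (congrArg norm (map_add (TensorProduct.lift b) x y)).le.trans ?_
      exact (IsUltrametricDist.norm_add_le_max _ _).trans (max_le hx hy)
    · intro x _ hx
      refine (congrArg norm (map_neg (TensorProduct.lift b) x)).le.trans ?_
      rwa [norm_neg]
  refine le_of_forall_pos_le_add fun e he => ?_
  have hK : 0 < C + 1 := by positivity
  refine (key (‖t‖ + e / (C + 1)) (by linarith [div_pos he hK])).trans ?_
  rw [mul_add]
  gcongr
  rw [mul_div_assoc', div_le_iff₀ hK]
  nlinarith

/-- The underlying additive map of the extension of a bounded bilinear map. -/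
def liftAdd {M N P : BanMod R} (b : M →ₗ[R] N →ₗ[R] P)
    (h : ∃ C : ℝ, 0 ≤ C ∧ ∀ m n, ‖b m n‖ ≤ C * ‖m‖ * ‖n‖) : tensor M N →+ P :=
  AddMonoidHom.extension (α := PTensor M N) (TensorProduct.lift b).toAddMonoidHom
    (continuous_of_bound _ (by
      obtain ⟨C, hC, h⟩ := h
      exact ⟨C, liftAux_bound b hC h⟩))

lemma liftAdd_coe {M N P : BanMod R} (b : M →ₗ[R] N →ₗ[R] P) (h) (t : M ⊗[R] N) :
    liftAdd b h (toTensor M N t) = TensorProduct.lift b t :=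
  AddMonoidHom.extension_coe (α := PTensor M N) (TensorProduct.lift b).toAddMonoidHom _ t

lemma continuous_liftAdd {M N P : BanMod R} (b : M →ₗ[R] N →ₗ[R] P) (h) :
    Continuous (liftAdd b h) :=
  AddMonoidHom.continuous_extension (α := PTensor M N) (TensorProduct.lift b).toAddMonoidHom _

instance (M : BanMod R) : ContinuousConstSMul R M where
  continuous_const_smul r := by
    obtain ⟨C, -, h⟩ := M.exists_smul_bound
    exact continuous_of_bound (DistribSMul.toAddMonoidHom M r) ⟨C * ‖r‖, fun t => h r t⟩

lemma norm_liftAdd_le {M N P : BanMod R} (b : M →ₗ[R] N →ₗ[R] P) {C : ℝ} (hC : 0 ≤ C)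
    (h : ∀ m n, ‖b m n‖ ≤ C * ‖m‖ * ‖n‖) (t : tensor M N) :
    ‖liftAdd b ⟨C, hC, h⟩ t‖ ≤ C * ‖t‖ := by
  refine UniformSpace.Completion.induction_on (α := PTensor M N) t
    (isClosed_le ((continuous_liftAdd b ⟨C, hC, h⟩).norm)
      (continuous_const.mul continuous_norm)) fun t => ?_
  refine (congrArg norm (liftAdd_coe b ⟨C, hC, h⟩ t)).le.trans ?_
  refine (liftAux_bound b hC h t).trans ?_
  rw [← UniformSpace.Completion.norm_coe (E := PTensor M N) t]
  rfl

/-- The universal property of the completed tensor product: a bounded bilinear map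
`M × N → P` extends to a morphism `M ⊗ N ⟶ P`. -/
def lift {M N P : BanMod R} (b : M →ₗ[R] N →ₗ[R] P)
    (h : ∃ C : ℝ, 0 ≤ C ∧ ∀ m n, ‖b m n‖ ≤ C * ‖m‖ * ‖n‖) : tensor M N ⟶ P :=
  ofLin
    { liftAdd b h with
      map_smul' := fun r t => by
        refine tensor_induction (p := fun t => liftAdd b h (r • t) = r • liftAdd b h t)
          (isClosed_eq ((continuous_liftAdd b h).comp (continuous_const_smul r))
            ((continuous_liftAdd b h).const_smul r)) (by simp) ?_ ?_ t
        · intro s t hs ht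
          rw [smul_add, map_add, hs, ht, map_add, smul_add]
        · intro m n
          rw [← smul_tmul]
          simp only [tmul, liftAdd_coe, TensorProduct.lift.tmul, map_smul, LinearMap.smul_apply] }
    (by
      obtain ⟨C, hC, h⟩ := h
      exact ⟨C, norm_liftAdd_le b hC h⟩)

@[simp] lemma lift_tmul {M N P : BanMod R} (b : M →ₗ[R] N →ₗ[R] P) (h) (m : M) (n : N) :
    lin (lift b h) (tmul m n) = b m n :=
  liftAdd_coe b h (m ⊗ₜ[R] n)

lemma norm_lift_le {M N P : BanMod R} (b : M →ₗ[R] N →ₗ[R] P) (h) {C : ℝ} (hC : 0 ≤ C)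
    (h' : ∀ m n, ‖b m n‖ ≤ C * ‖m‖ * ‖n‖) (t : tensor M N) : ‖lin (lift b h) t‖ ≤ C * ‖t‖ :=
  norm_liftAdd_le b hC h' t

/-- Pure tensors as a bilinear map. -/
def tmulₗ (M N : BanMod R) : M →ₗ[R] N →ₗ[R] tensor M N :=
  LinearMap.mk₂ R tmul add_tmul smul_tmul tmul_add (fun r m n => tmul_smul r m n)

@[simp] lemma tmulₗ_apply {M N : BanMod R} (m : M) (n : N) : tmulₗ M N m n = tmul m n := rfl

/-- The tensor product of two morphisms. -/
def tensorMap {M N M' N' : BanMod R} (f : M ⟶ M') (g : N ⟶ N') : tensor M N ⟶ tensor M' N' :=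
  lift ((tmulₗ M' N').compl₁₂ (lin f) (lin g)) (by
    obtain ⟨C, hC, hf⟩ := exists_bound f
    obtain ⟨D, hD, hg⟩ := exists_bound g
    refine ⟨C * D, by positivity, fun m n => (norm_tmul_le _ _).trans ?_⟩
    calc ‖lin f m‖ * ‖lin g n‖ ≤ (C * ‖m‖) * (D * ‖n‖) := by gcongr; exacts [hf m, hg n]
      _ = _ := by ring)

@[simp] lemma tensorMap_tmul {M N M' N' : BanMod R} (f : M ⟶ M') (g : N ⟶ N') (m : M) (n : N) :
    lin (tensorMap f g) (tmul m n) = tmul (lin f m) (lin g n) :=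
  lift_tmul _ _ m n

/-- For fixed `p`, the map `M ⊗ N ⟶ M ⊗ (N ⊗ P)`, `m ⊗ n ↦ m ⊗ (n ⊗ p)`. -/
def assocAux {M N P : BanMod R} (p : P) : tensor M N ⟶ tensor M (tensor N P) :=
  lift (LinearMap.mk₂ R (fun m n => tmul m (tmul n p)) (by simp [add_tmul]) (by simp [smul_tmul])
    (by simp [add_tmul, tmul_add]) (by simp [smul_tmul, tmul_smul]))
    ⟨‖p‖, norm_nonneg p, fun m n => (norm_tmul_le _ _).trans (by
      calc ‖m‖ * ‖tmul n p‖ ≤ ‖m‖ * (‖n‖ * ‖p‖) := by gcongr; exact norm_tmul_le _ _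
        _ = _ := by ring)⟩

@[simp] lemma assocAux_tmul {M N P : BanMod R} (p : P) (m : M) (n : N) :
    lin (assocAux p) (tmul m n) = tmul m (tmul n p) := lift_tmul _ _ m n

lemma norm_assocAux_le {M N P : BanMod R} (p : P) (t : tensor M N) :
    ‖lin (assocAux p) t‖ ≤ ‖p‖ * ‖t‖ :=
  norm_lift_le _ _ (norm_nonneg p) (fun m n => (norm_tmul_le _ _).trans (by
      calc ‖m‖ * ‖tmul n p‖ ≤ ‖m‖ * (‖n‖ * ‖p‖) := by gcongr; exact norm_tmul_le _ _
        _ = _ := by ring)) t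

/-- For fixed `m`, the map `N ⊗ P ⟶ (M ⊗ N) ⊗ P`, `n ⊗ p ↦ (m ⊗ n) ⊗ p`. -/
def assocInvAux {M N P : BanMod R} (m : M) : tensor N P ⟶ tensor (tensor M N) P :=
  lift (LinearMap.mk₂ R (fun n p => tmul (tmul m n) p) (by simp [add_tmul, tmul_add])
    (by simp [smul_tmul, tmul_smul]) (by simp [tmul_add]) (by simp [tmul_smul]))
    ⟨‖m‖, norm_nonneg m, fun n p => (norm_tmul_le _ _).trans (by
      gcongr; exact norm_tmul_le _ _)⟩

@[simp] lemma assocInvAux_tmul {M N P : BanMod R} (m : M) (n : N) (p : P) :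
    lin (assocInvAux m) (tmul n p) = tmul (tmul m n) p := lift_tmul _ _ n p

lemma norm_assocInvAux_le {M N P : BanMod R} (m : M) (t : tensor N P) :
    ‖lin (assocInvAux m) t‖ ≤ ‖m‖ * ‖t‖ :=
  norm_lift_le _ _ (norm_nonneg m) (fun n p => (norm_tmul_le _ _).trans (by
      gcongr; exact norm_tmul_le _ _)) t

lemma lin_eq_of_tmul {M N P : BanMod R} (f : tensor M N →ₗ[R] P) (g : tensor M N →ₗ[R] P)
    (hf : ∃ C : ℝ, ∀ t, ‖f t‖ ≤ C * ‖t‖) (hg : ∃ C : ℝ, ∀ t, ‖g t‖ ≤ C * ‖t‖)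
    (h : ∀ m n, f (tmul m n) = g (tmul m n)) (t) : f t = g t :=
  congrArg (fun k => lin k t) (tensor_ext (f := ofLin f hf) (g := ofLin g hg) h)

/-- The associator. -/
def assocHom (M N P : BanMod R) : tensor (tensor M N) P ⟶ tensor M (tensor N P) :=
  lift (LinearMap.mk₂ R (fun t p => lin (assocAux p) t) (by simp) (by simp)
    (fun t p q => by
      have h : ∃ C : ℝ, ∀ t : tensor M N,
          ‖(lin (assocAux p) + lin (assocAux q) : tensor M N →ₗ[R] tensor M (tensor N P)) t‖
            ≤ C * ‖t‖ := by
        refine ⟨‖p‖ + ‖q‖, fun t => (norm_add_le _ _).trans ?_⟩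
        rw [add_mul]
        exact add_le_add (norm_assocAux_le p t) (norm_assocAux_le q t)
      exact lin_eq_of_tmul _ (lin (assocAux p) + lin (assocAux q)) (bound_lin _) h
        (by simp [tmul_add]) t)
    (fun r t p => by
      have h : ∃ C : ℝ, ∀ t : tensor M N,
          ‖(r • lin (assocAux p) : tensor M N →ₗ[R] tensor M (tensor N P)) t‖
            ≤ C * ‖t‖ := by
        obtain ⟨C, hC, h⟩ := (tensor M (tensor N P)).exists_smul_bound
        refine ⟨C * ‖r‖ * ‖p‖, fun t => (h r _).trans ?_⟩
        rw [mul_assoc (C * ‖r‖)]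
        gcongr
        exact norm_assocAux_le p t
      exact lin_eq_of_tmul _ (r • lin (assocAux p)) (bound_lin _) h (by simp [tmul_smul]) t))
    ⟨1, zero_le_one, fun t p => (norm_assocAux_le p t).trans (by rw [one_mul, mul_comm])⟩

@[simp] lemma assocHom_tmul {M N P : BanMod R} (m : M) (n : N) (p : P) :
    lin (assocHom M N P) (tmul (tmul m n) p) = tmul m (tmul n p) :=
  (lift_tmul _ _ (tmul m n) p).trans (assocAux_tmul p m n)

/-- The inverse of the associator. -/
def assocInv (M N P : BanMod R) : tensor M (tensor N P) ⟶ tensor (tensor M N) P :=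
  lift (LinearMap.mk₂ R (fun m t => lin (assocInvAux m) t)
    (fun p q t => by
      have h : ∃ C : ℝ, ∀ t : tensor N P,
          ‖(lin (assocInvAux p) + lin (assocInvAux q) :
            tensor N P →ₗ[R] tensor (tensor M N) P) t‖ ≤ C * ‖t‖ := by
        refine ⟨‖p‖ + ‖q‖, fun t => (norm_add_le _ _).trans ?_⟩
        rw [add_mul]
        exact add_le_add (norm_assocInvAux_le p t) (norm_assocInvAux_le q t)
      exact lin_eq_of_tmul _ (lin (assocInvAux p) + lin (assocInvAux q)) (bound_lin _) h
        (by simp [add_tmul]) t)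
    (fun r p t => by
      have h : ∃ C : ℝ, ∀ t : tensor N P,
          ‖(r • lin (assocInvAux p) : tensor N P →ₗ[R] tensor (tensor M N) P) t‖
            ≤ C * ‖t‖ := by
        obtain ⟨C, hC, h⟩ := (tensor (tensor M N) P).exists_smul_bound
        refine ⟨C * ‖r‖ * ‖p‖, fun t => (h r _).trans ?_⟩
        rw [mul_assoc (C * ‖r‖)]
        gcongr
        exact norm_assocInvAux_le p t
      exact lin_eq_of_tmul _ (r • lin (assocInvAux p)) (bound_lin _) h (by simp [smul_tmul]) t)
    (by simp) (by simp))
    ⟨1, zero_le_one, fun m t => (norm_assocInvAux_le m t).trans (by rw [one_mul])⟩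

@[simp] lemma assocInv_tmul {M N P : BanMod R} (m : M) (n : N) (p : P) :
    lin (assocInv M N P) (tmul m (tmul n p)) = tmul (tmul m n) p :=
  (lift_tmul _ _ m (tmul n p)).trans (assocInvAux_tmul m n p)

/-- Morphisms out of a triple tensor product are determined on pure tensors. -/
lemma tensor_ext₃ {M N P Q : BanMod R} {f g : tensor (tensor M N) P ⟶ Q}
    (h : ∀ m n p, lin f (tmul (tmul m n) p) = lin g (tmul (tmul m n) p)) : f = g := by
  refine tensor_ext fun t p => ?_
  have hb : ∀ k : tensor (tensor M N) P ⟶ Q, ∃ C : ℝ, ∀ t,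
      ‖(lin k ∘ₗ (tmulₗ (tensor M N) P).flip p) t‖ ≤ C * ‖t‖ := by
    intro k
    obtain ⟨C, hC, hk⟩ := exists_bound k
    refine ⟨C * ‖p‖, fun t => (hk _).trans ?_⟩
    rw [mul_assoc, mul_comm ‖p‖]
    gcongr
    exact norm_tmul_le t p
  exact lin_eq_of_tmul (lin f ∘ₗ (tmulₗ (tensor M N) P).flip p)
    (lin g ∘ₗ (tmulₗ (tensor M N) P).flip p) (hb f) (hb g) (fun m n => h m n p) t

lemma tensor_ext₃' {M N P Q : BanMod R} {f g : tensor M (tensor N P) ⟶ Q}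
    (h : ∀ m n p, lin f (tmul m (tmul n p)) = lin g (tmul m (tmul n p))) : f = g := by
  have h1 : assocHom M N P ≫ f = assocHom M N P ≫ g := tensor_ext₃ (by simpa using h)
  have h2 : assocInv M N P ≫ assocHom M N P = 𝟙 _ := by
    refine tensor_ext fun m t => ?_
    have hb : ∀ k : tensor M (tensor N P) ⟶ tensor M (tensor N P), ∃ C : ℝ, ∀ t,
        ‖(lin k ∘ₗ tmulₗ M (tensor N P) m) t‖ ≤ C * ‖t‖ := by
      intro k
      obtain ⟨C, hC, hk⟩ := exists_bound k
      refine ⟨C * ‖m‖, fun t => (hk _).trans ?_⟩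
      rw [mul_assoc]
      gcongr
      exact norm_tmul_le m t
    exact lin_eq_of_tmul (lin (assocInv M N P ≫ assocHom M N P) ∘ₗ tmulₗ M (tensor N P) m)
      (lin (𝟙 _) ∘ₗ tmulₗ M (tensor N P) m) (hb _) (hb _) (by simp) t
  calc f = (assocInv M N P ≫ assocHom M N P) ≫ f := by rw [h2, Category.id_comp]
    _ = (assocInv M N P ≫ assocHom M N P) ≫ g := by rw [Category.assoc, h1, Category.assoc]
    _ = g := by rw [h2, Category.id_comp]

lemma tensor_ext₄ {M N P Q S : BanMod R} {f g : tensor (tensor (tensor M N) P) Q ⟶ S}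
    (h : ∀ m n p q, lin f (tmul (tmul (tmul m n) p) q) = lin g (tmul (tmul (tmul m n) p) q)) :
    f = g := by
  refine tensor_ext fun t q => ?_
  have hb : ∀ k : tensor (tensor (tensor M N) P) Q ⟶ S, ∃ C : ℝ, ∀ t,
      ‖(lin k ∘ₗ (tmulₗ (tensor (tensor M N) P) Q).flip q) t‖ ≤ C * ‖t‖ := by
    intro k
    obtain ⟨C, hC, hk⟩ := exists_bound k
    refine ⟨C * ‖q‖, fun t => (hk _).trans ?_⟩
    rw [mul_assoc, mul_comm ‖q‖]
    gcongr
    exact norm_tmul_le t q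
  exact congrArg (fun k => lin k t) (tensor_ext₃
    (f := ofLin (lin f ∘ₗ (tmulₗ (tensor (tensor M N) P) Q).flip q) (hb f))
    (g := ofLin (lin g ∘ₗ (tmulₗ (tensor (tensor M N) P) Q).flip q) (hb g))
    (fun m n p => h m n p q))

/-- The symmetry `M ⊗ N ⟶ N ⊗ M`. -/
def swap (M N : BanMod R) : tensor M N ⟶ tensor N M :=
  lift (tmulₗ N M).flip ⟨1, zero_le_one, fun m n => (norm_tmul_le n m).trans_eq (by ring)⟩

@[simp] lemma swap_tmul {M N : BanMod R} (m : M) (n : N) : lin (swap M N) (tmul m n) = tmul n m :=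
  lift_tmul _ _ m n

/-- The braiding `M ⊗ N ≅ N ⊗ M`. -/
def swapIso (M N : BanMod R) : tensor M N ≅ tensor N M where
  hom := swap M N
  inv := swap N M
  hom_inv_id := tensor_ext (by simp)
  inv_hom_id := tensor_ext (by simp)

/-- The associator as an isomorphism. -/
def assocIso (M N P : BanMod R) : tensor (tensor M N) P ≅ tensor M (tensor N P) where
  hom := assocHom M N P
  inv := assocInv M N P
  hom_inv_id := tensor_ext₃ (by simp)
  inv_hom_id := tensor_ext₃' (by simp)

lemma tensorMap_id (M N : BanMod R) : tensorMap (𝟙 M) (𝟙 N) = 𝟙 (tensor M N) :=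
  tensor_ext (by simp)

lemma tensorMap_comp {M N M' N' M'' N'' : BanMod R} (f : M ⟶ M') (g : N ⟶ N') (f' : M' ⟶ M'')
    (g' : N' ⟶ N'') : tensorMap f g ≫ tensorMap f' g' = tensorMap (f ≫ f') (g ≫ g') :=
  tensor_ext (by simp)

lemma assocHom_naturality {M N P M' N' P' : BanMod R} (f : M ⟶ M') (g : N ⟶ N') (h : P ⟶ P') :
    tensorMap (tensorMap f g) h ≫ assocHom M' N' P' =
      assocHom M N P ≫ tensorMap f (tensorMap g h) :=
  tensor_ext₃ (by simp)

lemma pentagon_aux (M N P Q : BanMod R) :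
    tensorMap (assocHom M N P) (𝟙 Q) ≫ assocHom M (tensor N P) Q ≫ tensorMap (𝟙 M) (assocHom N P Q)
      = assocHom (tensor M N) P Q ≫ assocHom M N (tensor P Q) :=
  tensor_ext₄ (by simp)

end

section

variable (R : Type u) [NormedCommRing R] [IsUltrametricDist R] [CompleteSpace R]

/-- The ring `R` as a Banach module over itself. -/
def unit : BanMod R where
  carrier := R
  smul_bound := ⟨1, fun r m => by rw [one_mul]; exact norm_mul_le r m⟩

variable {R}

/-- The unit element of `R`, as an element of the unit object. -/
def one : unit R := (1 : R)

/-- The left unitor `R ⊗ M ⟶ M`, `r ⊗ m ↦ r • m`. -/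
def leftUnitHom (M : BanMod R) : tensor (unit R) M ⟶ M :=
  lift (M := unit R) (LinearMap.lsmul R M : R →ₗ[R] M →ₗ[R] M) (by
    obtain ⟨C, hC, h⟩ := M.exists_smul_bound
    exact ⟨C, hC, h⟩)

@[simp] lemma leftUnitHom_tmul (M : BanMod R) (r : unit R) (m : M) :
    lin (leftUnitHom M) (tmul r m) = (show R from r) • m := lift_tmul _ _ _ _

/-- The left unitor as an isomorphism, with inverse `m ↦ 1 ⊗ m`. -/
def leftUnit (M : BanMod R) : tensor (unit R) M ≅ M where
  hom := leftUnitHom M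
  inv := ofLin (tmulₗ (unit R) M one) ⟨‖(one : unit R)‖, fun m => norm_tmul_le one m⟩
  hom_inv_id := tensor_ext fun r m => by
    rw [lin_comp, leftUnitHom_tmul]
    exact (tmul_smul (M := unit R) (r : R) one m).trans
      ((smul_tmul (M := unit R) (r : R) one m).symm.trans
        (congrArg (fun s : unit R => tmul s m) (mul_one (show R from r))))
  inv_hom_id := by
    ext m
    exact (leftUnitHom_tmul M one m).trans (one_smul R m)

lemma triangle_aux (M N : BanMod R) :
    assocHom M (unit R) N ≫ tensorMap (𝟙 M) (leftUnitHom N) =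
      tensorMap (swap M (unit R) ≫ leftUnitHom M) (𝟙 N) :=
  tensor_ext₃ fun m r n => by
    simp only [lin_comp, assocHom_tmul, tensorMap_tmul, leftUnitHom_tmul, swap_tmul, lin_id]
    exact (tmul_smul (R := R) _ m n).trans (smul_tmul (R := R) _ m n).symm

lemma leftUnitHom_naturality {M N : BanMod R} (f : M ⟶ N) :
    tensorMap (𝟙 (unit R)) f ≫ leftUnitHom N = leftUnitHom M ≫ f :=
  tensor_ext fun r m => by
    simp only [lin_comp, tensorMap_tmul, leftUnitHom_tmul, lin_id]
    exact (map_smul (lin f) (show R from r) m).symm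

lemma rightUnitHom_naturality {M N : BanMod R} (f : M ⟶ N) :
    tensorMap f (𝟙 (unit R)) ≫ swap N (unit R) ≫ leftUnitHom N =
      (swap M (unit R) ≫ leftUnitHom M) ≫ f :=
  tensor_ext fun m r => by
    simp only [lin_comp, tensorMap_tmul, swap_tmul, leftUnitHom_tmul, lin_id]
    exact (map_smul (lin f) (show R from r) m).symm

instance : MonoidalCategoryStruct (BanMod R) where
  tensorObj := tensor
  whiskerLeft M _ _ f := tensorMap (𝟙 M) f
  whiskerRight f N := tensorMap f (𝟙 N)
  tensorHom := tensorMap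
  tensorUnit := unit R
  associator := assocIso
  leftUnitor := leftUnit
  rightUnitor M := swapIso M (unit R) ≪≫ leftUnit M

/-- The symmetric monoidal category of Banach modules with the completed projective tensor
product. -/
instance : MonoidalCategory (BanMod R) := MonoidalCategory.ofTensorHom
  (id_tensorHom_id := tensorMap_id)
  (tensorHom_comp_tensorHom := tensorMap_comp)
  (associator_naturality := assocHom_naturality)
  (leftUnitor_naturality := leftUnitHom_naturality)
  (rightUnitor_naturality := rightUnitHom_naturality)
  (pentagon := pentagon_aux)
  (triangle := triangle_aux)

instance : BraidedCategory (BanMod R) where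
  braiding := swapIso
  braiding_naturality_right M _ _ f :=
    tensor_ext (f := tensorMap (𝟙 M) f ≫ swap _ _) (g := swap _ _ ≫ tensorMap f (𝟙 M)) (by simp)
  braiding_naturality_left f N :=
    tensor_ext (f := tensorMap f (𝟙 N) ≫ swap _ _) (g := swap _ _ ≫ tensorMap (𝟙 N) f) (by simp)
  hexagon_forward M N P :=
    tensor_ext₃ (f := assocHom M N P ≫ swap M (tensor N P) ≫ assocHom N P M)
      (g := tensorMap (swap M N) (𝟙 P) ≫ assocHom N M P ≫ tensorMap (𝟙 N) (swap M P)) (by simp)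
  hexagon_reverse M N P :=
    tensor_ext₃' (f := assocInv M N P ≫ swap (tensor M N) P ≫ assocInv P M N)
      (g := tensorMap (𝟙 M) (swap N P) ≫ assocInv M P N ≫ tensorMap (swap M P) (𝟙 N)) (by simp)

instance : SymmetricCategory (BanMod R) where
  symmetry M N := (swapIso M N).hom_inv_id

end

end BanMod

/-! ### Ind-objects -/

/-- An ind-object of `C`: a formal colimit of a small filtered diagram in `C`. -/
structure IndObj (C : Type w) [Category.{v} C] where
  J : Type v
  [cat : SmallCategory J]
  [filtered : IsFiltered J]
  diag : J ⥤ C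

namespace IndObj

attribute [instance] cat filtered

instance {C : Type w} [Category.{v} C] (X : IndObj C) : Nonempty X.J := IsFiltered.nonempty

section

variable {C : Type w} [Category.{v} C]

/-- Two morphisms from `A` to members of the diagram `Y` are identified if they become equal
further along the diagram. -/
def homToSetoid (A : C) (Y : IndObj C) : Setoid (Σ j : Y.J, A ⟶ Y.diag.obj j) where
  r p q := ∃ (k : Y.J) (a : p.1 ⟶ k) (b : q.1 ⟶ k), p.2 ≫ Y.diag.map a = q.2 ≫ Y.diag.map b
  iseqv :=
    { refl := fun p => ⟨p.1, 𝟙 _, 𝟙 _, rfl⟩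
      symm := fun ⟨k, a, b, h⟩ => ⟨k, b, a, h.symm⟩
      trans := by
        rintro p q r ⟨k, a, b, h⟩ ⟨l, c, d, h'⟩
        obtain ⟨m, e, f, hm⟩ := IsFiltered.span b c
        refine ⟨m, a ≫ e, d ≫ f, ?_⟩
        rw [Functor.map_comp, ← Category.assoc, h, Category.assoc, ← Functor.map_comp, hm,
          Functor.map_comp, ← Category.assoc, h', Category.assoc, ← Functor.map_comp] }

/-- The set `colim_j Hom(A, Y_j)`. -/
def HomTo (A : C) (Y : IndObj C) : Type v := Quotient (homToSetoid A Y)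

/-- The class of a morphism `A ⟶ Y_j` in `colim_j Hom(A, Y_j)`. -/
def HomTo.mk {A : C} {Y : IndObj C} (j : Y.J) (f : A ⟶ Y.diag.obj j) : HomTo A Y :=
  Quotient.mk (homToSetoid A Y) ⟨j, f⟩

lemma HomTo.mk_eq_mk {A : C} {Y : IndObj C} {j j' : Y.J} {f : A ⟶ Y.diag.obj j}
    {f' : A ⟶ Y.diag.obj j'} : HomTo.mk j f = HomTo.mk j' f' ↔
      ∃ (k : Y.J) (a : j ⟶ k) (b : j' ⟶ k), f ≫ Y.diag.map a = f' ≫ Y.diag.map b :=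
  Quotient.eq (r := homToSetoid A Y)

lemma HomTo.mk_map {A : C} {Y : IndObj C} {j j' : Y.J} (f : A ⟶ Y.diag.obj j) (a : j ⟶ j') :
    HomTo.mk j' (f ≫ Y.diag.map a) = HomTo.mk j f :=
  HomTo.mk_eq_mk.2 ⟨j', 𝟙 _, a, by simp⟩

lemma HomTo.exists_mk {A : C} {Y : IndObj C} (x : HomTo A Y) : ∃ j f, x = HomTo.mk j f := by
  obtain ⟨⟨j, f⟩, rfl⟩ := Quotient.exists_rep x
  exact ⟨j, f, rfl⟩

/-- Precomposition on `colim_j Hom(-, Y_j)`. -/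
def HomTo.pre {A B : C} {Y : IndObj C} (g : A ⟶ B) : HomTo B Y → HomTo A Y :=
  Quotient.map (sa := homToSetoid B Y) (sb := homToSetoid A Y) (fun p => ⟨p.1, g ≫ p.2⟩) (by
    rintro p q ⟨k, a, b, h⟩
    exact ⟨k, a, b, by simp only [Category.assoc, h]⟩)

@[simp] lemma HomTo.pre_mk {A B : C} {Y : IndObj C} (g : A ⟶ B) (j : Y.J) (f : B ⟶ Y.diag.obj j) :
    HomTo.pre g (HomTo.mk j f) = HomTo.mk j (g ≫ f) := rfl

@[simp] lemma HomTo.pre_id {A : C} {Y : IndObj C} (x : HomTo A Y) : HomTo.pre (𝟙 A) x = x := by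
  obtain ⟨j, f, rfl⟩ := x.exists_mk
  simp

lemma HomTo.pre_pre {A B D : C} {Y : IndObj C} (g : A ⟶ B) (h : B ⟶ D) (x : HomTo D Y) :
    HomTo.pre g (HomTo.pre h x) = HomTo.pre (g ≫ h) x := by
  obtain ⟨j, f, rfl⟩ := x.exists_mk
  simp

/-- Morphisms of ind-objects: the set `lim_i colim_j Hom(X_i, Y_j)`. -/
@[ext]
structure Hom (X Y : IndObj C) where
  app : ∀ i : X.J, HomTo (X.diag.obj i) Y
  comm : ∀ {i i' : X.J} (a : i ⟶ i'), HomTo.pre (X.diag.map a) (app i') = app i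

/-- Postcomposition with a morphism of ind-objects. -/
def HomTo.post {A : C} {Y Z : IndObj C} (g : Hom Y Z) : HomTo A Y → HomTo A Z :=
  Quotient.lift (s := homToSetoid A Y) (fun p => HomTo.pre p.2 (g.app p.1)) (by
    rintro p q ⟨k, a, b, h⟩
    rw [← g.comm a, ← g.comm b, HomTo.pre_pre, HomTo.pre_pre, h])

@[simp] lemma HomTo.post_mk {A : C} {Y Z : IndObj C} (g : Hom Y Z) (j : Y.J)
    (f : A ⟶ Y.diag.obj j) : HomTo.post g (HomTo.mk j f) = HomTo.pre f (g.app j) := rfl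

lemma HomTo.pre_post {A B : C} {Y Z : IndObj C} (f : A ⟶ B) (g : Hom Y Z) (x : HomTo B Y) :
    HomTo.pre f (HomTo.post g x) = HomTo.post g (HomTo.pre f x) := by
  obtain ⟨j, h, rfl⟩ := x.exists_mk
  simp [HomTo.pre_pre]

instance : Category (IndObj C) where
  Hom := Hom
  id X := ⟨fun i => HomTo.mk i (𝟙 _), fun {i i'} a => by
    rw [HomTo.pre_mk, Category.comp_id, ← Category.id_comp (X.diag.map a), HomTo.mk_map]⟩
  comp f g := ⟨fun i => HomTo.post g (f.app i), fun a => by rw [HomTo.pre_post, f.comm]⟩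
  id_comp f := Hom.ext (funext fun i => by simp)
  comp_id {X Y} f := Hom.ext (funext fun i => by
    obtain ⟨j, h, hj⟩ := (f.app i).exists_mk
    simp [hj])
  assoc f g h := Hom.ext (funext fun i => by
    obtain ⟨j, k, hj⟩ := (f.app i).exists_mk
    simp [hj, HomTo.pre_post])

/-- The component of a morphism of ind-objects. -/
def app {X Y : IndObj C} (f : X ⟶ Y) (i : X.J) : HomTo (X.diag.obj i) Y := Hom.app f i

/-- Constructor for morphisms of ind-objects. -/
def homMk {X Y : IndObj C} (app : ∀ i : X.J, HomTo (X.diag.obj i) Y)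
    (comm : ∀ {i i' : X.J} (a : i ⟶ i'), HomTo.pre (X.diag.map a) (app i') = app i) : X ⟶ Y :=
  Hom.mk app comm

@[simp] lemma app_homMk {X Y : IndObj C} (f : ∀ i : X.J, HomTo (X.diag.obj i) Y) (h) (i : X.J) :
    app (homMk f h) i = f i := rfl

@[ext] lemma hom_ext {X Y : IndObj C} {f g : X ⟶ Y} (h : ∀ i, app f i = app g i) : f = g :=
  Hom.ext (funext h)

lemma pre_app {X Y : IndObj C} (f : X ⟶ Y) {i i' : X.J} (a : i ⟶ i') :
    HomTo.pre (X.diag.map a) (app f i') = app f i := Hom.comm f a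

@[simp] lemma app_id (X : IndObj C) (i : X.J) : app (𝟙 X) i = HomTo.mk i (𝟙 _) := rfl

lemma app_comp {X Y Z : IndObj C} (f : X ⟶ Y) (g : Y ⟶ Z) (i : X.J) :
    app (f ≫ g) i = HomTo.post g (app f i) := rfl

@[simp] lemma HomTo.post_mk' {A : C} {Y Z : IndObj C} (g : Y ⟶ Z) (j : Y.J)
    (f : A ⟶ Y.diag.obj j) : HomTo.post g (HomTo.mk j f) = HomTo.pre f (app g j) := rfl

lemma app_comp_of_eq {X Y Z : IndObj C} (f : X ⟶ Y) (g : Y ⟶ Z) {i : X.J} {j : Y.J}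
    {h : X.diag.obj i ⟶ Y.diag.obj j} (hf : app f i = HomTo.mk j h) :
    app (f ≫ g) i = HomTo.pre h (app g j) := by
  rw [app_comp, hf, HomTo.post_mk']

/-- A morphism of ind-objects given by a map of indices and a compatible family of morphisms. -/
def levelHom {X Y : IndObj C} (s : X.J → Y.J) (s' : ∀ {i i' : X.J}, (i ⟶ i') → (s i ⟶ s i'))
    (f : ∀ i, X.diag.obj i ⟶ Y.diag.obj (s i))
    (h : ∀ {i i' : X.J} (a : i ⟶ i'), X.diag.map a ≫ f i' = f i ≫ Y.diag.map (s' a)) : X ⟶ Y :=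
  homMk (fun i => HomTo.mk (s i) (f i)) (fun a => by rw [HomTo.pre_mk, h, HomTo.mk_map])

@[simp] lemma app_levelHom {X Y : IndObj C} (s : X.J → Y.J)
    (s' : ∀ {i i' : X.J}, (i ⟶ i') → (s i ⟶ s i')) (f : ∀ i, X.diag.obj i ⟶ Y.diag.obj (s i))
    (h) (i : X.J) : app (levelHom s s' f h) i = HomTo.mk (s i) (f i) := rfl

/-- An object of `C` as a constant ind-object. -/
def const (A : C) : IndObj C where
  J := Discrete PUnit.{v + 1}
  diag := (Functor.const _).obj A

instance [Limits.HasZeroMorphisms C] : Limits.HasZeroMorphisms (IndObj C) where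
  zero X Y := ⟨homMk (fun i => HomTo.mk (Classical.arbitrary Y.J) 0) (by simp)⟩
  comp_zero {X Y} f Z := hom_ext fun i => by
    obtain ⟨j, h, hj⟩ := (app f i).exists_mk
    rw [app_comp_of_eq _ _ hj]
    exact congrArg (HomTo.mk _) Limits.comp_zero
  zero_comp X {Y Z} f := hom_ext fun i => by
    obtain ⟨j, h, hj⟩ := (app f (Classical.arbitrary Y.J)).exists_mk
    refine (app_comp_of_eq (Z := Z) _ f (i := i) (h := 0) rfl).trans ?_
    rw [hj, HomTo.pre_mk, Limits.zero_comp]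
    refine HomTo.mk_eq_mk.2 ?_
    exact ⟨IsFiltered.max j _, IsFiltered.leftToMax _ _, IsFiltered.rightToMax _ _, by simp⟩

lemma app_zero [Limits.HasZeroMorphisms C] {X Y : IndObj C} (i : X.J) (j : Y.J) :
    app (0 : X ⟶ Y) i = HomTo.mk j 0 := by
  refine HomTo.mk_eq_mk.2 ?_
  exact ⟨IsFiltered.max _ j, IsFiltered.leftToMax _ _, IsFiltered.rightToMax _ _, by simp⟩

end

section

variable {C : Type w} [Category.{v} C] [MonoidalCategory C]

/-- The tensor product of two ind-objects: the formal colimit of the `X_i ⊗ Y_j`. -/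
def tensor (X Y : IndObj C) : IndObj C where
  J := X.J × Y.J
  diag := X.diag.prod Y.diag ⋙ MonoidalCategory.tensor C

/-- The tensor product on `colim_j Hom(-, Y_j)`. -/
def HomTo.tmul {A B : C} {Y Z : IndObj C} : HomTo A Y → HomTo B Z → HomTo (A ⊗ B) (tensor Y Z) :=
  Quotient.map₂ (sa := homToSetoid A Y) (sb := homToSetoid B Z)
    (sc := homToSetoid (A ⊗ B) (tensor Y Z)) (fun p q => ⟨(p.1, q.1), p.2 ⊗ₘ q.2⟩) (by
      rintro p p' ⟨k, a, b, h⟩ q q' ⟨l, c, d, h'⟩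
      refine ⟨(k, l), (a, c), (b, d), ?_⟩
      change (p.2 ⊗ₘ q.2) ≫ (Y.diag.map a ⊗ₘ Z.diag.map c) =
        (p'.2 ⊗ₘ q'.2) ≫ (Y.diag.map b ⊗ₘ Z.diag.map d)
      rw [tensorHom_comp_tensorHom, tensorHom_comp_tensorHom, h, h'])

@[simp] lemma HomTo.tmul_mk {A B : C} {Y Z : IndObj C} (j : Y.J) (k : Z.J) (f : A ⟶ Y.diag.obj j)
    (g : B ⟶ Z.diag.obj k) : HomTo.tmul (HomTo.mk j f) (HomTo.mk k g) =
      HomTo.mk (Y := tensor Y Z) (j, k) (f ⊗ₘ g) := rfl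

lemma HomTo.pre_tmul {A B A' B' : C} {Y Z : IndObj C} (f : A' ⟶ A) (g : B' ⟶ B) (x : HomTo A Y)
    (y : HomTo B Z) :
    HomTo.pre (f ⊗ₘ g) (HomTo.tmul x y) = HomTo.tmul (HomTo.pre f x) (HomTo.pre g y) := by
  obtain ⟨j, h, rfl⟩ := x.exists_mk
  obtain ⟨k, h', rfl⟩ := y.exists_mk
  simp only [tmul_mk, pre_mk]
  exact congrArg (HomTo.mk (Y := tensor Y Z) (j, k)) (tensorHom_comp_tensorHom ..)

/-- The tensor product of two morphisms of ind-objects. -/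
def tensorMap {X Y X' Y' : IndObj C} (f : X ⟶ X') (g : Y ⟶ Y') : tensor X Y ⟶ tensor X' Y' :=
  homMk (fun i => HomTo.tmul (app f i.1) (app g i.2)) (fun {i i'} a =>
    (HomTo.pre_tmul (X.diag.map a.1) (Y.diag.map a.2) _ _).trans (by rw [pre_app, pre_app]))

lemma app_tensorMap {X Y X' Y' : IndObj C} (f : X ⟶ X') (g : Y ⟶ Y') (i : X.J) (j : Y.J) :
    app (tensorMap f g) (i, j) = HomTo.tmul (app f i) (app g j) := rfl

lemma app_tensorMap_of_eq {X Y X' Y' : IndObj C} (f : X ⟶ X') (g : Y ⟶ Y') {i : X.J} {j : Y.J}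
    {i' : X'.J} {j' : Y'.J} {h : X.diag.obj i ⟶ X'.diag.obj i'} {k : Y.diag.obj j ⟶ Y'.diag.obj j'}
    (hf : app f i = HomTo.mk i' h) (hg : app g j = HomTo.mk j' k) :
    app (tensorMap f g) (i, j) = HomTo.mk (Y := tensor X' Y') (i', j') (h ⊗ₘ k) := by
  rw [app_tensorMap, hf, hg, HomTo.tmul_mk]

/-- The associator, given by the associators of `C`. -/
def assocIso (X Y Z : IndObj C) : tensor (tensor X Y) Z ≅ tensor X (tensor Y Z) where
  hom := levelHom (X := tensor (tensor X Y) Z) (Y := tensor X (tensor Y Z))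
    (fun i => (i.1.1, (i.1.2, i.2))) (fun a => (a.1.1, (a.1.2, a.2))) (fun _ => (α_ _ _ _).hom)
    (fun a => associator_naturality (X.diag.map a.1.1) (Y.diag.map a.1.2) (Z.diag.map a.2))
  inv := levelHom (X := tensor X (tensor Y Z)) (Y := tensor (tensor X Y) Z)
    (fun i => ((i.1, i.2.1), i.2.2)) (fun a => ((a.1, a.2.1), a.2.2)) (fun _ => (α_ _ _ _).inv)
    (fun a => associator_inv_naturality (X.diag.map a.1) (Y.diag.map a.2.1) (Z.diag.map a.2.2))
  hom_inv_id := hom_ext fun ⟨⟨i, j⟩, k⟩ =>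
    congrArg (HomTo.mk (Y := tensor (tensor X Y) Z) ((i, j), k)) (Iso.hom_inv_id (α_ _ _ _))
  inv_hom_id := hom_ext fun ⟨i, ⟨j, k⟩⟩ =>
    congrArg (HomTo.mk (Y := tensor X (tensor Y Z)) (i, (j, k))) (Iso.inv_hom_id (α_ _ _ _))

lemma app_assocIso_hom (X Y Z : IndObj C) (i : X.J) (j : Y.J) (k : Z.J) :
    app (assocIso X Y Z).hom ((i, j), k) = HomTo.mk (Y := tensor X (tensor Y Z)) (i, (j, k))
      (α_ (X.diag.obj i) (Y.diag.obj j) (Z.diag.obj k)).hom := rfl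

/-- The left unitor, given by the left unitors of `C`. -/
def leftUnit (X : IndObj C) : tensor (const (𝟙_ C)) X ≅ X where
  hom := levelHom (X := tensor (const (𝟙_ C)) X) (fun i => i.2) (fun a => a.2)
    (fun i => (λ_ (X.diag.obj i.2)).hom) (fun a =>
      (congrArg (· ≫ _) (id_tensorHom (𝟙_ C) (X.diag.map a.2))).trans
        (leftUnitor_naturality (X.diag.map a.2)))
  inv := levelHom (Y := tensor (const (𝟙_ C)) X) (fun i => (⟨⟨⟩⟩, i)) (fun a => (𝟙 _, a))
    (fun i => (λ_ (X.diag.obj i)).inv) (fun a => (leftUnitor_inv_naturality (X.diag.map a)).trans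
      (congrArg (_ ≫ ·) (id_tensorHom (𝟙_ C) (X.diag.map a)).symm))
  hom_inv_id := hom_ext fun ⟨s, i⟩ =>
    congrArg (HomTo.mk (Y := tensor (const (𝟙_ C)) X) (s, i)) (Iso.hom_inv_id (λ_ _))
  inv_hom_id := hom_ext fun i =>
    congrArg (HomTo.mk (Y := X) i) (Iso.inv_hom_id (λ_ (X.diag.obj i)))

lemma app_leftUnit_hom (X : IndObj C) (s) (i : X.J) :
    app (leftUnit X).hom (s, i) = HomTo.mk i (λ_ (X.diag.obj i)).hom := rfl

lemma app_leftUnit_inv (X : IndObj C) (i : X.J) :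
    app (leftUnit X).inv i = HomTo.mk (Y := tensor (const (𝟙_ C)) X) (⟨⟨⟩⟩, i)
      (λ_ (X.diag.obj i)).inv := rfl

/-- The right unitor, given by the right unitors of `C`. -/
def rightUnit (X : IndObj C) : tensor X (const (𝟙_ C)) ≅ X where
  hom := levelHom (X := tensor X (const (𝟙_ C))) (fun i => i.1) (fun a => a.1)
    (fun i => (ρ_ (X.diag.obj i.1)).hom) (fun a =>
      (congrArg (· ≫ _) (tensorHom_id (X.diag.map a.1) (𝟙_ C))).trans
        (rightUnitor_naturality (X.diag.map a.1)))
  inv := levelHom (Y := tensor X (const (𝟙_ C))) (fun i => (i, ⟨⟨⟩⟩)) (fun a => (a, 𝟙 _))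
    (fun i => (ρ_ (X.diag.obj i)).inv) (fun a => (rightUnitor_inv_naturality (X.diag.map a)).trans
      (congrArg (_ ≫ ·) (tensorHom_id (X.diag.map a) (𝟙_ C)).symm))
  hom_inv_id := hom_ext fun ⟨i, s⟩ =>
    congrArg (HomTo.mk (Y := tensor X (const (𝟙_ C))) (i, s)) (Iso.hom_inv_id (ρ_ _))
  inv_hom_id := hom_ext fun i =>
    congrArg (HomTo.mk (Y := X) i) (Iso.inv_hom_id (ρ_ (X.diag.obj i)))

lemma app_rightUnit_hom (X : IndObj C) (i : X.J) (s) :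
    app (rightUnit X).hom (i, s) = HomTo.mk i (ρ_ (X.diag.obj i)).hom := rfl

instance : MonoidalCategoryStruct (IndObj C) where
  tensorObj := tensor
  whiskerLeft X _ _ f := tensorMap (𝟙 X) f
  whiskerRight f Y := tensorMap f (𝟙 Y)
  tensorHom := tensorMap
  tensorUnit := const (𝟙_ C)
  associator := assocIso
  leftUnitor := leftUnit
  rightUnitor := rightUnit

lemma tensorMap_comp {X Y X' Y' X'' Y'' : IndObj C} (f : X ⟶ X') (g : Y ⟶ Y') (f' : X' ⟶ X'')
    (g' : Y' ⟶ Y'') : tensorMap f g ≫ tensorMap f' g' = tensorMap (f ≫ f') (g ≫ g') :=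
  hom_ext fun ⟨i, j⟩ => by
    obtain ⟨i', h, hf⟩ := (app f i).exists_mk
    obtain ⟨j', k, hg⟩ := (app g j).exists_mk
    rw [app_comp_of_eq _ _ (app_tensorMap_of_eq f g hf hg), app_tensorMap, app_tensorMap,
      app_comp_of_eq _ _ hf, app_comp_of_eq _ _ hg]
    exact HomTo.pre_tmul _ _ _ _

/-- The monoidal structure on ind-objects extending that of `C` and commuting with formal filtered
colimits in each variable. -/
instance : MonoidalCategory (IndObj C) := MonoidalCategory.ofTensorHom
  (id_tensorHom_id := fun X Y => hom_ext fun i => congrArg (HomTo.mk _) (id_tensorHom_id _ _))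
  (tensorHom_comp_tensorHom := tensorMap_comp)
  (associator_naturality := fun {X Y Z X' Y' Z'} f g h => hom_ext fun ⟨⟨i, j⟩, k⟩ => by
    obtain ⟨i', a, hf⟩ := (app f i).exists_mk
    obtain ⟨j', b, hg⟩ := (app g j).exists_mk
    obtain ⟨k', c, hh⟩ := (app h k).exists_mk
    refine (app_comp_of_eq _ _ (app_tensorMap_of_eq _ _ (app_tensorMap_of_eq f g hf hg)
      hh)).trans ?_
    refine Eq.trans ?_ (((app_comp_of_eq _ _ rfl).trans (congrArg (HomTo.pre _)
      (app_tensorMap_of_eq _ _ hf (app_tensorMap_of_eq g h hg hh)))).symm)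
    exact congrArg (HomTo.mk (Y := tensor X' (tensor Y' Z')) (i', (j', k')))
      (associator_naturality a b c))
  (leftUnitor_naturality := fun {X Y} f => hom_ext fun ⟨i, j⟩ => by
    obtain ⟨j', b, hg⟩ := (app f j).exists_mk
    refine (app_comp_of_eq _ _ (app_tensorMap_of_eq _ _ (app_id _ _) hg)).trans ?_
    refine Eq.trans ?_ (((app_comp_of_eq _ _ rfl).trans (congrArg (HomTo.pre _) hg)).symm)
    exact congrArg (HomTo.mk (Y := Y) j') ((id_tensorHom (𝟙_ C) b) ▸ leftUnitor_naturality b))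
  (rightUnitor_naturality := fun {X Y} f => hom_ext fun ⟨j, i⟩ => by
    obtain ⟨j', b, hg⟩ := (app f j).exists_mk
    refine (app_comp_of_eq _ _ (app_tensorMap_of_eq _ _ hg (app_id _ _))).trans ?_
    refine Eq.trans ?_ (((app_comp_of_eq _ _ rfl).trans (congrArg (HomTo.pre _) hg)).symm)
    exact congrArg (HomTo.mk (Y := Y) j') ((tensorHom_id b (𝟙_ C)) ▸ rightUnitor_naturality b))
  (pentagon := fun W X Y Z => hom_ext fun ⟨⟨⟨i, j⟩, k⟩, l⟩ => by
    refine (app_comp_of_eq _ _ (app_tensorMap_of_eq _ _ rfl (app_id _ _))).trans ?_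
    refine (congrArg (HomTo.pre _) ((app_comp_of_eq _ _ rfl).trans (congrArg (HomTo.pre _)
      (app_tensorMap_of_eq _ _ (app_id _ _) rfl)))).trans ?_
    refine Eq.trans ?_ (app_comp_of_eq _ _ rfl).symm
    refine congrArg (HomTo.mk (Y := tensor W (tensor X (tensor Y Z))) (i, (j, (k, l)))) ?_
    have := MonoidalCategory.pentagon (W.diag.obj i) (X.diag.obj j) (Y.diag.obj k) (Z.diag.obj l)
    simp only [← tensorHom_id, ← id_tensorHom] at this
    exact this)
  (triangle := fun X Y => hom_ext fun ⟨⟨i, s⟩, j⟩ => by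
    refine (app_comp_of_eq _ _ rfl).trans ?_
    refine (congrArg (HomTo.pre _) (app_tensorMap_of_eq _ _ (app_id _ _) rfl)).trans ?_
    refine Eq.trans ?_ (app_tensorMap_of_eq (rightUnit X).hom (𝟙 Y) (i := (i, s)) (j := j)
      rfl (app_id _ _)).symm
    refine congrArg (HomTo.mk (Y := tensor X Y) (i, j)) ?_
    have := MonoidalCategory.triangle (X.diag.obj i) (Y.diag.obj j)
    simp only [← tensorHom_id, ← id_tensorHom] at this
    exact this)

end

section

variable {C : Type w} [Category.{v} C] [MonoidalCategory C] [SymmetricCategory C]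

/-- The symmetry, given by the symmetry of `C`. -/
def swapHom (X Y : IndObj C) : tensor X Y ⟶ tensor Y X :=
  levelHom (X := tensor X Y) (Y := tensor Y X) (fun i => (i.2, i.1)) (fun a => (a.2, a.1))
    (fun _ => (β_ _ _).hom)
    (fun a => BraidedCategory.braiding_naturality (X.diag.map a.1) (Y.diag.map a.2))

lemma app_swapHom (X Y : IndObj C) (i : X.J) (j : Y.J) :
    app (swapHom X Y) (i, j) = HomTo.mk (Y := tensor Y X) (j, i)
      (β_ (X.diag.obj i) (Y.diag.obj j)).hom := rfl

lemma swapHom_swapHom (X Y : IndObj C) : swapHom X Y ≫ swapHom Y X = 𝟙 _ :=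
  hom_ext fun ⟨i, j⟩ => congrArg (HomTo.mk (Y := tensor X Y) (i, j))
    (SymmetricCategory.symmetry (X.diag.obj i) (Y.diag.obj j))

lemma swapHom_naturality {X Y X' Y' : IndObj C} (f : X ⟶ X') (g : Y ⟶ Y') :
    tensorMap f g ≫ swapHom X' Y' = swapHom X Y ≫ tensorMap g f :=
  hom_ext fun ⟨i, j⟩ => by
    obtain ⟨i', h, hf⟩ := (app f i).exists_mk
    obtain ⟨j', k, hg⟩ := (app g j).exists_mk
    refine (app_comp_of_eq _ _ (app_tensorMap_of_eq f g hf hg)).trans ?_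
    refine Eq.trans ?_ (((app_comp_of_eq _ _ rfl).trans (congrArg (HomTo.pre _)
      (app_tensorMap_of_eq g f hg hf))).symm)
    exact congrArg (HomTo.mk (Y := tensor Y' X') (j', i')) (BraidedCategory.braiding_naturality h k)

instance : SymmetricCategory (IndObj C) where
  braiding X Y := ⟨swapHom X Y, swapHom Y X, swapHom_swapHom X Y, swapHom_swapHom Y X⟩
  braiding_naturality_right X _ _ f := swapHom_naturality (𝟙 X) f
  braiding_naturality_left f Z := swapHom_naturality f (𝟙 Z)
  hexagon_forward X Y Z := hom_ext fun ⟨⟨i, j⟩, k⟩ => by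
    refine (app_comp_of_eq _ _ rfl).trans ?_
    refine (congrArg (HomTo.pre _) (app_comp_of_eq _ _ rfl)).trans ?_
    refine Eq.trans ?_ (app_comp_of_eq _ _ (app_tensorMap_of_eq _ _ rfl (app_id _ _))).symm
    refine Eq.trans ?_ (congrArg (HomTo.pre _) ((app_comp_of_eq _ _ rfl).trans
      (congrArg (HomTo.pre _) (app_tensorMap_of_eq _ _ (app_id _ _) rfl)))).symm
    refine congrArg (HomTo.mk (Y := tensor Y (tensor Z X)) (j, (k, i))) ?_
    have := BraidedCategory.hexagon_forward (X.diag.obj i) (Y.diag.obj j) (Z.diag.obj k)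
    simp only [← tensorHom_id, ← id_tensorHom] at this
    exact this
  hexagon_reverse X Y Z := hom_ext fun ⟨i, ⟨j, k⟩⟩ => by
    refine (app_comp_of_eq _ _ rfl).trans ?_
    refine (congrArg (HomTo.pre _) (app_comp_of_eq _ _ rfl)).trans ?_
    refine Eq.trans ?_ (app_comp_of_eq _ _ (app_tensorMap_of_eq _ _ (app_id _ _) rfl)).symm
    refine Eq.trans ?_ (congrArg (HomTo.pre _) ((app_comp_of_eq _ _ rfl).trans
      (congrArg (HomTo.pre _) (app_tensorMap_of_eq _ _ rfl (app_id _ _))))).symm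
    refine congrArg (HomTo.mk (Y := tensor (tensor Z X) Y) ((k, i), j)) ?_
    have := BraidedCategory.hexagon_reverse (X.diag.obj i) (Y.diag.obj j) (Z.diag.obj k)
    simp only [← tensorHom_id, ← id_tensorHom] at this
    exact this
  symmetry := swapHom_swapHom

end

end IndObj

/-! ### The functor `V ↦ V̲`, the formal colimit of the `π⁻ⁿ V°`, on ind-Banach spaces -/

section

variable (F : Type u) [NontriviallyNormedField F]

/-- A pseudo-uniformizer of `F`: an element `π` with `0 < ‖π‖ < 1`. -/
def PseudoUniformizer : Type u := {π : F // 0 < ‖π‖ ∧ ‖π‖ < 1}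

variable [IsUltrametricDist F]

/-- The ring `F° = {x | ‖x‖ ≤ 1}` of integers of a non-Archimedean field. -/
def unitBall : Subring F where
  carrier := {x | ‖x‖ ≤ 1}
  mul_mem' {x y} hx hy := by
    exact (norm_mul x y).le.trans (mul_le_one₀ hx (norm_nonneg y) hy)
  one_mem' := by simp
  add_mem' {x y} hx hy := (IsUltrametricDist.norm_add_le_max x y).trans (max_le hx hy)
  zero_mem' := by simp
  neg_mem' {x} hx := by simpa using hx

instance : IsUltrametricDist (unitBall F) := ⟨fun x y z => dist_triangle_max (x : F) y z⟩

instance [CompleteSpace F] : CompleteSpace (unitBall F) := by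
  have h : IsClosed {x : F | ‖x‖ ≤ 1} := isClosed_le continuous_norm continuous_const
  exact h.completeSpace_coe

end

section

variable {F : Type u} [NontriviallyNormedField F]

/-- The underlying element of a pseudo-uniformizer. -/
def PseudoUniformizer.val (π : PseudoUniformizer F) : F := Subtype.val π

lemma PseudoUniformizer.ne_zero (π : PseudoUniformizer F) : π.val ≠ 0 :=
  norm_pos_iff.1 (Subtype.property π).1

lemma PseudoUniformizer.norm_lt_one (π : PseudoUniformizer F) : ‖π.val‖ < 1 :=
  (Subtype.property π).2

variable [IsUltrametricDist F] (π : PseudoUniformizer F)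

/-- The `F°`-submodule `π⁻ⁿ V°` of `V`, where `V° = {v | ‖r • v‖ ≤ 1 for all r ∈ F°}`; if the norm
of `V` satisfies `‖r • v‖ = ‖r‖ ‖v‖`, then `V°` is the unit ball `{v | ‖v‖ ≤ 1}`. -/
def lattice (V : BanMod F) (n : ℕ) : Submodule (unitBall F) V where
  carrier := {v | ∀ r : F, ‖r‖ ≤ 1 → ‖(r * π.val ^ n) • v‖ ≤ 1}
  add_mem' {x y} hx hy r hr := by
    rw [smul_add]
    exact (IsUltrametricDist.norm_add_le_max _ _).trans (max_le (hx r hr) (hy r hr))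
  zero_mem' r _ := by simp
  smul_mem' s x hx r hr := by
    have h := hx (r * s) (by
      rw [norm_mul]
      exact mul_le_one₀ hr (norm_nonneg _) s.2)
    rw [Subring.smul_def, smul_smul, mul_right_comm]
    exact h

variable {π}

lemma mem_lattice {V : BanMod F} {n : ℕ} {v : V} :
    v ∈ lattice π V n ↔ ∀ r : F, ‖r‖ ≤ 1 → ‖(r * π.val ^ n) • v‖ ≤ 1 := Iff.rfl

variable (π)

lemma lattice_mono (V : BanMod F) {n m : ℕ} (h : n ≤ m) : lattice π V n ≤ lattice π V m := by
  obtain ⟨k, rfl⟩ := Nat.exists_eq_add_of_le h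
  intro v hv r hr
  have := hv (r * π.val ^ k) (by
    rw [norm_mul, norm_pow]
    exact mul_le_one₀ hr (by positivity) (pow_le_one₀ (norm_nonneg _) π.norm_lt_one.le))
  rwa [mul_assoc, ← pow_add, add_comm k n] at this

/-- Bounded sets are contained in some `π⁻ⁿ V°`. -/
lemma exists_mem_lattice (V : BanMod F) (c : ℝ) : ∃ n, ∀ v : V, ‖v‖ ≤ c → v ∈ lattice π V n := by
  obtain ⟨C, hC, h⟩ := V.exists_smul_bound
  have hlim : Filter.Tendsto (fun n : ℕ => C * ‖π.val‖ ^ n * |c|) Filter.atTop (nhds 0) := by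
    simpa using ((tendsto_pow_atTop_nhds_zero_of_lt_one (norm_nonneg _)
      π.norm_lt_one).const_mul C).mul_const |c|
  obtain ⟨n, hn⟩ := (hlim.eventually_le_const zero_lt_one).exists
  refine ⟨n, fun v hv r hr => ?_⟩
  calc ‖(r * π.val ^ n) • v‖ ≤ C * ‖r * π.val ^ n‖ * ‖v‖ := h _ _
    _ ≤ C * (1 * ‖π.val‖ ^ n) * |c| := by
        rw [norm_mul, norm_pow]
        gcongr
        exact hv.trans (le_abs_self c)
    _ ≤ 1 := by rwa [one_mul]

lemma bounded_lattice (V : BanMod F) (n : ℕ) : ∃ c : ℝ, ∀ v ∈ lattice π V n, ‖v‖ ≤ c := by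
  obtain ⟨C, hC, h⟩ := V.exists_smul_bound
  refine ⟨C * ‖(π.val ^ n)⁻¹‖, fun v hv => ?_⟩
  have h1 := hv 1 (by simp)
  rw [one_mul] at h1
  calc ‖v‖ = ‖(π.val ^ n)⁻¹ • π.val ^ n • v‖ := by
        rw [inv_smul_smul₀ (pow_ne_zero n π.ne_zero)]
    _ ≤ C * ‖(π.val ^ n)⁻¹‖ * ‖π.val ^ n • v‖ := h _ _
    _ ≤ C * ‖(π.val ^ n)⁻¹‖ * 1 := by gcongr
    _ = _ := mul_one _

lemma isClosed_lattice (V : BanMod F) (n : ℕ) : IsClosed (lattice π V n : Set V) := by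
  have : (lattice π V n : Set V) =
      ⋂ r : {r : F // ‖r‖ ≤ 1}, {v : V | ‖((r : F) * π.val ^ n) • v‖ ≤ 1} := by
    ext v
    simp [mem_lattice]
  rw [this]
  exact isClosed_iInter fun r => isClosed_le (continuous_const_smul _).norm continuous_const

/-- A morphism maps each `π⁻ⁿ V°` into some `π⁻ᵐ W°`. -/
lemma exists_map_lattice {V W : BanMod F} (f : V ⟶ W) (n : ℕ) :
    ∃ m, ∀ v ∈ lattice π V n, BanMod.lin f v ∈ lattice π W m := by
  obtain ⟨c, hc⟩ := bounded_lattice π V n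
  obtain ⟨C, hC, hf⟩ := BanMod.exists_bound f
  obtain ⟨m, hm⟩ := exists_mem_lattice π W (C * c)
  exact ⟨m, fun v hv => hm _ ((hf v).trans (by gcongr; exact hc v hv))⟩

/-- `π⁻ⁿ V°` as a Banach `F°`-module, with the norm of `V`. -/
def latticeObj (V : BanMod F) (n : ℕ) : BanMod (unitBall F) where
  carrier := lattice π V n
  ultra := ⟨fun x y z => dist_triangle_max (x : V) y z⟩
  complete := (isClosed_lattice π V n).completeSpace_coe
  smul_bound := by
    obtain ⟨C, hC⟩ := V.smul_bound
    exact ⟨C, fun r v => hC r v⟩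

variable {π}

/-- The restriction of a morphism to the submodules `π⁻ⁿ V°` and `π⁻ᵐ W°`. -/
def latticeMap {V W : BanMod F} (f : V ⟶ W) {n m : ℕ}
    (h : ∀ v ∈ lattice π V n, BanMod.lin f v ∈ lattice π W m) :
    latticeObj π V n ⟶ latticeObj π W m :=
  BanMod.ofLin (M := latticeObj π V n) (N := latticeObj π W m)
    { toFun := fun v => ⟨BanMod.lin f v.1, h _ v.2⟩
      map_add' := fun v w => Subtype.ext (map_add (BanMod.lin f) v.1 w.1)
      map_smul' := fun r v => Subtype.ext (map_smul (BanMod.lin f) (r : F) v.1) }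
    (by
      obtain ⟨C, hC⟩ := BanMod.bound_lin f
      exact ⟨C, fun v => hC v.1⟩)

/-- The inclusion of `π⁻ⁿ V°` into `V`. -/
def coe {V : BanMod F} {n : ℕ} (v : latticeObj π V n) : V := Subtype.val v

lemma coe_mem {V : BanMod F} {n : ℕ} (v : latticeObj π V n) : coe v ∈ lattice π V n :=
  Subtype.property v

lemma coe_injective {V : BanMod F} {n : ℕ} :
    Function.Injective (coe : latticeObj π V n → V) := Subtype.val_injective

@[simp] lemma coe_latticeMap {V W : BanMod F} (f : V ⟶ W) {n m : ℕ} (h) (v : latticeObj π V n) :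
    coe (BanMod.lin (latticeMap (m := m) f h) v) = BanMod.lin f (coe v) := rfl

variable (π)

/-- Indices of the ind-object `X̲`: pairs `(i, n)`, standing for `π⁻ⁿ Xᵢ°`. -/
structure Index (X : IndObj (BanMod F)) : Type u where
  fst : X.J
  snd : ℕ

/-- An arrow `(i, n) ⟶ (i', n')` is an arrow `i ⟶ i'` whose transition map sends
`π⁻ⁿ Xᵢ°` into `π⁻ⁿ' Xᵢ'°`. -/
abbrev indexCat (X : IndObj (BanMod F)) : SmallCategory (Index X) where
  Hom p q := {u : p.fst ⟶ q.fst // ∀ v ∈ lattice π (X.diag.obj p.fst) p.snd,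
    BanMod.lin (X.diag.map u) v ∈ lattice π (X.diag.obj q.fst) q.snd}
  id p := ⟨𝟙 _, fun v hv => by simpa using hv⟩
  comp u v := ⟨u.1 ≫ v.1, fun x hx => by simpa using v.2 _ (u.2 x hx)⟩

/-- The ind-Banach `F°`-module `X̲`: the formal colimit of the `π⁻ⁿ Xᵢ°`. -/
def underline (X : IndObj (BanMod F)) : IndObj (BanMod (unitBall F)) :=
  letI := indexCat π X
  { J := Index X
    filtered :=
      { nonempty := ⟨⟨Classical.arbitrary _, 0⟩⟩
        cocone_objs := fun ⟨i, n⟩ ⟨i', n'⟩ => by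
          obtain ⟨m, hm⟩ := exists_map_lattice π (X.diag.map (IsFiltered.leftToMax i i')) n
          obtain ⟨m', hm'⟩ := exists_map_lattice π (X.diag.map (IsFiltered.rightToMax i i')) n'
          exact ⟨⟨IsFiltered.max i i', max m m'⟩,
            ⟨_, fun v hv => lattice_mono π _ (le_max_left _ _) (hm v hv)⟩,
            ⟨_, fun v hv => lattice_mono π _ (le_max_right _ _) (hm' v hv)⟩, ⟨⟩⟩
        cocone_maps := fun ⟨i, n⟩ ⟨i', n'⟩ u v => by
          obtain ⟨m, hm⟩ := exists_map_lattice π (X.diag.map (IsFiltered.coeqHom u.1 v.1)) n'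
          exact ⟨⟨_, m⟩, ⟨IsFiltered.coeqHom u.1 v.1, hm⟩,
            Subtype.ext (IsFiltered.coeq_condition u.1 v.1)⟩ }
    diag :=
      { obj := fun p => latticeObj π (X.diag.obj p.fst) p.snd
        map := fun u => latticeMap (X.diag.map u.1) u.2
        map_id := fun p => BanMod.hom_ext fun v => coe_injective (by
          rw [coe_latticeMap]
          exact congrArg (fun k => BanMod.lin k (coe v)) (X.diag.map_id p.fst))
        map_comp := fun u v => BanMod.hom_ext fun x => coe_injective (by
          rw [coe_latticeMap]
          exact congrArg (fun k => BanMod.lin k (coe x)) (X.diag.map_comp u.1 v.1)) } }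

variable {π}

/-- The element of `Xᵢ` underlying an element of the member `(i, n)` of `X̲`. -/
def coeU {X : IndObj (BanMod F)} {p : (underline π X).J} (v : (underline π X).diag.obj p) :
    X.diag.obj p.fst := Subtype.val v

lemma homTo_underline_eq {A : BanMod (unitBall F)} {X : IndObj (BanMod F)}
    {p q : (underline π X).J} (f : A ⟶ (underline π X).diag.obj p)
    (g : A ⟶ (underline π X).diag.obj q) {k : X.J} (a : p.fst ⟶ k) (b : q.fst ⟶ k)
    (h : ∀ x : A, BanMod.lin (X.diag.map a) (coeU (BanMod.lin f x)) =
      BanMod.lin (X.diag.map b) (coeU (BanMod.lin g x))) :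
    IndObj.HomTo.mk (Y := underline π X) p f = IndObj.HomTo.mk q g := by
  obtain ⟨m, hm⟩ := exists_map_lattice π (X.diag.map a) p.snd
  obtain ⟨m', hm'⟩ := exists_map_lattice π (X.diag.map b) q.snd
  refine IndObj.HomTo.mk_eq_mk.2 ⟨⟨k, max m m'⟩,
    ⟨a, fun v hv => lattice_mono π _ (le_max_left _ _) (hm v hv)⟩,
    ⟨b, fun v hv => lattice_mono π _ (le_max_right _ _) (hm' v hv)⟩, ?_⟩
  exact BanMod.hom_ext fun x => Subtype.ext (h x)

/-- The map `colim_j Hom(V, Y_j) → colim_{(j, m)} Hom(π⁻ⁿ V°, π⁻ᵐ Y_j°)` given by restriction. -/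
def homToRestrict {V : BanMod F} {Y : IndObj (BanMod F)} (n : ℕ) :
    IndObj.HomTo V Y → IndObj.HomTo (latticeObj π V n) (underline π Y) :=
  Quotient.lift (s := IndObj.homToSetoid V Y)
    (fun p => IndObj.HomTo.mk (Y := underline π Y) ⟨p.1, (exists_map_lattice π p.2 n).choose⟩
      (latticeMap p.2 (exists_map_lattice π p.2 n).choose_spec))
    (by
      rintro p q ⟨k, a, b, h⟩
      exact homTo_underline_eq _ _ a b fun x => congrArg (fun k => BanMod.lin k (coe x)) h)

lemma homToRestrict_mk {V : BanMod F} {Y : IndObj (BanMod F)} {n m : ℕ} {j : Y.J}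
    (f : V ⟶ Y.diag.obj j) (h : ∀ v ∈ lattice π V n, BanMod.lin f v ∈ lattice π _ m) :
    homToRestrict n (IndObj.HomTo.mk j f) =
      IndObj.HomTo.mk (Y := underline π Y) ⟨j, m⟩ (latticeMap f h) :=
  homTo_underline_eq (X := Y) (p := ⟨j, _⟩) (q := ⟨j, m⟩) _ _ (𝟙 j) (𝟙 j) fun _ => rfl

lemma pre_homToRestrict {V W : BanMod F} {Y : IndObj (BanMod F)} {n m : ℕ} (f : V ⟶ W)
    (h : ∀ v ∈ lattice π V n, BanMod.lin f v ∈ lattice π W m) (x : IndObj.HomTo W Y) :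
    IndObj.HomTo.pre (latticeMap f h) (homToRestrict m x) =
      homToRestrict n (IndObj.HomTo.pre f x) := by
  obtain ⟨j, g, rfl⟩ := x.exists_mk
  obtain ⟨k, hk⟩ := exists_map_lattice π g m
  exact (congrArg (IndObj.HomTo.pre (latticeMap f h)) (homToRestrict_mk g hk)).trans
    (homToRestrict_mk (m := k) (f ≫ g) (fun v hv => hk _ (h v hv))).symm

variable (π)

/-- The morphism `X̲ ⟶ Y̲` induced by a morphism of ind-Banach spaces. -/
def underlineMap {X Y : IndObj (BanMod F)} (f : X ⟶ Y) : underline π X ⟶ underline π Y :=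
  IndObj.homMk (X := underline π X) (fun p => homToRestrict p.snd (IndObj.app f p.fst))
    (fun {p q} u => (pre_homToRestrict (X.diag.map u.1) u.2 _).trans (by rw [IndObj.pre_app]))

lemma app_underlineMap {X Y : IndObj (BanMod F)} (f : X ⟶ Y) {i : X.J} {n m : ℕ} {j : Y.J}
    {g : X.diag.obj i ⟶ Y.diag.obj j} (hf : IndObj.app f i = IndObj.HomTo.mk j g)
    (h : ∀ v ∈ lattice π _ n, BanMod.lin g v ∈ lattice π _ m) :
    IndObj.app (underlineMap π f) ⟨i, n⟩ =
      IndObj.HomTo.mk (Y := underline π Y) ⟨j, m⟩ (latticeMap g h) :=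
  (congrArg (homToRestrict n) hf).trans (homToRestrict_mk g h)

/-- The functor `X ↦ X̲` from ind-Banach spaces over `F` to ind-Banach modules over `F°`. -/
def underlineFunctor : IndObj (BanMod F) ⥤ IndObj (BanMod (unitBall F)) where
  obj := underline π
  map f := underlineMap π f
  map_id X := IndObj.hom_ext fun ⟨i, n⟩ =>
    app_underlineMap π (𝟙 X) (i := i) (n := n) (m := n) (IndObj.app_id X i) (fun _ hv => hv)
  map_comp {X Y Z} f g := IndObj.hom_ext fun ⟨i, n⟩ => by
    obtain ⟨j, a, hf⟩ := (IndObj.app f i).exists_mk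
    obtain ⟨k, b, hg⟩ := (IndObj.app g j).exists_mk
    obtain ⟨m, hm⟩ := exists_map_lattice π a n
    obtain ⟨l, hl⟩ := exists_map_lattice π b m
    have hfg : IndObj.app (f ≫ g) i = IndObj.HomTo.mk k (a ≫ b) := by
      rw [IndObj.app_comp_of_eq _ _ hf, hg, IndObj.HomTo.pre_mk]
    refine (app_underlineMap π _ hfg (m := l) (fun v hv => hl _ (hm v hv))).trans ?_
    rw [IndObj.app_comp_of_eq _ _ (app_underlineMap π f hf hm), app_underlineMap π g hg hl]
    rfl

end

section

variable {F : Type u} [NontriviallyNormedField F] [IsUltrametricDist F]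
variable {π : PseudoUniformizer F}

lemma homTo_underline_eq' {A : BanMod (unitBall F)} {X : IndObj (BanMod F)} {i j : X.J} {n m : ℕ}
    (f : A ⟶ latticeObj π (X.diag.obj i) n) (g : A ⟶ latticeObj π (X.diag.obj j) m) {k : X.J}
    (a : i ⟶ k) (b : j ⟶ k)
    (h : ∀ (l : ℕ) (ha : ∀ v ∈ lattice π (X.diag.obj i) n,
        BanMod.lin (X.diag.map a) v ∈ lattice π (X.diag.obj k) l)
      (hb : ∀ v ∈ lattice π (X.diag.obj j) m,
        BanMod.lin (X.diag.map b) v ∈ lattice π (X.diag.obj k) l),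
      f ≫ latticeMap (X.diag.map a) ha = g ≫ latticeMap (X.diag.map b) hb) :
    IndObj.HomTo.mk (Y := underline π X) ⟨i, n⟩ f =
      IndObj.HomTo.mk (Y := underline π X) ⟨j, m⟩ g := by
  obtain ⟨l, hl⟩ := exists_map_lattice π (X.diag.map a) n
  obtain ⟨l', hl'⟩ := exists_map_lattice π (X.diag.map b) m
  exact IndObj.HomTo.mk_eq_mk.2 ⟨⟨k, max l l'⟩,
    ⟨a, fun v hv => lattice_mono π _ (le_max_left _ _) (hl v hv)⟩,
    ⟨b, fun v hv => lattice_mono π _ (le_max_right _ _) (hl' v hv)⟩,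
    h (max l l') (fun v hv => lattice_mono π _ (le_max_left _ _) (hl v hv))
      (fun v hv => lattice_mono π _ (le_max_right _ _) (hl' v hv))⟩

/-- Two morphisms to the same member `Xᵢ` whose values agree in `Xᵢ` are identified. -/
lemma homTo_underline_eq_same {A : BanMod (unitBall F)} {X : IndObj (BanMod F)} {i : X.J}
    {n m : ℕ} (f : A ⟶ latticeObj π (X.diag.obj i) n) (g : A ⟶ latticeObj π (X.diag.obj i) m)
    (h : ∀ x : A, coe (BanMod.lin f x) = coe (BanMod.lin g x)) :
    IndObj.HomTo.mk (Y := underline π X) ⟨i, n⟩ f =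
      IndObj.HomTo.mk (Y := underline π X) ⟨i, m⟩ g :=
  homTo_underline_eq (X := X) (p := ⟨i, n⟩) (q := ⟨i, m⟩) f g (𝟙 i) (𝟙 i) fun x =>
    congrArg (BanMod.lin (X.diag.map (𝟙 i))) (h x)

lemma continuous_coe {V : BanMod F} {n : ℕ} : Continuous (coe : latticeObj π V n → V) :=
  continuous_subtype_val

lemma coe_add {V : BanMod F} {n : ℕ} (v w : latticeObj π V n) : coe (v + w) = coe v + coe w := rfl

lemma coe_zero {V : BanMod F} {n : ℕ} : coe (0 : latticeObj π V n) = 0 := rfl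

lemma coe_eq_of_tmul {A B : BanMod (unitBall F)} {V : BanMod F} {n m : ℕ}
    {f : BanMod.tensor A B ⟶ latticeObj π V n} {g : BanMod.tensor A B ⟶ latticeObj π V m}
    (h : ∀ a b, coe (BanMod.lin f (BanMod.tmul a b)) = coe (BanMod.lin g (BanMod.tmul a b)))
    (x : BanMod.tensor A B) : coe (BanMod.lin f x) = coe (BanMod.lin g x) := by
  refine BanMod.tensor_induction (p := fun x => coe (BanMod.lin f x) = coe (BanMod.lin g x))
    (isClosed_eq (continuous_coe.comp (BanMod.continuous_lin f))
      (continuous_coe.comp (BanMod.continuous_lin g))) ?_ ?_ h x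
  · rw [map_zero, map_zero, coe_zero, coe_zero]
  · intro s t hs ht
    rw [map_add, map_add, coe_add, coe_add, hs, ht]

lemma coe_eq_of_latticeMap {A : BanMod (unitBall F)} {V : BanMod F} {n m : ℕ}
    {f : A ⟶ latticeObj π V n} {g : A ⟶ latticeObj π V m}
    (h : f ≫ latticeMap (m := max n m) (𝟙 V) (fun _ hv => lattice_mono π V (le_max_left n m) hv) =
      g ≫ latticeMap (m := max n m) (𝟙 V) (fun _ hv => lattice_mono π V (le_max_right n m) hv)) (x : A) :
    coe (BanMod.lin f x) = coe (BanMod.lin g x) :=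
  congrArg (fun k => coe (BanMod.lin k x)) h

/-- The multiplication `π⁻ⁿ V° ⊗ π⁻ᵐ W° ⟶ π⁻⁽ⁿ⁺ᵐ⁾ (V ⊗ W)°`, `v ⊗ w ↦ v ⊗ w`. -/
def latticeMul (V W : BanMod F) (n m : ℕ) :
    BanMod.tensor (latticeObj π V n) (latticeObj π W m) ⟶
      latticeObj π (BanMod.tensor V W) (n + m) :=
  BanMod.lift (M := latticeObj π V n) (N := latticeObj π W m)
    (P := latticeObj π (BanMod.tensor V W) (n + m))
    (LinearMap.mk₂ (unitBall F) (fun v w => ⟨BanMod.tmul (coe v) (coe w), fun r hr => by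
        have hv := coe_mem v r hr
        have hw := coe_mem w 1 (by simp)
        rw [one_mul] at hw
        rw [pow_add, ← mul_assoc, mul_smul, ← BanMod.tmul_smul, ← BanMod.smul_tmul]
        exact (BanMod.norm_tmul_le _ _).trans (mul_le_one₀ hv (norm_nonneg _) hw)⟩)
      (fun v v' w => Subtype.ext (BanMod.add_tmul (coe v) (coe v') (coe w)))
      (fun r v w => Subtype.ext (BanMod.smul_tmul (r : F) (coe v) (coe w)))
      (fun v w w' => Subtype.ext (BanMod.tmul_add (coe v) (coe w) (coe w')))
      (fun r v w => Subtype.ext (BanMod.tmul_smul (r : F) (coe v) (coe w))))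
    ⟨1, zero_le_one, fun v w => (BanMod.norm_tmul_le (coe v) (coe w)).trans_eq (by
      rw [one_mul]; rfl)⟩

@[simp] lemma coe_latticeMul {V W : BanMod F} {n m : ℕ} (v : latticeObj π V n)
    (w : latticeObj π W m) :
    coe (BanMod.lin (latticeMul V W n m) (BanMod.tmul v w)) = BanMod.tmul (coe v) (coe w) :=
  congrArg coe (BanMod.lift_tmul _ _ v w)

lemma latticeMul_comp {V W V' W' Z : BanMod F} {n m n' m' l : ℕ} (f : V ⟶ V')
    (hf : ∀ v ∈ lattice π V n, BanMod.lin f v ∈ lattice π V' n') (g : W ⟶ W')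
    (hg : ∀ v ∈ lattice π W m, BanMod.lin g v ∈ lattice π W' m')
    (e : BanMod.tensor V' W' ⟶ Z) (e' : BanMod.tensor V W ⟶ Z)
    (he : ∀ v ∈ lattice π (BanMod.tensor V' W') (n' + m'), BanMod.lin e v ∈ lattice π Z l)
    (he' : ∀ v ∈ lattice π (BanMod.tensor V W) (n + m), BanMod.lin e' v ∈ lattice π Z l)
    (h : BanMod.tensorMap f g ≫ e = e') :
    (BanMod.tensorMap (latticeMap f hf) (latticeMap g hg) ≫ latticeMul V' W' n' m') ≫
      latticeMap e he = latticeMul V W n m ≫ latticeMap e' he' :=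
  BanMod.tensor_ext fun v w => coe_injective (by
    subst h
    simp)

variable [CompleteSpace F] (π)

/-- The morphism `X̲ ⊗ Y̲ ⟶ (X ⊗ Y)̲` induced by `π⁻ⁿ Xᵢ° ⊗ π⁻ᵐ Yⱼ° ⟶ π⁻⁽ⁿ⁺ᵐ⁾ (Xᵢ ⊗ Yⱼ)°`. -/
def underlineMul (X Y : IndObj (BanMod F)) :
    underline π X ⊗ underline π Y ⟶ underline π (X ⊗ Y) :=
  IndObj.homMk (X := IndObj.tensor (underline π X) (underline π Y))
    (Y := underline π (IndObj.tensor X Y))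
    (fun p => IndObj.HomTo.mk (Y := underline π (IndObj.tensor X Y))
      ⟨(p.1.fst, p.2.fst), p.1.snd + p.2.snd⟩
      (latticeMul (X.diag.obj p.1.fst) (Y.diag.obj p.2.fst) p.1.snd p.2.snd))
    (fun u => homTo_underline_eq' (X := IndObj.tensor X Y) _ _ (𝟙 _) (u.1.1, u.2.1)
      fun _ ha hb => latticeMul_comp (X.diag.map u.1.1) u.1.2 (Y.diag.map u.2.1) u.2.2
        _ _ ha hb
        ((congrArg _ ((X.tensor Y).diag.map_id _)).trans (Category.comp_id _)))

/-- The inclusion of `F°` as the member `n = 0` of `F̲`. -/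
def latticeOne : BanMod.unit (unitBall F) ⟶ latticeObj π (BanMod.unit F) 0 :=
  BanMod.ofLin (N := latticeObj π (BanMod.unit F) 0)
    { toFun := fun x => ⟨(x : unitBall F).1, fun r hr => by
        rw [pow_zero, mul_one]
        exact (norm_mul r _).le.trans (mul_le_one₀ hr (norm_nonneg _) (x : unitBall F).2)⟩
      map_add' := fun _ _ => rfl
      map_smul' := fun _ _ => rfl }
    ⟨1, fun x => (one_mul ‖x‖).ge⟩

/-- The morphism `F° ⟶ F̲`. -/
def underlineOne : 𝟙_ (IndObj (BanMod (unitBall F))) ⟶ underline π (𝟙_ (IndObj (BanMod F))) :=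
  IndObj.homMk (X := IndObj.const (BanMod.unit (unitBall F)))
    (Y := underline π (IndObj.const (BanMod.unit F)))
    (fun _ => IndObj.HomTo.mk (Y := underline π (IndObj.const (BanMod.unit F))) ⟨⟨⟨⟩⟩, 0⟩
      (latticeOne π))
    (fun _ => rfl)

lemma app_underlineMul (X Y : IndObj (BanMod F)) (i : X.J) (n : ℕ) (j : Y.J) (m : ℕ) :
    IndObj.app (X := IndObj.tensor (underline π X) (underline π Y)) (underlineMul π X Y)
      ((⟨i, n⟩ : Index X), (⟨j, m⟩ : Index Y)) =
    IndObj.HomTo.mk (Y := underline π (IndObj.tensor X Y)) ⟨(i, j), n + m⟩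
      (latticeMul (X.diag.obj i) (Y.diag.obj j) n m) := rfl

variable {π}

lemma latticeMul_natural {V W V' W' : BanMod F} {n m n' m' l : ℕ} (f : V ⟶ V')
    (hf : ∀ v ∈ lattice π V n, BanMod.lin f v ∈ lattice π V' n') (g : W ⟶ W')
    (hg : ∀ v ∈ lattice π W m, BanMod.lin g v ∈ lattice π W' m')
    (h : ∀ v ∈ lattice π _ (n + m), BanMod.lin (BanMod.tensorMap f g) v ∈ lattice π _ l) (x) :
    coe (BanMod.lin (BanMod.tensorMap (latticeMap f hf) (latticeMap g hg) ≫
      latticeMul V' W' n' m') x) =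
    coe (BanMod.lin (latticeMul V W n m ≫ latticeMap (BanMod.tensorMap f g) h) x) :=
  coe_eq_of_tmul (fun v w => by simp) x

lemma latticeMul_assoc {V W Z : BanMod F} {n m k l : ℕ}
    (h : ∀ v ∈ lattice π _ (n + m + k), BanMod.lin (BanMod.assocHom V W Z) v ∈ lattice π _ l) (x) :
    coe (BanMod.lin (BanMod.tensorMap (latticeMul V W n m) (𝟙 (latticeObj π Z k)) ≫
      latticeMul (BanMod.tensor V W) Z (n + m) k ≫ latticeMap (BanMod.assocHom V W Z) h) x) =
    coe (BanMod.lin (BanMod.assocHom _ _ _ ≫ BanMod.tensorMap (𝟙 (latticeObj π V n))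
      (latticeMul W Z m k) ≫ latticeMul V (BanMod.tensor W Z) n (m + k)) x) :=
  coe_eq_of_latticeMap (BanMod.tensor_ext₃ fun u v w => coe_injective (by
    rw [BanMod.lin_comp, coe_latticeMap, BanMod.lin_id, BanMod.lin_comp, BanMod.lin_comp,
      coe_latticeMap, BanMod.tensorMap_tmul, coe_latticeMul, coe_latticeMul, BanMod.lin_id,
      BanMod.assocHom_tmul, BanMod.lin_comp, coe_latticeMap, BanMod.lin_id, BanMod.lin_comp,
      BanMod.lin_comp, BanMod.assocHom_tmul, BanMod.tensorMap_tmul, BanMod.lin_id, coe_latticeMul,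
      coe_latticeMul])) x

lemma coe_latticeOne (r : BanMod.unit (unitBall F)) :
    coe (BanMod.lin (latticeOne π) r) = (r : unitBall F).1 := rfl

lemma latticeMul_leftUnit {V : BanMod F} {n l : ℕ}
    (h : ∀ v ∈ lattice π _ (0 + n), BanMod.lin (BanMod.leftUnitHom V) v ∈ lattice π _ l) (x) :
    coe (BanMod.lin (BanMod.leftUnitHom (latticeObj π V n)) x) =
    coe (BanMod.lin (BanMod.tensorMap (latticeOne π) (𝟙 (latticeObj π V n)) ≫
      latticeMul (BanMod.unit F) V 0 n ≫ latticeMap (BanMod.leftUnitHom V) h) x) :=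
  coe_eq_of_tmul (fun r v => by
    rw [BanMod.lin_comp, BanMod.lin_comp, coe_latticeMap, BanMod.tensorMap_tmul, coe_latticeMul,
      BanMod.leftUnitHom_tmul, BanMod.leftUnitHom_tmul]
    rfl) x

lemma latticeMul_rightUnit {V : BanMod F} {n l : ℕ}
    (h : ∀ v ∈ lattice π _ (n + 0),
      BanMod.lin (BanMod.swap V (BanMod.unit F) ≫ BanMod.leftUnitHom V) v ∈ lattice π _ l) (x) :
    coe (BanMod.lin (BanMod.swap _ _ ≫ BanMod.leftUnitHom (latticeObj π V n)) x) =
    coe (BanMod.lin (BanMod.tensorMap (𝟙 (latticeObj π V n)) (latticeOne π) ≫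
      latticeMul V (BanMod.unit F) n 0 ≫
        latticeMap (BanMod.swap V (BanMod.unit F) ≫ BanMod.leftUnitHom V) h) x) :=
  coe_eq_of_tmul (fun v r => by
    rw [BanMod.lin_comp, BanMod.lin_comp, BanMod.lin_comp, coe_latticeMap, BanMod.tensorMap_tmul,
      coe_latticeMul, BanMod.lin_comp, BanMod.swap_tmul, BanMod.swap_tmul,
      BanMod.leftUnitHom_tmul, BanMod.leftUnitHom_tmul]
    rfl) x

lemma latticeMul_swap {V W : BanMod F} {n m l : ℕ}
    (h : ∀ v ∈ lattice π _ (n + m), BanMod.lin (BanMod.swap V W) v ∈ lattice π _ l) (x) :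
    coe (BanMod.lin (latticeMul V W n m ≫ latticeMap (BanMod.swap V W) h) x) =
    coe (BanMod.lin (BanMod.swap _ _ ≫ latticeMul W V m n) x) :=
  coe_eq_of_tmul (fun v w => by
    rw [BanMod.lin_comp, BanMod.lin_comp, coe_latticeMap, BanMod.swap_tmul, coe_latticeMul,
      coe_latticeMul, BanMod.swap_tmul]) x

lemma underlineMul_natural {X Y X' Y' : IndObj (BanMod F)} (f : X ⟶ X') (g : Y ⟶ Y') :
    IndObj.tensorMap (underlineMap π f) (underlineMap π g) ≫ underlineMul π X' Y' =
      underlineMul π X Y ≫ underlineMap π (IndObj.tensorMap f g) :=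
  IndObj.hom_ext fun ⟨⟨i, n⟩, ⟨j, m⟩⟩ => by
    obtain ⟨i', a, hf⟩ := (IndObj.app f i).exists_mk
    obtain ⟨j', b, hg⟩ := (IndObj.app g j).exists_mk
    obtain ⟨n', hn⟩ := exists_map_lattice π a n
    obtain ⟨m', hm⟩ := exists_map_lattice π b m
    obtain ⟨l, hl⟩ := exists_map_lattice π (BanMod.tensorMap a b) (n + m)
    refine (IndObj.app_comp_of_eq _ _ (IndObj.app_tensorMap_of_eq _ _
      (app_underlineMap π f hf hn) (app_underlineMap π g hg hm))).trans ?_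
    refine Eq.trans ?_ ((IndObj.app_comp_of_eq _ _ (app_underlineMul π X Y i n j m)).trans
      (congrArg (IndObj.HomTo.pre _)
      (app_underlineMap π _ (IndObj.app_tensorMap_of_eq _ _ hf hg) hl))).symm
    exact homTo_underline_eq_same (X := IndObj.tensor X' Y') (i := (i', j')) _ _
      (latticeMul_natural a hn b hm hl)
lemma underlineMul_assoc (X Y Z : IndObj (BanMod F)) :
    IndObj.tensorMap (underlineMul π X Y) (𝟙 (underline π Z)) ≫ underlineMul π (X ⊗ Y) Z ≫
        underlineMap π (α_ X Y Z).hom =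
      (α_ (underline π X) (underline π Y) (underline π Z)).hom ≫
        IndObj.tensorMap (𝟙 (underline π X)) (underlineMul π Y Z) ≫ underlineMul π X (Y ⊗ Z) :=
  IndObj.hom_ext fun ⟨⟨⟨i, n⟩, ⟨j, m⟩⟩, ⟨k, l⟩⟩ => by
    obtain ⟨p, hp⟩ := exists_map_lattice π
      (BanMod.assocHom (X.diag.obj i) (Y.diag.obj j) (Z.diag.obj k)) (n + m + l)
    refine (IndObj.app_comp_of_eq _ _ (IndObj.app_tensorMap_of_eq _ _
      (app_underlineMul π X Y i n j m) (IndObj.app_id _ _))).trans ?_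
    refine (congrArg (IndObj.HomTo.pre _) ((IndObj.app_comp_of_eq _ _
      (app_underlineMul π (IndObj.tensor X Y) Z (i, j) (n + m) k l)).trans
      (congrArg (IndObj.HomTo.pre _) (app_underlineMap π _ (IndObj.app_assocIso_hom X Y Z i j k)
        hp)))).trans ?_
    refine Eq.trans ?_ (IndObj.app_comp_of_eq _ _ (IndObj.app_assocIso_hom _ _ _ _ _ _)).symm
    refine Eq.trans ?_ (congrArg (IndObj.HomTo.pre _) (IndObj.app_comp_of_eq _ _
      (IndObj.app_tensorMap_of_eq _ _ (IndObj.app_id _ _) (app_underlineMul π Y Z j m k l)))).symm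
    exact homTo_underline_eq_same (X := IndObj.tensor X (IndObj.tensor Y Z)) (i := (i, (j, k))) _ _
      (latticeMul_assoc hp)

lemma underline_leftUnit (X : IndObj (BanMod F)) :
    (IndObj.leftUnit (underline π X)).hom =
      IndObj.tensorMap (underlineOne π) (𝟙 (underline π X)) ≫ underlineMul π (𝟙_ _) X ≫
        underlineMap π (λ_ X).hom :=
  IndObj.hom_ext fun ⟨s, ⟨i, n⟩⟩ => by
    obtain ⟨p, hp⟩ := exists_map_lattice π (BanMod.leftUnitHom (X.diag.obj i)) (0 + n)
    refine Eq.trans ?_ (IndObj.app_comp_of_eq _ _ (IndObj.app_tensorMap_of_eq _ _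
      rfl (IndObj.app_id _ _))).symm
    refine Eq.trans ?_ (congrArg (IndObj.HomTo.pre _) ((IndObj.app_comp_of_eq _ _
      (app_underlineMul π (IndObj.const (BanMod.unit F)) X ⟨⟨⟩⟩ 0 i n)).trans
      (congrArg (IndObj.HomTo.pre _) (app_underlineMap π _ (IndObj.app_leftUnit_hom X ⟨⟨⟩⟩ i)
        hp)))).symm
    exact homTo_underline_eq_same (X := X) (i := i)
      (BanMod.leftUnitHom (latticeObj π (X.diag.obj i) n)) _ (latticeMul_leftUnit hp)

lemma underline_rightUnit (X : IndObj (BanMod F)) :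
    (IndObj.rightUnit (underline π X)).hom =
      IndObj.tensorMap (𝟙 (underline π X)) (underlineOne π) ≫ underlineMul π X (𝟙_ _) ≫
        underlineMap π (ρ_ X).hom :=
  IndObj.hom_ext fun ⟨⟨i, n⟩, s⟩ => by
    obtain ⟨p, hp⟩ := exists_map_lattice π (BanMod.swap (X.diag.obj i) (BanMod.unit F) ≫
      BanMod.leftUnitHom (X.diag.obj i)) (n + 0)
    refine Eq.trans ?_ (IndObj.app_comp_of_eq _ _ (IndObj.app_tensorMap_of_eq _ _
      (IndObj.app_id _ _) rfl)).symm
    refine Eq.trans ?_ (congrArg (IndObj.HomTo.pre _) ((IndObj.app_comp_of_eq _ _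
      (app_underlineMul π X (IndObj.const (BanMod.unit F)) i n ⟨⟨⟩⟩ 0)).trans
      (congrArg (IndObj.HomTo.pre _) (app_underlineMap π _ (IndObj.app_rightUnit_hom X i ⟨⟨⟩⟩)
        hp)))).symm
    exact homTo_underline_eq_same (X := X) (i := i)
      (BanMod.swap _ _ ≫ BanMod.leftUnitHom (latticeObj π (X.diag.obj i) n)) _
      (latticeMul_rightUnit hp)

lemma underline_swap (X Y : IndObj (BanMod F)) :
    underlineMul π X Y ≫ underlineMap π (IndObj.swapHom X Y) =
      IndObj.swapHom (underline π X) (underline π Y) ≫ underlineMul π Y X :=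
  IndObj.hom_ext fun ⟨⟨i, n⟩, ⟨j, m⟩⟩ => by
    obtain ⟨p, hp⟩ := exists_map_lattice π (BanMod.swap (X.diag.obj i) (Y.diag.obj j)) (n + m)
    refine (IndObj.app_comp_of_eq _ _ (app_underlineMul π X Y i n j m)).trans ?_
    refine (congrArg (IndObj.HomTo.pre _) (app_underlineMap π _ (IndObj.app_swapHom X Y i j)
      hp)).trans ?_
    refine Eq.trans ?_ ((IndObj.app_comp_of_eq _ _ (IndObj.app_swapHom _ _ _ _)).trans
      (congrArg (IndObj.HomTo.pre _) (app_underlineMul π Y X j m i n))).symm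
    exact homTo_underline_eq_same (X := IndObj.tensor Y X) (i := (j, i)) _ _
      (latticeMul_swap hp)

/-- The lax symmetric monoidal structure of `X ↦ X̲`, with respect to the tensor product of
ind-Banach modules over `F°`. -/
instance : (underlineFunctor π).LaxBraided where
  toLaxMonoidal := Functor.LaxMonoidal.ofTensorHom (underlineOne π) (underlineMul π)
    underlineMul_natural underlineMul_assoc underline_leftUnit underline_rightUnit
  braided := underline_swap

end

/-! ### Modules over a commutative monoid and the relative tensor product

The relative tensor product is the coequalizer of the two actions `(M ⊗ A) ⊗ N ⇉ M ⊗ N`. We only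
need it when the multiplication `A ⊗ A ⟶ A` is an isomorphism; then these coequalizers exist. -/

namespace RelTensor

section

variable {C : Type w} [Category.{v} C] [MonoidalCategory C] {A : C} [MonObj A]

/-- The action `A ⊗ M ⟶ M` of a module. -/
abbrev act (M : Mod C A) : A ⊗ M.X ⟶ M.X := ModObj.smul (M := A) (X := M.X)

lemma one_act (M : Mod C A) : MonObj.one (X := A) ▷ M.X ≫ act M = (λ_ M.X).hom :=
  ModObj.one_smul_self A M.X

lemma mul_act (M : Mod C A) : MonObj.mul (X := A) ▷ M.X ≫ act M =
    (α_ A A M.X).hom ≫ A ◁ act M ≫ act M :=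
  ModObj.mul_smul_self A M.X

variable (A) in
/-- The multiplication of `A` is an isomorphism. -/
class IsIdempotent : Prop where
  isIso_mul : IsIso (MonObj.mul (X := A))

attribute [instance] IsIdempotent.isIso_mul

lemma isIdempotent_of
    (h : MonObj.mul (X := A) ≫ (λ_ A).inv ≫ MonObj.one (X := A) ▷ A = 𝟙 (A ⊗ A)) :
    IsIdempotent A :=
  ⟨⟨_, h, by simp⟩⟩

lemma inv_mul_left [IsIdempotent A] : inv (MonObj.mul (X := A)) = (λ_ A).inv ≫ MonObj.one (X := A) ▷ A :=
  IsIso.inv_eq_of_inv_hom_id (by simp)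

lemma inv_mul_right [IsIdempotent A] : inv (MonObj.mul (X := A)) = (ρ_ A).inv ≫ A ◁ MonObj.one (X := A) :=
  IsIso.inv_eq_of_inv_hom_id (by simp)

variable [SymmetricCategory C]

/-- The map `M ⊗ A ⊗ N ⟶ M ⊗ N` given by the action on `N`. -/
def actRight (M N : Mod C A) : (M.X ⊗ A) ⊗ N.X ⟶ M.X ⊗ N.X :=
  (α_ M.X A N.X).hom ≫ M.X ◁ act N

/-- The map `M ⊗ A ⊗ N ⟶ M ⊗ N` given by the action on `M` (after the symmetry `M ⊗ A ≅ A ⊗ M`). -/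
def actLeft (M N : Mod C A) : (M.X ⊗ A) ⊗ N.X ⟶ M.X ⊗ N.X :=
  ((β_ M.X A).hom ≫ act M) ▷ N.X

variable [IsIdempotent A]

lemma one_comm : (λ_ A).inv ≫ MonObj.one (X := A) ▷ A = (ρ_ A).inv ≫ A ◁ MonObj.one (X := A) := by
  rw [← inv_mul_left, inv_mul_right]

/-- The action on a module is an isomorphism. -/
lemma act_comp (M : Mod C A) :
    act M ≫ (λ_ M.X).inv ≫ MonObj.one (X := A) ▷ M.X = 𝟙 (A ⊗ M.X) := by
  have h := congrArg (fun k => k ▷ M.X ≫ (α_ A A M.X).hom) (one_comm (A := A))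
  simp only [comp_whiskerRight, Category.assoc] at h
  calc act M ≫ (λ_ M.X).inv ≫ MonObj.one (X := A) ▷ M.X
      = (λ_ (A ⊗ M.X)).inv ≫ MonObj.one (X := A) ▷ (A ⊗ M.X) ≫ A ◁ act M := by
        rw [← whisker_exchange]
        simp
    _ = ((λ_ A).inv ▷ M.X ≫ MonObj.one (X := A) ▷ A ▷ M.X ≫ (α_ A A M.X).hom) ≫ A ◁ act M := by
        simp
    _ = A ◁ ((λ_ M.X).inv ≫ MonObj.one (X := A) ▷ M.X ≫ act M) := by
        rw [h]
        simp [-ModObj.one_smul_self]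
    _ = 𝟙 _ := by rw [one_act, Iso.inv_hom_id, MonoidalCategory.whiskerLeft_id]

instance (M : Mod C A) : IsIso (act M) :=
  ⟨_, act_comp M, by rw [Category.assoc, one_act, Iso.inv_hom_id]⟩

instance (M : Mod C A) : IsIso (MonObj.one (X := A) ▷ M.X) := by
  have : IsIso (MonObj.one (X := A) ▷ M.X ≫ act M) := by
    rw [one_act]
    infer_instance
  exact IsIso.of_isIso_comp_right _ (act M)

instance (M : Mod C A) : IsIso (M.X ◁ MonObj.one (X := A)) := by
  have : M.X ◁ MonObj.one (X := A) =
      (β_ M.X (𝟙_ C)).hom ≫ MonObj.one (X := A) ▷ M.X ≫ (β_ M.X A).inv := by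
    rw [← Category.assoc, Iso.eq_comp_inv, BraidedCategory.braiding_naturality_right]
  rw [this]
  infer_instance

/-- Every morphism between modules is linear. -/
lemma act_naturality {M N : Mod C A} (f : M.X ⟶ N.X) : act M ≫ f = A ◁ f ≫ act N := by
  rw [← cancel_epi (MonObj.one (X := A) ▷ M.X), ← Category.assoc, one_act,
    ← whisker_exchange_assoc, one_act, leftUnitor_naturality]

/-- A morphism of modules from a morphism of the underlying objects. -/
def mkHom {M N : Mod C A} (f : M.X ⟶ N.X) : M ⟶ N := Mod.Hom.mk' f (act_naturality f)

@[simp] lemma mkHom_hom {M N : Mod C A} (f : M.X ⟶ N.X) : (mkHom f).hom = f := rfl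

lemma actRight_eq_actLeft (M N : Mod C A) : actRight M N = actLeft M N := by
  rw [← cancel_epi ((ρ_ M.X).inv ▷ N.X ≫ (M.X ◁ MonObj.one (X := A)) ▷ N.X)]
  have h1 : ((ρ_ M.X).inv ▷ N.X ≫ (M.X ◁ MonObj.one (X := A)) ▷ N.X) ≫ actRight M N = 𝟙 _ := by
    have h : (α_ M.X (𝟙_ C) N.X).hom ≫ M.X ◁ (MonObj.one (X := A) ▷ N.X ≫ act N) =
        (ρ_ M.X).hom ▷ N.X := by
      rw [one_act, triangle]
    rw [actRight, Category.assoc, associator_naturality_middle_assoc,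
      ← MonoidalCategory.whiskerLeft_comp, h, ← comp_whiskerRight, Iso.inv_hom_id, id_whiskerRight]
  have h2 : ((ρ_ M.X).inv ▷ N.X ≫ (M.X ◁ MonObj.one (X := A)) ▷ N.X) ≫ actLeft M N = 𝟙 _ := by
    rw [actLeft, ← comp_whiskerRight, ← comp_whiskerRight, Category.assoc,
      BraidedCategory.braiding_naturality_right_assoc, one_act, braiding_leftUnitor,
      Iso.inv_hom_id, id_whiskerRight]
  rw [h1, h2]

instance (M N : Mod C A) : Limits.HasCoequalizer (actRight M N) (actLeft M N) := by
  rw [actRight_eq_actLeft]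
  infer_instance

/-- The relative tensor product: the coequalizer of the two actions `M ⊗ A ⊗ N ⇉ M ⊗ N`. -/
def obj (M N : Mod C A) : C := Limits.coequalizer (actRight M N) (actLeft M N)

/-- The projection from `M ⊗ N` to the relative tensor product. -/
def projObj (M N : Mod C A) : M.X ⊗ N.X ⟶ obj M N := Limits.coequalizer.π _ _

instance (M N : Mod C A) : IsIso (projObj M N) :=
  Limits.coequalizer.π_of_eq (actRight_eq_actLeft M N)

/-- The action of `A` on the relative tensor product, induced by the action on `M`. -/
instance (M N : Mod C A) : ModObj A (obj M N) where
  smul := A ◁ inv (projObj M N) ≫ (α_ A M.X N.X).inv ≫ act M ▷ N.X ≫ projObj M N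
  one_smul := by
    have h := congrArg (fun k => k ▷ N.X) (one_act M)
    simp only [comp_whiskerRight] at h
    change MonObj.one ▷ obj M N ≫ _ = (λ_ (obj M N)).hom
    rw [← whisker_exchange_assoc, associator_inv_naturality_left_assoc, reassoc_of% h]
    simp
  mul_smul := by
    have h := congrArg (fun k => k ▷ N.X) (mul_act M)
    simp only [comp_whiskerRight] at h
    change MonObj.mul ▷ obj M N ≫ _ = (α_ A A (obj M N)).hom ≫ A ◁ (_ ≫ _) ≫ _
    rw [← whisker_exchange_assoc, associator_inv_naturality_left_assoc, reassoc_of% h]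
    simp

/-- The relative tensor product as a module. -/
def tensor (M N : Mod C A) : Mod C A := ⟨obj M N⟩

/-- The projection from `M ⊗ N` to the relative tensor product. -/
def proj (M N : Mod C A) : M.X ⊗ N.X ⟶ (tensor M N).X := projObj M N

instance (M N : Mod C A) : IsIso (proj M N) := inferInstanceAs (IsIso (projObj M N))

lemma proj_act (M N : Mod C A) : A ◁ proj M N ≫ act (tensor M N) =
    (α_ A M.X N.X).inv ≫ act M ▷ N.X ≫ proj M N := by
  change A ◁ projObj M N ≫ A ◁ inv (projObj M N) ≫ (α_ A M.X N.X).inv ≫ act M ▷ N.X ≫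
    projObj M N = _
  rw [← MonoidalCategory.whiskerLeft_comp_assoc, IsIso.hom_inv_id,
    MonoidalCategory.whiskerLeft_id, Category.id_comp]
  rfl

/-- The morphism induced by `f ⊗ g` on relative tensor products. -/
def tensorMap {M N M' N' : Mod C A} (f : M ⟶ M') (g : N ⟶ N') : tensor M N ⟶ tensor M' N' :=
  mkHom (inv (proj M N) ≫ (f.hom ⊗ₘ g.hom) ≫ proj M' N')

lemma proj_tensorMap {M N M' N' : Mod C A} (f : M ⟶ M') (g : N ⟶ N') :
    proj M N ≫ (tensorMap f g).hom = (f.hom ⊗ₘ g.hom) ≫ proj M' N' := by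
  simp [tensorMap]

/-- An isomorphism of modules from an isomorphism of the underlying objects. -/
def mkIso {M N : Mod C A} (e : M.X ≅ N.X) : M ≅ N where
  hom := mkHom e.hom
  inv := mkHom e.inv
  hom_inv_id := Mod.hom_ext _ _ (by simp)
  inv_hom_id := Mod.hom_ext _ _ (by simp)

@[simp] lemma mkIso_hom_hom {M N : Mod C A} (e : M.X ≅ N.X) : (mkIso e).hom.hom = e.hom := rfl
@[simp] lemma mkIso_inv_hom {M N : Mod C A} (e : M.X ≅ N.X) : (mkIso e).inv.hom = e.inv := rfl

/-- The action as an isomorphism. -/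
def actIso (M : Mod C A) : A ⊗ M.X ≅ M.X := asIso (act M)

/-- The associator of the relative tensor product, induced by the associator of `C`. -/
def assoc (M N P : Mod C A) : tensor (tensor M N) P ≅ tensor M (tensor N P) :=
  mkIso ((asIso (proj (tensor M N) P)).symm ≪≫ whiskerRightIso (asIso (proj M N)).symm P.X ≪≫
    α_ M.X N.X P.X ≪≫ whiskerLeftIso M.X (asIso (proj N P)) ≪≫ asIso (proj M (tensor N P)))

/-- The left unitor `A ⊗_A M ≅ M`, induced by the action. -/
def leftUnit (M : Mod C A) : tensor (Mod.regular A) M ≅ M :=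
  mkIso ((asIso (proj (Mod.regular A) M)).symm ≪≫ actIso M)

/-- The right unitor `M ⊗_A A ≅ M`, induced by the symmetry and the action. -/
def rightUnit (M : Mod C A) : tensor M (Mod.regular A) ≅ M :=
  mkIso ((asIso (proj M (Mod.regular A))).symm ≪≫ β_ M.X A ≪≫ actIso M)

/-- The symmetry of the relative tensor product, induced by the symmetry of `C`. -/
def swap (M N : Mod C A) : tensor M N ≅ tensor N M :=
  mkIso ((asIso (proj M N)).symm ≪≫ β_ M.X N.X ≪≫ asIso (proj N M))

instance : MonoidalCategoryStruct (Mod C A) where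
  tensorObj := tensor
  whiskerLeft M _ _ f := tensorMap (𝟙 M) f
  whiskerRight f N := tensorMap f (𝟙 N)
  tensorHom := tensorMap
  tensorUnit := Mod.regular A
  associator := assoc
  leftUnitor := leftUnit
  rightUnitor := rightUnit

lemma proj_assoc (M N P : Mod C A) :
    proj M N ▷ P.X ≫ proj (tensor M N) P ≫ (assoc M N P).hom.hom =
      (α_ M.X N.X P.X).hom ≫ M.X ◁ proj N P ≫ proj M (tensor N P) := by
  simp [assoc]

lemma proj_leftUnit (M : Mod C A) : proj (Mod.regular A) M ≫ (leftUnit M).hom.hom = act M := by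
  exact IsIso.hom_inv_id_assoc (proj (Mod.regular A) M) (act M)

lemma proj_rightUnit (M : Mod C A) :
    proj M (Mod.regular A) ≫ (rightUnit M).hom.hom = (β_ M.X A).hom ≫ act M := by
  simp [rightUnit]
  rfl

lemma proj_swap (M N : Mod C A) : proj M N ≫ (swap M N).hom.hom = (β_ M.X N.X).hom ≫ proj N M := by
  simp [swap]

lemma tensor_hom_ext {M N P : Mod C A} {f g : tensor M N ⟶ P}
    (h : proj M N ≫ f.hom = proj M N ≫ g.hom) : f = g :=
  Mod.hom_ext _ _ ((cancel_epi (proj M N)).1 h)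

lemma tensor_hom_ext₃ {M N P Q : Mod C A} {f g : tensor (tensor M N) P ⟶ Q}
    (h : proj M N ▷ P.X ≫ proj (tensor M N) P ≫ f.hom =
      proj M N ▷ P.X ≫ proj (tensor M N) P ≫ g.hom) : f = g :=
  tensor_hom_ext ((cancel_epi (proj M N ▷ P.X)).1 h)

lemma proj_tensorMap_left {M N P M' N' P' : Mod C A} (f : M ⟶ M') (g : N ⟶ N') (h : P ⟶ P') :
    proj M N ▷ P.X ≫ ((tensorMap f g).hom ⊗ₘ h.hom) =
      ((f.hom ⊗ₘ g.hom) ⊗ₘ h.hom) ≫ proj M' N' ▷ P'.X := by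
  rw [← tensorHom_id, ← tensorHom_id, tensorHom_comp_tensorHom, tensorHom_comp_tensorHom,
    proj_tensorMap, Category.id_comp, Category.comp_id]

lemma proj_tensorMap_right {M N P M' N' P' : Mod C A} (f : M ⟶ M') (g : N ⟶ N') (h : P ⟶ P') :
    M.X ◁ proj N P ≫ (f.hom ⊗ₘ (tensorMap g h).hom) =
      (f.hom ⊗ₘ (g.hom ⊗ₘ h.hom)) ≫ M'.X ◁ proj N' P' := by
  rw [← id_tensorHom, ← id_tensorHom, tensorHom_comp_tensorHom, tensorHom_comp_tensorHom,
    proj_tensorMap, Category.id_comp, Category.comp_id]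

lemma leftUnit_naturality {M N : Mod C A} (f : M ⟶ N) :
    tensorMap (𝟙 (Mod.regular A)) f ≫ (leftUnit N).hom = (leftUnit M).hom ≫ f :=
  tensor_hom_ext (by
    rw [Mod.comp_hom', Mod.comp_hom', reassoc_of% (proj_tensorMap (𝟙 (Mod.regular A)) f),
      proj_leftUnit, reassoc_of% (proj_leftUnit M)]
    exact (congrArg (· ≫ act N) (id_tensorHom A f.hom)).trans (act_naturality f.hom).symm)

lemma rightUnit_naturality {M N : Mod C A} (f : M ⟶ N) :
    tensorMap f (𝟙 (Mod.regular A)) ≫ (rightUnit N).hom = (rightUnit M).hom ≫ f :=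
  tensor_hom_ext (by
    rw [Mod.comp_hom', Mod.comp_hom', reassoc_of% (proj_tensorMap f (𝟙 (Mod.regular A))),
      proj_rightUnit, reassoc_of% (proj_rightUnit M)]
    have h : f.hom ▷ A ≫ (β_ N.X A).hom ≫ act N = ((β_ M.X A).hom ≫ act M) ≫ f.hom := by
      rw [Category.assoc, act_naturality, BraidedCategory.braiding_naturality_left_assoc]
    exact (congrArg (· ≫ (β_ N.X A).hom ≫ act N) (tensorHom_id f.hom A)).trans h)

lemma pentagon_aux (M N P Q : Mod C A) :
    tensorMap (assoc M N P).hom (𝟙 Q) ≫ (assoc M (tensor N P) Q).hom ≫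
      tensorMap (𝟙 M) (assoc N P Q).hom =
    (assoc (tensor M N) P Q).hom ≫ (assoc M N (tensor P Q)).hom :=
  tensor_hom_ext ((cancel_epi (proj (tensor M N) P ▷ Q.X)).1
    ((cancel_epi (proj M N ▷ P.X ▷ Q.X)).1 (by
      have h1 := congrArg (fun k => k ▷ Q.X) (proj_assoc M N P)
      have h2 := congrArg (fun k => M.X ◁ k) (proj_assoc N P Q)
      simp only [comp_whiskerRight, MonoidalCategory.whiskerLeft_comp] at h1 h2
      simp only [Mod.comp_hom']
      rw [reassoc_of% (proj_tensorMap (assoc M N P).hom (𝟙 Q)), Mod.id_hom', tensorHom_id,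
        reassoc_of% h1, reassoc_of% (proj_assoc M (tensor N P) Q), proj_tensorMap, Mod.id_hom',
        id_tensorHom, associator_naturality_middle_assoc, reassoc_of% h2,
        reassoc_of% (proj_assoc (tensor M N) P Q), associator_naturality_left_assoc,
        ← whisker_exchange_assoc, proj_assoc]
      simp)))

lemma triangle_aux (M N : Mod C A) :
    (assoc M (Mod.regular A) N).hom ≫ tensorMap (𝟙 M) (leftUnit N).hom =
      tensorMap (rightUnit M).hom (𝟙 N) :=
  tensor_hom_ext₃ (by
    have h1 := congrArg (fun k => k ▷ N.X) (proj_rightUnit M)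
    have h2 := congrArg (fun k => M.X ◁ k) (proj_leftUnit N)
    simp only [comp_whiskerRight, MonoidalCategory.whiskerLeft_comp] at h1 h2
    rw [Mod.comp_hom', reassoc_of% (proj_assoc M (Mod.regular A) N), proj_tensorMap,
      proj_tensorMap, Mod.id_hom', id_tensorHom, reassoc_of% h2, Mod.id_hom', tensorHom_id,
      reassoc_of% h1]
    have h := congrArg (· ≫ proj M N) (actRight_eq_actLeft M N)
    simp only [actRight, actLeft, Category.assoc] at h
    exact h)

/-- The monoidal structure on modules given by the relative tensor product. -/
instance : MonoidalCategory (Mod C A) := MonoidalCategory.ofTensorHom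
  (id_tensorHom_id := fun M N => tensor_hom_ext ((proj_tensorMap _ _).trans (by
    change (𝟙 M.X ⊗ₘ 𝟙 N.X) ≫ _ = _ ≫ 𝟙 _
    simp)))
  (tensorHom_comp_tensorHom := fun f g f' g' => tensor_hom_ext (by
    change proj _ _ ≫ (tensorMap f g).hom ≫ (tensorMap f' g').hom = _ ≫
      (tensorMap (f ≫ f') (g ≫ g')).hom
    rw [← Category.assoc, proj_tensorMap, proj_tensorMap, Category.assoc, proj_tensorMap]
    simp))
  (associator_naturality := fun {M N P M' N' P'} f g h => tensor_hom_ext₃ (by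
    change _ ≫ _ ≫ (tensorMap (tensorMap f g) h).hom ≫ (assoc M' N' P').hom.hom =
      _ ≫ _ ≫ (assoc M N P).hom.hom ≫ (tensorMap f (tensorMap g h)).hom
    rw [reassoc_of% (proj_tensorMap (tensorMap f g) h), reassoc_of% (proj_tensorMap_left f g h),
      proj_assoc, reassoc_of% (proj_assoc M N P), proj_tensorMap,
      reassoc_of% (proj_tensorMap_right f g h), associator_naturality_assoc]))
  (leftUnitor_naturality := leftUnit_naturality)
  (rightUnitor_naturality := rightUnit_naturality)
  (pentagon := pentagon_aux)
  (triangle := triangle_aux)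

lemma swap_natural {M N M' N' : Mod C A} (f : M ⟶ M') (g : N ⟶ N') :
    tensorMap f g ≫ (swap M' N').hom = (swap M N).hom ≫ tensorMap g f :=
  tensor_hom_ext (by
    rw [Mod.comp_hom', Mod.comp_hom', reassoc_of% (proj_tensorMap f g), proj_swap,
      reassoc_of% (proj_swap M N), proj_tensorMap, BraidedCategory.braiding_naturality_assoc])

lemma hexagon_aux (M N P : Mod C A) :
    (assoc M N P).hom ≫ (swap M (tensor N P)).hom ≫ (assoc N P M).hom =
      tensorMap (swap M N).hom (𝟙 P) ≫ (assoc N M P).hom ≫ tensorMap (𝟙 N) (swap M P).hom :=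
  tensor_hom_ext₃ (by
    have h1 := congrArg (fun k => k ▷ P.X) (proj_swap M N)
    have h2 := congrArg (fun k => N.X ◁ k) (proj_swap M P)
    simp only [comp_whiskerRight, MonoidalCategory.whiskerLeft_comp] at h1 h2
    simp only [Mod.comp_hom']
    rw [reassoc_of% (proj_assoc M N P), reassoc_of% (proj_swap M (tensor N P)),
      BraidedCategory.braiding_naturality_right_assoc, proj_assoc,
      reassoc_of% (proj_tensorMap (swap M N).hom (𝟙 P)), Mod.id_hom', tensorHom_id,
      reassoc_of% h1, reassoc_of% (proj_assoc N M P), proj_tensorMap, Mod.id_hom', id_tensorHom,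
      reassoc_of% h2, BraidedCategory.hexagon_forward_assoc])

lemma proj_assoc_inv (M N P : Mod C A) :
    M.X ◁ proj N P ≫ proj M (tensor N P) ≫ (assoc M N P).inv.hom =
      (α_ M.X N.X P.X).inv ≫ proj M N ▷ P.X ≫ proj (tensor M N) P := by
  simp [assoc]

lemma hexagon_aux' (M N P : Mod C A) :
    (assoc M N P).inv ≫ (swap (tensor M N) P).hom ≫ (assoc P M N).inv =
      tensorMap (𝟙 M) (swap N P).hom ≫ (assoc M P N).inv ≫ tensorMap (swap M P).hom (𝟙 N) :=
  tensor_hom_ext ((cancel_epi (M.X ◁ proj N P)).1 (by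
    have h1 := congrArg (fun k => k ▷ N.X) (proj_swap M P)
    have h2 := congrArg (fun k => M.X ◁ k) (proj_swap N P)
    simp only [comp_whiskerRight, MonoidalCategory.whiskerLeft_comp] at h1 h2
    simp only [Mod.comp_hom']
    rw [reassoc_of% (proj_assoc_inv M N P), reassoc_of% (proj_swap (tensor M N) P),
      BraidedCategory.braiding_naturality_left_assoc, proj_assoc_inv,
      reassoc_of% (proj_tensorMap (𝟙 M) (swap N P).hom), Mod.id_hom', id_tensorHom,
      reassoc_of% h2, reassoc_of% (proj_assoc_inv M P N), proj_tensorMap, Mod.id_hom', tensorHom_id,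
      reassoc_of% h1, BraidedCategory.hexagon_reverse_assoc]))

instance : SymmetricCategory (Mod C A) where
  braiding := swap
  braiding_naturality_right M _ _ f := swap_natural (𝟙 M) f
  braiding_naturality_left f N := swap_natural f (𝟙 N)
  hexagon_forward := hexagon_aux
  hexagon_reverse := hexagon_aux'
  symmetry M N := tensor_hom_ext (by
    change proj M N ≫ (swap M N).hom.hom ≫ (swap N M).hom.hom = proj M N ≫ 𝟙 _
    rw [reassoc_of% (proj_swap M N), proj_swap]
    simp)

end

end RelTensor

/-! ### A lax symmetric monoidal functor `G` as a functor to modules over `G(𝟙)` -/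

namespace LaxToMod

section

variable {C : Type w} [Category.{v} C]

lemma comp_eq {W X Y Z : C} {a : W ⟶ X} {b : X ⟶ Y} {c : W ⟶ Y} (h : a ≫ b = c) (d : Y ⟶ Z) :
    a ≫ b ≫ d = c ≫ d := by rw [← h, Category.assoc]

lemma comp_eq_assoc {P0 P1 P2 P3 P4 P5 Q0 Q1 Q2 Q3 S T : C} {a : P0 ⟶ P1} {p : P1 ⟶ P2}
    {t : P2 ⟶ P3} {m : P3 ⟶ P4} {g : P4 ⟶ P5} {as : P2 ⟶ Q2} {t' : Q2 ⟶ Q3} {m' : Q3 ⟶ P5}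
    {n : P1 ⟶ S} {q : S ⟶ P3} {al : P0 ⟶ Q0} {b : Q0 ⟶ Q1} {p' : Q1 ⟶ Q2} {n' : Q1 ⟶ T}
    {q' : T ⟶ Q3} (h1 : p ≫ t = n ≫ q) (h2 : p' ≫ t' = n' ≫ q')
    (h3 : a ≫ p ≫ as = al ≫ b ≫ p')
    (h : a ≫ n ≫ q ≫ m ≫ g = al ≫ b ≫ n' ≫ q' ≫ m') :
    a ≫ p ≫ t ≫ m ≫ g = a ≫ p ≫ as ≫ t' ≫ m' := by
  rw [reassoc_of% h1, h, reassoc_of% h3, reassoc_of% h2]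

end

section

open Functor

variable {V : Type w} [Category.{v} V] [MonoidalCategory V] [SymmetricCategory V]
variable {C : Type w} [Category.{v} C] [MonoidalCategory C] [SymmetricCategory C]
variable (G : V ⥤ C) [G.LaxBraided]

/-- The image of the unit object under a lax monoidal functor. -/
def base : C := G.obj (𝟙_ V)

/-- The image of the unit object is a monoid, with multiplication
`G(𝟙) ⊗ G(𝟙) ⟶ G(𝟙 ⊗ 𝟙) ≅ G(𝟙)`. -/
instance : MonObj (base G) := Functor.monObjObj (F := G) (𝟙_ V)

lemma base_mul : MonObj.mul (X := base G) =
    LaxMonoidal.μ G (𝟙_ V) (𝟙_ V) ≫ G.map (λ_ (𝟙_ V)).hom := rfl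

lemma base_one : MonObj.one (X := base G) = LaxMonoidal.ε G :=
  (congrArg (LaxMonoidal.ε G ≫ ·) (G.map_id _)).trans (Category.comp_id _)

lemma act_one (X : V) : MonObj.one (X := base G) ▷ G.obj X ≫
    LaxMonoidal.μ G (𝟙_ V) X ≫ G.map (λ_ X).hom = (λ_ (G.obj X)).hom := by
  rw [base_one]
  exact (LaxMonoidal.left_unitality G X).symm

lemma act_mul_aux (X : V) :
    (LaxMonoidal.μ G (𝟙_ V) (𝟙_ V) ≫ G.map (λ_ (𝟙_ V)).hom) ▷ G.obj X ≫
      LaxMonoidal.μ G (𝟙_ V) X ≫ G.map (λ_ X).hom =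
    (α_ _ _ _).hom ≫ G.obj (𝟙_ V) ◁ (LaxMonoidal.μ G (𝟙_ V) X ≫ G.map (λ_ X).hom) ≫
      LaxMonoidal.μ G (𝟙_ V) X ≫ G.map (λ_ X).hom := by
  rw [comp_whiskerRight, Category.assoc, LaxMonoidal.μ_natural_left_assoc,
    MonoidalCategory.whiskerLeft_comp, Category.assoc, LaxMonoidal.μ_natural_right_assoc,
    ← LaxMonoidal.associativity_assoc, ← G.map_comp, ← G.map_comp, ← G.map_comp]
  simp

lemma act_mul (X : V) : MonObj.mul (X := base G) ▷ G.obj X ≫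
      LaxMonoidal.μ G (𝟙_ V) X ≫ G.map (λ_ X).hom =
    (α_ (base G) (base G) (G.obj X)).hom ≫
      base G ◁ (show base G ⊗ G.obj X ⟶ G.obj X from
        LaxMonoidal.μ G (𝟙_ V) X ≫ G.map (λ_ X).hom) ≫
      LaxMonoidal.μ G (𝟙_ V) X ≫ G.map (λ_ X).hom := act_mul_aux G X

/-- `G(X)` is a module over `G(𝟙)`, with action `G(𝟙) ⊗ G(X) ⟶ G(𝟙 ⊗ X) ≅ G(X)`. -/
def toModObj (X : V) : Mod C (base G) where
  X := G.obj X
  mod :=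
    { smul := LaxMonoidal.μ G (𝟙_ V) X ≫ G.map (λ_ X).hom
      one_smul := act_one G X
      mul_smul := act_mul G X }

lemma act_toModObj (X : V) : RelTensor.act (toModObj G X) =
    LaxMonoidal.μ G (𝟙_ V) X ≫ G.map (λ_ X).hom := rfl

/-- The linear map induced by a morphism. -/
def toModMap {X Y : V} (f : X ⟶ Y) : toModObj G X ⟶ toModObj G Y :=
  Mod.Hom.mk' (M := toModObj G X) (N := toModObj G Y) (G.map f) (by
    change (LaxMonoidal.μ G (𝟙_ V) X ≫ G.map (λ_ X).hom) ≫ G.map f =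
      G.obj (𝟙_ V) ◁ G.map f ≫ LaxMonoidal.μ G (𝟙_ V) Y ≫ G.map (λ_ Y).hom
    rw [LaxMonoidal.μ_natural_right_assoc, Category.assoc, ← G.map_comp, ← G.map_comp,
      leftUnitor_naturality])

/-- The functor `X ↦ G(X)` to modules over `G(𝟙)`. -/
def toMod : V ⥤ Mod C (base G) where
  obj := toModObj G
  map := toModMap G
  map_id X := Mod.hom_ext _ _ (G.map_id X)
  map_comp f g := Mod.hom_ext _ _ (G.map_comp f g)

lemma toMod_map_hom {X Y : V} (f : X ⟶ Y) : ((toMod G).map f).hom = G.map f := rfl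

variable [RelTensor.IsIdempotent (base G)]

/-- The canonical morphism from `G(𝟙)`, as a module over itself, to the module `G(𝟙)`. -/
def unitHom : 𝟙_ (Mod C (base G)) ⟶ (toMod G).obj (𝟙_ V) :=
  RelTensor.mkHom (M := Mod.regular (base G)) (N := toModObj G (𝟙_ V)) (𝟙 (base G))

/-- The projection `G(X) ⊗ G(Y) ⟶ G(X) ⊗_{G(𝟙)} G(Y)`. -/
def pr (X Y : V) : G.obj X ⊗ G.obj Y ⟶ (RelTensor.tensor (toModObj G X) (toModObj G Y)).X :=
  RelTensor.proj (toModObj G X) (toModObj G Y)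

instance (X Y : V) : IsIso (pr G X Y) :=
  inferInstanceAs (IsIso (RelTensor.proj (toModObj G X) (toModObj G Y)))

/-- The map underlying the canonical morphism `G(X) ⊗_{G(𝟙)} G(Y) ⟶ G(X ⊗ Y)`, induced by the map
`G(X) ⊗ G(Y) ⟶ G(X ⊗ Y)`. -/
def mulMap (X Y : V) : (RelTensor.tensor (toModObj G X) (toModObj G Y)).X ⟶ G.obj (X ⊗ Y) :=
  inv (pr G X Y) ≫ LaxMonoidal.μ G X Y

/-- The canonical morphism `G(X) ⊗_{G(𝟙)} G(Y) ⟶ G(X ⊗ Y)` induced by `G(X) ⊗ G(Y) ⟶ G(X ⊗ Y)`. -/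
def mulHom (X Y : V) : (toMod G).obj X ⊗ (toMod G).obj Y ⟶ (toMod G).obj (X ⊗ Y) :=
  RelTensor.mkHom (M := RelTensor.tensor (toModObj G X) (toModObj G Y)) (N := toModObj G (X ⊗ Y))
    (mulMap G X Y)

lemma pr_mulMap (X Y : V) : pr G X Y ≫ mulMap G X Y = LaxMonoidal.μ G X Y :=
  IsIso.hom_inv_id_assoc (pr G X Y) (LaxMonoidal.μ G X Y)

lemma mulHom_natural {X Y X' Y' : V} (f : X ⟶ X') (g : Y ⟶ Y') :
    RelTensor.tensorMap ((toMod G).map f) ((toMod G).map g) ≫ mulHom G X' Y' =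
      mulHom G X Y ≫ (toMod G).map (f ⊗ₘ g) :=
  RelTensor.tensor_hom_ext (by
    have h : pr G X Y ≫ (RelTensor.tensorMap (toModMap G f) (toModMap G g)).hom =
      (G.map f ⊗ₘ G.map g) ≫ pr G X' Y' := RelTensor.proj_tensorMap _ _
    change pr G X Y ≫ (RelTensor.tensorMap (toModMap G f) (toModMap G g)).hom ≫
      mulMap G X' Y' =
      pr G X Y ≫ mulMap G X Y ≫ G.map (f ⊗ₘ g)
    rw [reassoc_of% h, pr_mulMap, reassoc_of% (pr_mulMap G X Y), LaxMonoidal.μ_natural])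

lemma mulHom_assoc (X Y Z : V) :
    RelTensor.tensorMap (mulHom G X Y) (𝟙 ((toMod G).obj Z)) ≫ mulHom G (X ⊗ Y) Z ≫
        (toMod G).map (α_ X Y Z).hom =
      (RelTensor.assoc _ _ _).hom ≫ RelTensor.tensorMap (𝟙 ((toMod G).obj X)) (mulHom G Y Z) ≫
        mulHom G X (Y ⊗ Z) :=
  RelTensor.tensor_hom_ext₃ (by
    have h1 : RelTensor.proj (RelTensor.tensor (toModObj G X) (toModObj G Y)) (toModObj G Z) ≫
      (RelTensor.tensorMap (mulHom G X Y) (𝟙 (toModObj G Z))).hom =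
      (mulMap G X Y ▷ G.obj Z) ≫ pr G (X ⊗ Y) Z :=
        (RelTensor.proj_tensorMap _ _).trans (congrArg (· ≫ _) (tensorHom_id _ _))
    have h2 : RelTensor.proj (toModObj G X) (RelTensor.tensor (toModObj G Y) (toModObj G Z)) ≫
      (RelTensor.tensorMap (𝟙 (toModObj G X)) (mulHom G Y Z)).hom =
      (G.obj X ◁ mulMap G Y Z) ≫ pr G X (Y ⊗ Z) :=
        (RelTensor.proj_tensorMap _ _).trans (congrArg (· ≫ _) (id_tensorHom _ _))
    have h3 : pr G X Y ▷ G.obj Z ≫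
        RelTensor.proj (RelTensor.tensor (toModObj G X) (toModObj G Y)) (toModObj G Z) ≫
        (RelTensor.assoc (toModObj G X) (toModObj G Y) (toModObj G Z)).hom.hom =
      (α_ _ _ _).hom ≫ G.obj X ◁ pr G Y Z ≫
        RelTensor.proj (toModObj G X) (RelTensor.tensor (toModObj G Y) (toModObj G Z)) :=
      RelTensor.proj_assoc (toModObj G X) (toModObj G Y) (toModObj G Z)
    have h4 := congrArg (fun k => k ▷ G.obj Z) (pr_mulMap G X Y)
    have h5 := congrArg (fun k => G.obj X ◁ k) (pr_mulMap G Y Z)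
    simp only [comp_whiskerRight, MonoidalCategory.whiskerLeft_comp] at h4 h5
    have h6 : pr G X Y ▷ G.obj Z ≫ mulMap G X Y ▷ G.obj Z ≫ pr G (X ⊗ Y) Z ≫ mulMap G (X ⊗ Y) Z ≫
        G.map (α_ X Y Z).hom = (α_ _ _ _).hom ≫ G.obj X ◁ pr G Y Z ≫ G.obj X ◁ mulMap G Y Z ≫
        pr G X (Y ⊗ Z) ≫ mulMap G X (Y ⊗ Z) := by
      rw [reassoc_of% h4, reassoc_of% (pr_mulMap G (X ⊗ Y) Z), reassoc_of% h5,
        pr_mulMap, LaxMonoidal.associativity]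
    exact comp_eq_assoc h1 h2 h3 h6)

lemma unit_left (X : V) :
    (RelTensor.leftUnit ((toMod G).obj X)).hom =
      RelTensor.tensorMap (unitHom G) (𝟙 ((toMod G).obj X)) ≫ mulHom G (𝟙_ V) X ≫
        (toMod G).map (λ_ X).hom :=
  RelTensor.tensor_hom_ext (by
    have h : RelTensor.proj (Mod.regular (base G)) (toModObj G X) ≫
      (RelTensor.tensorMap (unitHom G) (𝟙 (toModObj G X))).hom = pr G (𝟙_ V) X :=
        (RelTensor.proj_tensorMap _ _).trans ((congrArg (· ≫ pr G (𝟙_ V) X)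
          (id_tensorHom_id (G.obj (𝟙_ V)) (G.obj X))).trans (Category.id_comp _))
    refine (RelTensor.proj_leftUnit (toModObj G X)).trans ?_
    change _ = RelTensor.proj (Mod.regular (base G)) (toModObj G X) ≫
      (RelTensor.tensorMap (unitHom G) (𝟙 (toModObj G X))).hom ≫ mulMap G (𝟙_ V) X ≫
        G.map (λ_ X).hom
    exact ((comp_eq h _).trans (comp_eq (pr_mulMap G (𝟙_ V) X) (G.map (λ_ X).hom))).symm)

lemma unit_right (X : V) :
    (RelTensor.rightUnit ((toMod G).obj X)).hom =
      RelTensor.tensorMap (𝟙 ((toMod G).obj X)) (unitHom G) ≫ mulHom G X (𝟙_ V) ≫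
        (toMod G).map (ρ_ X).hom :=
  RelTensor.tensor_hom_ext (by
    have h : RelTensor.proj (toModObj G X) (Mod.regular (base G)) ≫
      (RelTensor.tensorMap (𝟙 (toModObj G X)) (unitHom G)).hom = pr G X (𝟙_ V) :=
        (RelTensor.proj_tensorMap _ _).trans ((congrArg (· ≫ pr G X (𝟙_ V))
          (id_tensorHom_id (G.obj X) (G.obj (𝟙_ V)))).trans (Category.id_comp _))
    have h' : (β_ (G.obj X) (G.obj (𝟙_ V))).hom ≫ LaxMonoidal.μ G (𝟙_ V) X ≫ G.map (λ_ X).hom =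
        LaxMonoidal.μ G X (𝟙_ V) ≫ G.map (ρ_ X).hom := by
      rw [← LaxBraided.braided_assoc, ← G.map_comp, braiding_leftUnitor]
    refine (RelTensor.proj_rightUnit (toModObj G X)).trans (h'.trans ?_)
    change _ = RelTensor.proj (toModObj G X) (Mod.regular (base G)) ≫
      (RelTensor.tensorMap (𝟙 (toModObj G X)) (unitHom G)).hom ≫ mulMap G X (𝟙_ V) ≫
        G.map (ρ_ X).hom
    exact ((comp_eq h _).trans (comp_eq (pr_mulMap G X (𝟙_ V)) (G.map (ρ_ X).hom))).symm)

lemma mulHom_swap (X Y : V) :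
    mulHom G X Y ≫ (toMod G).map (β_ X Y).hom = (RelTensor.swap _ _).hom ≫ mulHom G Y X :=
  RelTensor.tensor_hom_ext (by
    have h : pr G X Y ≫ (RelTensor.swap (toModObj G X) (toModObj G Y)).hom.hom =
      (β_ _ _).hom ≫ pr G Y X := RelTensor.proj_swap _ _
    change pr G X Y ≫ mulMap G X Y ≫ G.map (β_ X Y).hom =
      pr G X Y ≫ (RelTensor.swap (toModObj G X) (toModObj G Y)).hom.hom ≫ mulMap G Y X
    rw [reassoc_of% (pr_mulMap G X Y), reassoc_of% h, pr_mulMap, LaxBraided.braided])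

/-- The functor to modules over `G(𝟙)` is lax symmetric monoidal for the relative tensor
product. -/
instance : (toMod G).LaxBraided where
  toLaxMonoidal := Functor.LaxMonoidal.ofTensorHom (unitHom G) (mulHom G)
    (mulHom_natural G) (mulHom_assoc G) (unit_left G) (unit_right G)
  braided := mulHom_swap G

end

end LaxToMod

section

variable {F : Type u} [NontriviallyNormedField F] [IsUltrametricDist F] [CompleteSpace F]
variable (π : PseudoUniformizer F)

/-- The element of `F` underlying an element of a member of `F̲`. -/
def coeF {n : ℕ} (x : latticeObj π (BanMod.unit F) n) : F := Subtype.val x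

lemma tmul_one_eq {n m : ℕ} (u x : latticeObj π (BanMod.unit F) n)
    (w y : latticeObj π (BanMod.unit F) m) (hu : coeF π u = 1)
    (hw : coeF π w = coeF π x * coeF π y) :
    BanMod.tmul u w = BanMod.tmul x y := by
  have hπ : π.val ^ n ≠ 0 := pow_ne_zero n π.ne_zero
  let p : unitBall F := ⟨π.val ^ n, by
    change ‖π.val ^ n‖ ≤ 1
    rw [norm_pow]
    exact pow_le_one₀ (norm_nonneg _) π.norm_lt_one.le⟩
  let a : unitBall F := ⟨π.val ^ n * coeF π x, by
    have h : ‖((1 : F) * π.val ^ n) * coeF π x‖ ≤ 1 := coe_mem x 1 (by simp)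
    rw [one_mul] at h
    exact h⟩
  let e : latticeObj π (BanMod.unit F) n := ⟨(show F from (π.val ^ n)⁻¹), fun r hr => by
    change ‖(r * π.val ^ n) * (π.val ^ n)⁻¹‖ ≤ 1
    rwa [mul_inv_cancel_right₀ hπ]⟩
  have h1 : u = p • e := coe_injective (hu.trans (mul_inv_cancel₀ hπ).symm)
  have h2 : x = a • e := coe_injective (by
    change coeF π x = (π.val ^ n * coeF π x) * (π.val ^ n)⁻¹
    rw [mul_comm (π.val ^ n), mul_inv_cancel_right₀ hπ])
  have h3 : p • w = a • y := coe_injective (by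
    change π.val ^ n * coeF π w = (π.val ^ n * coeF π x) * coeF π y
    rw [hw, mul_assoc])
  rw [h1, h2, BanMod.smul_tmul, BanMod.smul_tmul, ← BanMod.tmul_smul, ← BanMod.tmul_smul, h3]

lemma mul_unit_aux {n m p q : ℕ}
    (hp : ∀ v ∈ lattice π _ (n + m), BanMod.lin (BanMod.leftUnitHom (BanMod.unit F)) v ∈
      lattice π (BanMod.unit F) p)
    (h1 : ∀ v ∈ lattice π (BanMod.unit F) 0, BanMod.lin (𝟙 (BanMod.unit F)) v ∈
      lattice π (BanMod.unit F) n)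
    (h2 : ∀ v ∈ lattice π (BanMod.unit F) p, BanMod.lin (𝟙 (BanMod.unit F)) v ∈
      lattice π (BanMod.unit F) q)
    (h3 : ∀ v ∈ lattice π (BanMod.unit F) n, BanMod.lin (𝟙 (BanMod.unit F)) v ∈
      lattice π (BanMod.unit F) n)
    (h4 : ∀ v ∈ lattice π (BanMod.unit F) m, BanMod.lin (𝟙 (BanMod.unit F)) v ∈
      lattice π (BanMod.unit F) q) :
    ((latticeMul (BanMod.unit F) (BanMod.unit F) n m ≫
      latticeMap (BanMod.leftUnitHom (BanMod.unit F)) hp) ≫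
      (BanMod.leftUnit (latticeObj π (BanMod.unit F) p)).inv ≫
      BanMod.tensorMap (latticeOne π) (𝟙 _)) ≫
      BanMod.tensorMap (latticeMap (𝟙 _) h1) (latticeMap (𝟙 _) h2) =
    𝟙 (BanMod.tensor (latticeObj π (BanMod.unit F) n) (latticeObj π (BanMod.unit F) m)) ≫
      BanMod.tensorMap (latticeMap (𝟙 _) h3) (latticeMap (𝟙 _) h4) :=
  BanMod.tensor_ext fun x y => by
    have hi (z : latticeObj π (BanMod.unit F) p) :
        BanMod.lin (BanMod.leftUnit (latticeObj π (BanMod.unit F) p)).inv z =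
          BanMod.tmul BanMod.one z := rfl
    rw [BanMod.lin_comp, BanMod.lin_comp, BanMod.lin_comp, hi, BanMod.tensorMap_tmul,
      BanMod.tensorMap_tmul, BanMod.lin_id, BanMod.lin_comp, BanMod.lin_comp, BanMod.lin_id, BanMod.tensorMap_tmul]
    refine tmul_one_eq π _ _ _ _ rfl ?_
    change BanMod.lin (BanMod.leftUnitHom (BanMod.unit F)) (coe (BanMod.lin (latticeMul (BanMod.unit F)
      (BanMod.unit F) n m) (BanMod.tmul x y))) = coeF π x * coeF π y
    rw [coe_latticeMul, BanMod.leftUnitHom_tmul]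
    rfl

lemma mul_comp_inv :
    (underlineMul π (IndObj.const (BanMod.unit F)) (IndObj.const (BanMod.unit F)) ≫
      underlineMap π (IndObj.leftUnit (IndObj.const (BanMod.unit F))).hom) ≫
      (IndObj.leftUnit (underline π (IndObj.const (BanMod.unit F)))).inv ≫
      IndObj.tensorMap (underlineOne π) (𝟙 (underline π (IndObj.const (BanMod.unit F)))) =
      𝟙 (IndObj.tensor (underline π (IndObj.const (BanMod.unit F)))
        (underline π (IndObj.const (BanMod.unit F)))) :=
  IndObj.hom_ext fun ⟨⟨s, n⟩, ⟨t, m⟩⟩ => by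
    obtain ⟨p, hp⟩ := exists_map_lattice π (BanMod.leftUnitHom (BanMod.unit F)) (n + m)
    have e1 := IndObj.app_comp_of_eq
      (underlineMul π (IndObj.const (BanMod.unit F)) (IndObj.const (BanMod.unit F)))
      (underlineMap π (IndObj.leftUnit (IndObj.const (BanMod.unit F))).hom)
      (app_underlineMul π (IndObj.const (BanMod.unit F)) (IndObj.const (BanMod.unit F)) s n t m)
    have e2 := e1.trans (congrArg (IndObj.HomTo.pre _) (app_underlineMap π _
      (IndObj.app_leftUnit_hom (IndObj.const (BanMod.unit F)) s t) hp))
    have e3 := IndObj.app_comp_of_eq _ ((IndObj.leftUnit (underline π (IndObj.const (BanMod.unit F)))).inv ≫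
      IndObj.tensorMap (underlineOne π) (𝟙 (underline π (IndObj.const (BanMod.unit F))))) e2
    refine e3.trans ?_
    refine (congrArg (IndObj.HomTo.pre _) (IndObj.app_comp_of_eq _ _
      (IndObj.app_leftUnit_inv _ _))).trans ?_
    refine (congrArg (fun k => IndObj.HomTo.pre _ (IndObj.HomTo.pre _ k))
      (IndObj.app_tensorMap_of_eq _ _ rfl (IndObj.app_id _ _))).trans ?_
    have h1 (v) (hv : v ∈ lattice π (BanMod.unit F) 0) := lattice_mono π _ (Nat.zero_le n) hv
    have h2 (v) (hv : v ∈ lattice π (BanMod.unit F) p) := lattice_mono π _ (le_max_left p m) hv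
    have h3 (v) (hv : v ∈ lattice π (BanMod.unit F) n) := hv
    have h4 (v) (hv : v ∈ lattice π (BanMod.unit F) m) := lattice_mono π _ (le_max_right p m) hv
    exact IndObj.HomTo.mk_eq_mk.2 ⟨(⟨s, n⟩, ⟨t, max p m⟩), (⟨𝟙 _, h1⟩, ⟨𝟙 _, h2⟩),
      (⟨𝟙 _, h3⟩, ⟨𝟙 _, h4⟩), mul_unit_aux π hp h1 h2 h3 h4⟩

variable (F)

/-- The monoid `F̲`, the formal colimit of the `π⁻ⁿ F°`, in ind-Banach modules over `F°`. -/
abbrev baseMonoid : IndObj (BanMod (unitBall F)) := LaxToMod.base (underlineFunctor π)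

lemma baseMonoid_mul : MonObj.mul (X := baseMonoid F π) =
    underlineMul π (𝟙_ (IndObj (BanMod F))) (𝟙_ (IndObj (BanMod F))) ≫
      underlineMap π (λ_ (𝟙_ (IndObj (BanMod F)))).hom := rfl

lemma baseMonoid_one : MonObj.one (X := baseMonoid F π) = underlineOne π :=
  LaxToMod.base_one (underlineFunctor π)

instance : RelTensor.IsIdempotent (baseMonoid F π) :=
  RelTensor.isIdempotent_of (by
    rw [baseMonoid_mul, baseMonoid_one]
    exact mul_comp_inv π)

/-- The category of ind-Banach modules over `F̲`, i.e. of `F̲`-modules in ind-Banach modules over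
`F°`. It is symmetric monoidal for the relative tensor product over `F̲`. -/
abbrev IndBanUnderline : Type (u + 1) := Mod (IndObj (BanMod (unitBall F))) (baseMonoid F π)

/-- The functor `V ↦ V̲` from ind-Banach spaces over `F` to ind-Banach modules over `F̲`, with its
canonical lax symmetric monoidal structure. -/
abbrev toUnderline : IndObj (BanMod F) ⥤ IndBanUnderline F π := LaxToMod.toMod (underlineFunctor π)

end

/-! ### Exactness -/

instance {C : Type w} [Category.{v} C] [MonoidalCategory C] [SymmetricCategory C]
    [Limits.HasZeroMorphisms C] {A : C} [MonObj A] [RelTensor.IsIdempotent A] :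
    Limits.HasZeroMorphisms (Mod C A) where
  zero M N := ⟨RelTensor.mkHom (0 : M.X ⟶ N.X)⟩
  comp_zero f N := Mod.hom_ext _ _ (Limits.comp_zero (f := f.hom))
  zero_comp M _ _ f := Mod.hom_ext _ _ (Limits.zero_comp (f := f.hom))

instance {C : Type w} [Category.{v} C] [Limits.HasZeroMorphisms C] (P : ObjectProperty C) :
    Limits.HasZeroMorphisms P.FullSubcategory where
  zero X Y := ⟨ObjectProperty.homMk (0 : X.obj ⟶ Y.obj)⟩
  comp_zero f Z := ObjectProperty.hom_ext P (Limits.comp_zero (f := f.hom))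
  zero_comp X _ _ f := ObjectProperty.hom_ext P (Limits.zero_comp (f := f.hom))

section

variable {C : Type*} [Category* C] [Limits.HasZeroMorphisms C]
variable {D : Type*} [Category* D] [Limits.HasZeroMorphisms D]

/-- `i` is a kernel of `f`. -/
def IsKernelOf {X Y Z : C} (i : X ⟶ Y) (f : Y ⟶ Z) : Prop :=
  ∃ h : i ≫ f = 0, Nonempty (Limits.IsLimit (Limits.KernelFork.ofι i h))

/-- `p` is a cokernel of `f`. -/
def IsCokernelOf {X Y Z : C} (p : Y ⟶ Z) (f : X ⟶ Y) : Prop :=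
  ∃ h : f ≫ p = 0, Nonempty (Limits.IsColimit (Limits.CokernelCofork.ofπ p h))

/-- `0 ⟶ X ⟶ Y ⟶ Z ⟶ 0` is strictly short exact: `i` is a kernel of `p` and `p` is a cokernel of
`i`. -/
def IsStrictShortExact {X Y Z : C} (i : X ⟶ Y) (p : Y ⟶ Z) : Prop :=
  IsKernelOf i p ∧ IsCokernelOf p i

/-- A functor is exact if it preserves strictly short exact sequences. -/
def IsExact (G : C ⥤ D) : Prop :=
  ∀ {X Y Z : C} (i : X ⟶ Y) (p : Y ⟶ Z), IsStrictShortExact i p →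
    IsStrictShortExact (G.map i) (G.map p)

/-- A functor is strongly left exact if it preserves the kernels of arbitrary morphisms. -/
def IsStronglyLeftExact (G : C ⥤ D) : Prop :=
  ∀ {X Y Z : C} (i : X ⟶ Y) (f : Y ⟶ Z), IsKernelOf i f → IsKernelOf (G.map i) (G.map f)

end

/-! ### Quotients of Banach modules -/

namespace BanMod

section

variable {R : Type u} [NormedCommRing R]

/-- The quotient of a Banach module by a closed submodule, with the quotient norm. -/
def quot (V : BanMod R) (N : Submodule R V) (h : IsClosed (N : Set V)) : BanMod R where
  carrier := V ⧸ N
  normed := Submodule.Quotient.normedAddCommGroup N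
  ultra := by
    let := Submodule.Quotient.normedAddCommGroup N
    refine IsUltrametricDist.isUltrametricDist_of_forall_norm_add_le_max_norm fun x y => ?_
    refine le_of_forall_pos_le_add fun e he => ?_
    obtain ⟨a, rfl, ha⟩ := Submodule.Quotient.norm_mk_lt x he
    obtain ⟨b, rfl, hb⟩ := Submodule.Quotient.norm_mk_lt y he
    refine (Submodule.Quotient.norm_mk_le N (a + b)).trans ?_
    refine (IsUltrametricDist.norm_add_le_max a b).trans ?_
    rw [max_add]
    exact max_le_max ha.le hb.le
  complete := Submodule.Quotient.completeSpace N
  smul_bound := by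
    let := Submodule.Quotient.normedAddCommGroup N
    obtain ⟨C, hC, hV⟩ := V.exists_smul_bound
    refine ⟨C, fun r x => le_of_forall_pos_le_add fun e he => ?_⟩
    have hK : 0 < C * ‖r‖ + 1 := by positivity
    obtain ⟨a, rfl, ha⟩ := Submodule.Quotient.norm_mk_lt x (div_pos he hK)
    have h1 : ‖r • a‖ ≤ C * ‖r‖ * ‖a‖ := hV r a
    have h2 : C * ‖r‖ * (e / (C * ‖r‖ + 1)) ≤ e := by
      rw [mul_div_assoc', div_le_iff₀ hK]
      nlinarith
    calc ‖Submodule.Quotient.mk (p := N) (r • a)‖ ≤ ‖r • a‖ := Submodule.Quotient.norm_mk_le N _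
      _ ≤ C * ‖r‖ * ‖a‖ := h1
      _ ≤ C * ‖r‖ * (‖Submodule.Quotient.mk (p := N) a‖ + e / (C * ‖r‖ + 1)) := by gcongr
      _ ≤ _ := by rw [mul_add]; gcongr

variable {V W : BanMod R} {N : Submodule R V} {h : IsClosed (N : Set V)}

/-- The projection to the quotient. -/
def quotMk (V : BanMod R) (N : Submodule R V) (h : IsClosed (N : Set V)) : V ⟶ quot V N h :=
  ofLin (N := quot V N h) N.mkQ ⟨1, fun v => by
    rw [one_mul]
    exact Submodule.Quotient.norm_mk_le N v⟩

lemma quotMk_surjective : Function.Surjective (lin (quotMk V N h)) := N.mkQ_surjective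

lemma quotMk_eq_zero {v : V} : lin (quotMk V N h) v = 0 ↔ v ∈ N := Submodule.Quotient.mk_eq_zero N

lemma exists_norm_quotMk (x : quot V N h) {e : ℝ} (he : 0 < e) :
    ∃ v, lin (quotMk V N h) v = x ∧ ‖v‖ < ‖x‖ + e := Submodule.Quotient.norm_mk_lt x he

lemma bound_of_quotMk {S : Type*} [SeminormedAddCommGroup S] (f : quot V N h → S) {C : ℝ}
    (hC : 0 ≤ C) (hf : ∀ v, ‖f (lin (quotMk V N h) v)‖ ≤ C * ‖v‖) (x : quot V N h) :
    ‖f x‖ ≤ C * ‖x‖ := by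
  refine le_of_forall_pos_le_add fun e he => ?_
  have hK : 0 < C + 1 := by positivity
  obtain ⟨v, rfl, hv⟩ := exists_norm_quotMk x (div_pos he hK)
  refine (hf v).trans ?_
  have h2 : C * (e / (C + 1)) ≤ e := by
    rw [mul_div_assoc', div_le_iff₀ hK]
    nlinarith
  calc C * ‖v‖ ≤ C * (‖lin (quotMk V N h) v‖ + e / (C + 1)) := by gcongr
    _ ≤ _ := by rw [mul_add]; gcongr

/-- The morphism induced on a quotient. -/
def quotLift (f : V ⟶ W) (hf : N ≤ LinearMap.ker (lin f)) : quot V N h ⟶ W :=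
  ofLin (M := quot V N h) (N.liftQ (lin f) hf) (by
    obtain ⟨C, hC, hb⟩ := exists_bound f
    exact ⟨C, bound_of_quotMk (h := h) (N.liftQ (lin f) hf) hC hb⟩)

lemma quotMk_quotLift (f : V ⟶ W) (hf : N ≤ LinearMap.ker (lin f)) :
    quotMk V N h ≫ quotLift f hf = f := hom_ext fun _ => rfl

lemma quot_ext {f g : quot V N h ⟶ W} (H : quotMk V N h ≫ f = quotMk V N h ≫ g) : f = g :=
  hom_ext fun x => by
    obtain ⟨v, rfl⟩ := quotMk_surjective x
    exact congrArg (fun k => lin k v) H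

lemma isClosed_ker (f : V ⟶ W) : IsClosed (LinearMap.ker (lin f) : Set V) :=
  isClosed_eq (continuous_lin f) continuous_const

end

section

variable {R : Type u} [NormedCommRing R]

lemma mono_of_injective {V W : BanMod R} (f : V ⟶ W)
    (hf : Function.Injective (lin f)) : Mono f :=
  ⟨fun _ _ h => hom_ext fun v => hf (congrArg (fun k => lin k v) h)⟩

end

end BanMod

/-! ### Complete bornological spaces -/

section

variable {C : Type w} [Category.{v} C]

/-- A diagram all of whose transition maps are monomorphisms. -/
def IsMonomorphic (X : IndObj C) : Prop := ∀ {i j : X.J} (a : i ⟶ j), Mono (X.diag.map a)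

/-- An ind-object is essentially monomorphic if it is isomorphic to the ind-object of a diagram all
of whose transition maps are monomorphisms. -/
def essentiallyMonomorphic : ObjectProperty (IndObj C) :=
  ObjectProperty.isoClosure fun Y => IsMonomorphic Y

lemma IndObj.epi_of_levelwise {X Y : IndObj C} (e : X ⟶ Y) (s : X.J → Y.J) (hs : ∀ j, ∃ i, s i = j)
    (f : ∀ i, X.diag.obj i ⟶ Y.diag.obj (s i)) (hf : ∀ i, IndObj.app e i = HomTo.mk (s i) (f i))
    (hepi : ∀ i, Epi (f i)) : Epi e :=
  ⟨fun {Z} g h H => IndObj.hom_ext fun j => by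
    obtain ⟨i, rfl⟩ := hs j
    have h1 := congrArg (fun k => IndObj.app k i) H
    simp only [app_comp_of_eq _ _ (hf i)] at h1
    obtain ⟨k, a, ha⟩ := (IndObj.app g (s i)).exists_mk
    obtain ⟨l, b, hb⟩ := (IndObj.app h (s i)).exists_mk
    rw [ha, hb, HomTo.pre_mk, HomTo.pre_mk] at h1
    obtain ⟨m, c, d, hcd⟩ := HomTo.mk_eq_mk.1 h1
    rw [ha, hb]
    refine HomTo.mk_eq_mk.2 ⟨m, c, d, ?_⟩
    simp only [Category.assoc] at hcd
    exact (cancel_epi (f i)).1 hcd⟩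

end

section

variable (F : Type u) [NontriviallyNormedField F]

/-- The category of complete bornological spaces over `F`, as the category of essentially
monomorphic ind-Banach spaces. -/
abbrev CBorn : Type (u + 1) :=
  (essentiallyMonomorphic : ObjectProperty (IndObj (BanMod F))).FullSubcategory

end

section

variable {F : Type u} [NontriviallyNormedField F]

/-- The vector space `|E| = colim |Eᵢ|` underlying an ind-Banach space. -/
def space (E : IndObj (BanMod F)) : ModuleCat.{u} F :=
  Limits.colimit (E.diag ⋙ BanMod.forgetModule)

/-- The canonical map `|Eᵢ| → |E|`. -/
def toSpace (E : IndObj (BanMod F)) (i : E.J) : E.diag.obj i →ₗ[F] space E :=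
  (Limits.colimit.ι (E.diag ⋙ BanMod.forgetModule) i).hom

/-- A subset of `|E|` is bounded if it is contained in the image of a bounded subset of some
`Eᵢ`. -/
def IsBoundedIn (E : IndObj (BanMod F)) (B : Set (space E)) : Prop :=
  ∃ (i : E.J) (c : ℝ), ∀ b ∈ B, ∃ x : E.diag.obj i, ‖x‖ ≤ c ∧ toSpace E i x = b

/-- A sequence `eₙ` converges bornologically to zero if there is a bounded subset `B` such that, for
every nonzero scalar `r`, we have `eₙ ∈ r B` for all large `n`. -/
def ConvergesToZero (E : IndObj (BanMod F)) (e : ℕ → space E) : Prop :=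
  ∃ B : Set (space E), IsBoundedIn E B ∧
    ∀ r : F, r ≠ 0 → ∃ N : ℕ, ∀ n ≥ N, ∃ b ∈ B, e n = r • b

/-- A sequence `eₙ` converges bornologically to `x` if `x - eₙ` converges to zero. -/
def ConvergesTo (E : IndObj (BanMod F)) (e : ℕ → space E) (x : space E) : Prop :=
  ConvergesToZero E fun n => x - e n

/-- A subset is bornologically closed if it contains the limits of its convergent sequences. -/
def IsBornClosed (E : IndObj (BanMod F)) (S : Set (space E)) : Prop :=
  ∀ (e : ℕ → space E) (x : space E), (∀ n, e n ∈ S) → ConvergesTo E e x → x ∈ S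

/-- A complete bornological space is proper if its bornology has a basis of closed subsets: there is
a collection of closed bounded subsets such that every bounded subset is contained in a finite union
of members of the collection. -/
def IsProper (E : CBorn F) : Prop :=
  ∃ 𝓑 : Set (Set (space E.obj)), (∀ S ∈ 𝓑, IsBoundedIn E.obj S ∧ IsBornClosed E.obj S) ∧
    ∀ B, IsBoundedIn E.obj B → ∃ 𝓕 : Set (Set (space E.obj)), 𝓕 ⊆ 𝓑 ∧ 𝓕.Finite ∧ B ⊆ ⋃₀ 𝓕

/-! ### The reflector onto complete bornological spaces and their tensor product -/

variable [IsUltrametricDist F] [CompleteSpace F]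

lemma BanMod.injective_of_mono {V W : BanMod F} (f : V ⟶ W) (hf : Mono f) :
    Function.Injective (BanMod.lin f) := by
  rw [injective_iff_map_eq_zero]
  intro x hx
  obtain ⟨C, -, hC⟩ := V.exists_smul_bound
  let g : BanMod.unit F ⟶ V := BanMod.ofLin (M := BanMod.unit F) (LinearMap.toSpanSingleton F V x)
    ⟨C * ‖x‖, fun r => (hC r x).trans (mul_right_comm C ‖r‖ ‖x‖).le⟩
  have hg : g ≫ f = 0 ≫ f := BanMod.hom_ext fun r => by
    rw [Limits.zero_comp]
    exact ((BanMod.lin f).map_smul (show F from r) x).trans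
      ((congrArg ((show F from r) • ·) hx).trans (smul_zero _))
  have h := congrArg (fun k => BanMod.lin k (1 : F)) ((cancel_mono f).1 hg)
  exact (one_smul F x).symm.trans h

lemma ker_eq_of_mk_eq {A : BanMod F} {B : IndObj (BanMod F)} (hB : IsMonomorphic B) {j j' : B.J}
    {f : A ⟶ B.diag.obj j} {f' : A ⟶ B.diag.obj j'}
    (h : IndObj.HomTo.mk j f = IndObj.HomTo.mk j' f') (x : A) (hx : BanMod.lin f x = 0) :
    BanMod.lin f' x = 0 := by
  obtain ⟨k, a, b, hab⟩ := IndObj.HomTo.mk_eq_mk.1 h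
  have h1 := congrArg (fun k => BanMod.lin k x) hab
  refine BanMod.injective_of_mono _ (hB b) ?_
  rw [map_zero]
  exact h1.symm.trans ((congrArg (BanMod.lin (B.diag.map a)) hx).trans (map_zero _))

/-- The intersection of the kernels of all maps from `Eᵢ` to members of monomorphic ind-objects `B`
that represent a component of a morphism `E ⟶ B`. -/
def reflKer (E : IndObj (BanMod F)) (i : E.J) : Submodule F (E.diag.obj i) :=
  sInf {K | ∃ B : IndObj (BanMod F), IsMonomorphic B ∧ ∃ (φ : E ⟶ B) (j : B.J)
    (f : E.diag.obj i ⟶ B.diag.obj j), IndObj.app φ i = IndObj.HomTo.mk j f ∧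
      K = LinearMap.ker (BanMod.lin f)}

lemma mem_reflKer {E : IndObj (BanMod F)} {i : E.J} {x : E.diag.obj i} :
    x ∈ reflKer E i ↔ ∀ B : IndObj (BanMod F), IsMonomorphic B → ∀ (φ : E ⟶ B) (j : B.J)
      (f : E.diag.obj i ⟶ B.diag.obj j), IndObj.app φ i = IndObj.HomTo.mk j f →
        BanMod.lin f x = 0 := by
  rw [reflKer, Submodule.mem_sInf]
  refine ⟨fun h B hB φ j f hf => h _ ⟨B, hB, φ, j, f, hf, rfl⟩, ?_⟩
  rintro h _ ⟨B, hB, φ, j, f, hf, rfl⟩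
  exact h B hB φ j f hf

lemma isClosed_reflKer (E : IndObj (BanMod F)) (i : E.J) :
    IsClosed (reflKer E i : Set (E.diag.obj i)) := by
  have h : (reflKer E i : Set (E.diag.obj i)) = ⋂ K ∈ {K | ∃ B : IndObj (BanMod F),
      IsMonomorphic B ∧ ∃ (φ : E ⟶ B) (j : B.J) (f : E.diag.obj i ⟶ B.diag.obj j),
        IndObj.app φ i = IndObj.HomTo.mk j f ∧ K = LinearMap.ker (BanMod.lin f)},
      (K : Set (E.diag.obj i)) := Submodule.coe_sInf _
  rw [h]
  refine isClosed_biInter ?_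
  rintro _ ⟨B, hB, φ, j, f, hf, rfl⟩
  exact BanMod.isClosed_ker f

lemma map_mem_reflKer {E : IndObj (BanMod F)} {i i' : E.J} (a : i ⟶ i') {x : E.diag.obj i} :
    BanMod.lin (E.diag.map a) x ∈ reflKer E i' ↔ x ∈ reflKer E i := by
  rw [mem_reflKer, mem_reflKer]
  refine ⟨fun h B hB φ j f hf => ?_, fun h B hB φ j f hf => ?_⟩
  · obtain ⟨j', f', hf'⟩ := (IndObj.app φ i').exists_mk
    refine ker_eq_of_mk_eq hB (f := E.diag.map a ≫ f') ?_ x (h B hB φ j' f' hf')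
    rw [← hf, ← IndObj.pre_app φ a, hf', IndObj.HomTo.pre_mk]
  · refine h B hB φ j (E.diag.map a ≫ f) ?_
    rw [← IndObj.pre_app φ a, hf, IndObj.HomTo.pre_mk]

/-- The transition map `Eᵢ / Nᵢ ⟶ Eⱼ / Nⱼ`. -/
def reflTrans (E : IndObj (BanMod F)) {i i' : E.J} (a : i ⟶ i') :
    BanMod.quot (E.diag.obj i) (reflKer E i) (isClosed_reflKer E i) ⟶
      BanMod.quot (E.diag.obj i') (reflKer E i') (isClosed_reflKer E i') :=
  BanMod.quotLift (E.diag.map a ≫ BanMod.quotMk _ _ _)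
    fun x hx => LinearMap.mem_ker.2 ((BanMod.lin_comp _ _ x).trans
      (BanMod.quotMk_eq_zero.2 ((map_mem_reflKer a).2 hx)))

lemma quotMk_reflTrans (E : IndObj (BanMod F)) {i i' : E.J} (a : i ⟶ i') :
    BanMod.quotMk (E.diag.obj i) (reflKer E i) (isClosed_reflKer E i) ≫ reflTrans E a =
      E.diag.map a ≫ BanMod.quotMk _ _ _ := BanMod.quotMk_quotLift _ _

/-- The largest monomorphic quotient of an ind-Banach space: the formal colimit of the `Eᵢ / Nᵢ`. -/
def reflObj (E : IndObj (BanMod F)) : IndObj (BanMod F) where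
  J := E.J
  diag :=
    { obj := fun i => BanMod.quot (E.diag.obj i) (reflKer E i) (isClosed_reflKer E i)
      map := reflTrans E
      map_id := fun i => BanMod.quot_ext (by
        rw [quotMk_reflTrans, E.diag.map_id, Category.id_comp, Category.comp_id])
      map_comp := fun a b => BanMod.quot_ext (by
        rw [quotMk_reflTrans, ← Category.assoc, quotMk_reflTrans, Category.assoc,
          quotMk_reflTrans, E.diag.map_comp, Category.assoc]) }

/-- The projection `Eᵢ ⟶ Eᵢ / Nᵢ`. -/
def reflMk (E : IndObj (BanMod F)) (i : E.J) : E.diag.obj i ⟶ (reflObj E).diag.obj i :=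
  BanMod.quotMk (E.diag.obj i) (reflKer E i) (isClosed_reflKer E i)

lemma reflMk_natural (E : IndObj (BanMod F)) {i i' : E.J} (a : i ⟶ i') :
    E.diag.map a ≫ reflMk E i' = reflMk E i ≫ (reflObj E).diag.map a :=
  (quotMk_reflTrans E a).symm

lemma reflMk_surjective (E : IndObj (BanMod F)) (i : E.J) :
    Function.Surjective (BanMod.lin (reflMk E i)) := BanMod.quotMk_surjective

lemma reflMk_eq_zero {E : IndObj (BanMod F)} {i : E.J} {x : E.diag.obj i} :
    BanMod.lin (reflMk E i) x = 0 ↔ x ∈ reflKer E i := BanMod.quotMk_eq_zero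

lemma isMonomorphic_reflObj (E : IndObj (BanMod F)) : IsMonomorphic (reflObj E) := fun {i i'} a =>
  BanMod.mono_of_injective _ (by
    rw [injective_iff_map_eq_zero]
    intro y hy
    obtain ⟨x, rfl⟩ := reflMk_surjective E i y
    have h := congrArg (fun k => BanMod.lin k x) (reflMk_natural E a)
    have h1 : BanMod.lin (reflMk E i') (BanMod.lin (E.diag.map a) x) = 0 := h.trans hy
    exact reflMk_eq_zero.2 ((map_mem_reflKer (E := E) a).1 (reflMk_eq_zero.1 h1)))

/-- The projection from an ind-Banach space to its largest monomorphic quotient. -/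
def reflUnit (E : IndObj (BanMod F)) : E ⟶ reflObj E :=
  IndObj.levelHom (Y := reflObj E) (fun i => i) (fun a => a) (reflMk E) (reflMk_natural E)

lemma epi_of_surjective {V W : BanMod F} (f : V ⟶ W) (hf : Function.Surjective (BanMod.lin f)) :
    Epi f :=
  ⟨fun _ _ h => BanMod.hom_ext fun w => by
    obtain ⟨v, rfl⟩ := hf w
    exact congrArg (fun k => BanMod.lin k v) h⟩

instance (E : IndObj (BanMod F)) : Epi (reflUnit E) :=
  IndObj.epi_of_levelwise (reflUnit E) (fun i => i) (fun j => ⟨j, rfl⟩) (reflMk E) (fun _ => rfl)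
    (fun i => epi_of_surjective _ (reflMk_surjective E i))

end

namespace BanMod

section

variable {R : Type u} [NormedCommRing R]

/-- For fixed `m`, the map `N ⟶ M ⊗ N`, `n ↦ m ⊗ n`. -/
def tmulLeft {M : BanMod R} (N : BanMod R) (m : M) : N ⟶ tensor M N :=
  ofLin (tmulₗ M N m) ⟨‖m‖, fun n => norm_tmul_le m n⟩

lemma tmulLeft_apply {M N : BanMod R} (m : M) (n : N) : lin (tmulLeft N m) n = tmul m n := rfl

lemma exists_tensor_quot {V W P : BanMod R} {N : Submodule R W} {h : IsClosed (N : Set W)}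
    (f : tensor V W ⟶ P) (hf : ∀ x, ∀ y ∈ N, lin f (tmul x y) = 0) :
    ∃ g : tensor V (quot W N h) ⟶ P, tensorMap (𝟙 V) (quotMk W N h) ≫ g = f := by
  let q (x : V) : quot W N h ⟶ P := quotLift (tmulLeft W x ≫ f) fun y hy =>
    LinearMap.mem_ker.2 (hf x y hy)
  have hq (x : V) (y : W) : lin (q x) (lin (quotMk W N h) y) = lin f (tmul x y) := rfl
  obtain ⟨C, hC, hb⟩ := exists_bound f
  let b : V →ₗ[R] quot W N h →ₗ[R] P := LinearMap.mk₂ R (fun x y => lin (q x) y)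
    (fun x x' y => by
      obtain ⟨y, rfl⟩ := quotMk_surjective y
      rw [hq, hq, hq, add_tmul, map_add])
    (fun r x y => by
      obtain ⟨y, rfl⟩ := quotMk_surjective y
      rw [hq, hq, smul_tmul, map_smul])
    (fun x y y' => map_add _ _ _) (fun r x y => map_smul _ _ _)
  have hbd : ∀ x y, ‖b x y‖ ≤ C * ‖x‖ * ‖y‖ := fun x y =>
    bound_of_quotMk (h := h) (fun y => lin (q x) y) (by positivity) (fun y => by
      refine (hb (tmul x y)).trans ?_
      rw [mul_assoc]
      gcongr
      exact norm_tmul_le x y) y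
  refine ⟨lift b ⟨C, hC, hbd⟩, tensor_ext fun x y => ?_⟩
  rw [lin_comp, tensorMap_tmul, lift_tmul]
  rfl

lemma epi_tensorMap {V W W' : BanMod R} (f : W ⟶ W') (hf : Function.Surjective (lin f)) :
    Epi (tensorMap (𝟙 V) f) :=
  ⟨fun g h H => tensor_ext fun x y => by
    obtain ⟨y, rfl⟩ := hf y
    have h1 := congrArg (fun k => lin k (tmul x y)) H
    simp only [lin_comp, tensorMap_tmul, lin_id] at h1
    exact h1⟩

end

end BanMod

section

variable {C : Type w} [Category.{v} C]

lemma IndObj.HomTo.pre_injective {A B : C} {Y : IndObj C} (e : A ⟶ B) [Epi e] :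
    Function.Injective (HomTo.pre (Y := Y) e) := by
  intro x y h
  obtain ⟨j, f, rfl⟩ := x.exists_mk
  obtain ⟨k, g, rfl⟩ := y.exists_mk
  obtain ⟨m, c, d, hcd⟩ := HomTo.mk_eq_mk.1 h
  refine HomTo.mk_eq_mk.2 ⟨m, c, d, ?_⟩
  simp only [Category.assoc] at hcd
  exact (cancel_epi e).1 hcd

/-- The morphism of ind-objects given by a natural transformation of diagrams. -/
def IndObj.natHom {J : Type v} [SmallCategory J] [IsFiltered J] {D D' : J ⥤ C} (t : D ⟶ D') :
    (IndObj.mk J D) ⟶ (IndObj.mk J D') :=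
  levelHom (X := IndObj.mk J D) (Y := IndObj.mk J D') (fun i => i) (fun a => a) (fun i => t.app i)
    (fun a => t.naturality a)

lemma IndObj.bijective_natHom {J : Type v} [SmallCategory J] [IsFiltered J] {D D' : J ⥤ C}
    (t : D ⟶ D') (ht : ∀ i, Epi (t.app i)) (B : IndObj C)
    (h : ∀ (φ : IndObj.mk J D ⟶ B) (i : J), ∃ y : HomTo (D'.obj i) B,
      HomTo.pre (t.app i) y = IndObj.app φ i) :
    Function.Bijective (fun ψ : IndObj.mk J D' ⟶ B => natHom t ≫ ψ) := by
  constructor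
  · intro g h H
    refine IndObj.hom_ext fun i => HomTo.pre_injective (t.app i) ?_
    have H' : natHom t ≫ g = natHom t ≫ h := H
    exact congrArg (fun k : IndObj.mk J D ⟶ B => IndObj.app k i) H'
  · intro φ
    choose y hy using h φ
    refine ⟨homMk (X := IndObj.mk J D') y (fun {i i'} a => HomTo.pre_injective (t.app i) ?_),
      IndObj.hom_ext hy⟩
    change HomTo.pre (t.app i) (HomTo.pre (D'.map a) (y i')) = HomTo.pre (t.app i) (y i)
    rw [HomTo.pre_pre, ← t.naturality, ← HomTo.pre_pre, hy, hy]
    exact IndObj.pre_app φ a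

end

section

variable {F : Type u} [NontriviallyNormedField F] [IsUltrametricDist F] [CompleteSpace F]

/-- Morphisms that are inverted by the reflector onto essentially monomorphic ind-objects. -/
abbrev reflLocal (F : Type u) [NontriviallyNormedField F] :
    MorphismProperty (IndObj (BanMod F)) := essentiallyMonomorphic.isLocal

lemma reflLocal_of {X Y : IndObj (BanMod F)} (f : X ⟶ Y)
    (h : ∀ B : IndObj (BanMod F), IsMonomorphic B →
      Function.Bijective (fun ψ : Y ⟶ B => f ≫ ψ)) : reflLocal F f := by
  rw [reflLocal, essentiallyMonomorphic, ObjectProperty.isoClosure_isLocal]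
  exact h

lemma reflLocal_reflUnit (E : IndObj (BanMod F)) : reflLocal F (reflUnit E) :=
  reflLocal_of _ fun B hB =>
    IndObj.bijective_natHom (J := E.J) (D := E.diag) (D' := (reflObj E).diag)
      { app := reflMk E, naturality := fun _ _ a => reflMk_natural E a }
      (fun i => epi_of_surjective _ (reflMk_surjective E i)) B (fun φ i => by
        obtain ⟨j, f, hf⟩ := (IndObj.app φ i).exists_mk
        refine ⟨IndObj.HomTo.mk j (BanMod.quotLift f fun x hx => mem_reflKer.1 hx B hB φ j f hf), ?_⟩
        rw [hf]
        rfl)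

lemma tmul_reflKer {X Y B : IndObj (BanMod F)} (hB : IsMonomorphic B)
    (φ : IndObj.tensor X Y ⟶ B) {i : X.J} {j : Y.J} {k : B.J}
    (f : BanMod.tensor (X.diag.obj i) (Y.diag.obj j) ⟶ B.diag.obj k)
    (hf : IndObj.app φ (i, j) = IndObj.HomTo.mk k f) (x : X.diag.obj i)
    (y : Y.diag.obj j) (hy : y ∈ reflKer Y j) : BanMod.lin f (BanMod.tmul x y) = 0 := by
  have hnat {j' j'' : Y.J} (a : j' ⟶ j'') : Y.diag.map a ≫ BanMod.tmulLeft (Y.diag.obj j'') x =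
      BanMod.tmulLeft (Y.diag.obj j') x ≫
        BanMod.tensorMap (X.diag.map (𝟙 i)) (Y.diag.map a) := by
    refine BanMod.hom_ext fun z => ?_
    rw [BanMod.lin_comp, BanMod.lin_comp, BanMod.tmulLeft_apply, BanMod.tmulLeft_apply,
      BanMod.tensorMap_tmul, X.diag.map_id, BanMod.lin_id]
  let ψ : Y ⟶ B := IndObj.homMk (fun j' =>
    IndObj.HomTo.pre (BanMod.tmulLeft (Y.diag.obj j') x) (IndObj.app φ (i, j'))) (fun {j' j''} a => by
      refine (IndObj.HomTo.pre_pre (Y := B) _ _ _).trans ?_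
      rw [hnat a]
      refine (IndObj.HomTo.pre_pre (Y := B) _ _ _).symm.trans ?_
      exact congrArg (IndObj.HomTo.pre _) (IndObj.pre_app φ (i := (i, j')) (i' := (i, j'')) (𝟙 i, a)))
  have h1 : IndObj.app ψ j = IndObj.HomTo.mk k (BanMod.tmulLeft (Y.diag.obj j) x ≫ f) :=
    congrArg (IndObj.HomTo.pre (BanMod.tmulLeft (Y.diag.obj j) x)) hf
  exact mem_reflKer.1 hy B hB ψ k _ h1

lemma reflLocal_whiskerLeft_reflUnit (X Y : IndObj (BanMod F)) :
    reflLocal F (X ◁ reflUnit Y) :=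
  reflLocal_of _ fun B hB =>
    IndObj.bijective_natHom (J := (IndObj.tensor X Y).J) (D := (IndObj.tensor X Y).diag)
      (D' := (IndObj.tensor X (reflObj Y)).diag)
      { app := fun i => BanMod.tensorMap (𝟙 (X.diag.obj i.1)) (reflMk Y i.2)
        naturality := fun i i' a => by
          have h1 := reflMk_natural Y a.2
          have h2 : BanMod.tensorMap (X.diag.map a.1) (Y.diag.map a.2) ≫
              BanMod.tensorMap (𝟙 (X.diag.obj i'.1)) (reflMk Y i'.2) =
            BanMod.tensorMap (𝟙 (X.diag.obj i.1)) (reflMk Y i.2) ≫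
              BanMod.tensorMap (X.diag.map a.1) ((reflObj Y).diag.map a.2) := by
            rw [BanMod.tensorMap_comp, BanMod.tensorMap_comp, h1, Category.comp_id,
              Category.id_comp]
          exact h2 }
      (fun i => BanMod.epi_tensorMap _ (reflMk_surjective Y i.2)) B (fun φ i => by
        obtain ⟨k, f, hf⟩ := (IndObj.app φ i).exists_mk
        obtain ⟨g, hg⟩ := BanMod.exists_tensor_quot (h := isClosed_reflKer Y i.2) f
          (fun x y hy => tmul_reflKer hB φ (i := i.1) (j := i.2) f hf x y hy)
        refine ⟨IndObj.HomTo.mk k g, ?_⟩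
        rw [hf, ← hg]
        rfl)

lemma reflLocal_whiskerLeft (X : IndObj (BanMod F)) {Y Y' : IndObj (BanMod F)} (g : Y ⟶ Y')
    (hg : reflLocal F g) : reflLocal F (X ◁ g) := by
  obtain ⟨g', hg'⟩ := (reflLocal_reflUnit Y (reflObj Y')
    ⟨_, isMonomorphic_reflObj Y', ⟨Iso.refl _⟩⟩).2 (g ≫ reflUnit Y')
  have h1 : reflLocal F g' := by
    refine MorphismProperty.of_precomp _ (reflUnit Y) g' (reflLocal_reflUnit Y) ?_
    rw [show reflUnit Y ≫ g' = g ≫ reflUnit Y' from hg']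
    exact MorphismProperty.comp_mem _ _ _ hg (reflLocal_reflUnit Y')
  have : IsIso g' := (ObjectProperty.isLocal_iff_isIso _ g'
    ⟨_, isMonomorphic_reflObj Y, ⟨Iso.refl _⟩⟩ ⟨_, isMonomorphic_reflObj Y', ⟨Iso.refl _⟩⟩).1 h1
  refine MorphismProperty.of_postcomp _ (X ◁ g) (X ◁ reflUnit Y')
    (reflLocal_whiskerLeft_reflUnit X Y') ?_
  rw [← MonoidalCategory.whiskerLeft_comp, ← show reflUnit Y ≫ g' = g ≫ reflUnit Y' from hg',
    MonoidalCategory.whiskerLeft_comp]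
  exact MorphismProperty.comp_mem _ _ _ (reflLocal_whiskerLeft_reflUnit X Y)
    (ObjectProperty.isLocal_of_isIso _ _)

instance : (reflLocal F).IsMonoidal where
  whiskerLeft X _ _ g hg := reflLocal_whiskerLeft X g hg
  whiskerRight {X X'} f hf Y := by
    have h : f ▷ Y = (β_ X Y).hom ≫ Y ◁ f ≫ (β_ X' Y).inv := by
      rw [← BraidedCategory.braiding_naturality_left_assoc, Iso.hom_inv_id, Category.comp_id]
    rw [h]
    exact MorphismProperty.comp_mem _ _ _ (ObjectProperty.isLocal_of_isIso _ _)
      (MorphismProperty.comp_mem _ _ _ (reflLocal_whiskerLeft Y f hf)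
        (ObjectProperty.isLocal_of_isIso _ _))

end

section

variable (F : Type u) [NontriviallyNormedField F] [IsUltrametricDist F] [CompleteSpace F]

/-- The inclusion of complete bornological spaces into ind-Banach spaces. -/
abbrev diss : CBorn F ⥤ IndObj (BanMod F) := essentiallyMonomorphic.ι

/-- Morphisms from the largest monomorphic quotient of `E` to a complete bornological space are the
same as morphisms from `E`. -/
def reflEquiv (E : IndObj (BanMod F)) (B : CBorn F) :
    ((⟨reflObj E, reflObj E, isMonomorphic_reflObj E, ⟨Iso.refl _⟩⟩ : CBorn F) ⟶ B) ≃
      (E ⟶ (diss F).obj B) :=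
  (essentiallyMonomorphic.fullyFaithfulι.homEquiv).trans
    ((reflLocal_reflUnit E).homEquiv B.obj B.property)

lemma reflEquiv_apply (E : IndObj (BanMod F)) (B : CBorn F) (f) :
    reflEquiv F E B f = reflUnit E ≫ (diss F).map f := rfl

/-- The reflector from ind-Banach spaces to complete bornological spaces. -/
def reflector : IndObj (BanMod F) ⥤ CBorn F :=
  Adjunction.leftAdjointOfEquiv (G := diss F) (reflEquiv F) (fun E B B' f g => by
    rw [reflEquiv_apply, reflEquiv_apply, Functor.map_comp, Category.assoc])

/-- The reflector is left adjoint to the inclusion. -/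
def reflAdj : reflector F ⊣ diss F := Adjunction.adjunctionOfEquivLeft _ _

instance : (reflector F).IsLocalization (reflLocal F) := by
  have h : (essentiallyMonomorphic : ObjectProperty (IndObj (BanMod F))) =
      (· ∈ Set.range (diss F).obj) := by
    ext X
    exact ⟨fun hX => ⟨⟨X, hX⟩, rfl⟩, by rintro ⟨Y, rfl⟩; exact Y.property⟩
  have h2 : reflLocal F = ObjectProperty.isLocal (· ∈ Set.range (diss F).obj) :=
    congrArg ObjectProperty.isLocal h
  rw [h2]
  exact ObjectProperty.isLocalization_isLocal (reflAdj F)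

lemma isMonomorphic_const (A : BanMod F) : IsMonomorphic (IndObj.const A) := fun _ =>
  inferInstanceAs (Mono (𝟙 A))

/-- The field `F` as a complete bornological space. -/
def cbornUnit : CBorn F :=
  ⟨𝟙_ (IndObj (BanMod F)), _, isMonomorphic_const F _, ⟨Iso.refl _⟩⟩

/-- The reflector maps the unit of ind-Banach spaces to `F`. -/
def reflectorUnitIso : (reflector F).obj (𝟙_ (IndObj (BanMod F))) ≅ cbornUnit F :=
  (asIso (reflAdj F).counit).app (cbornUnit F)

/-- The symmetric monoidal category of complete bornological spaces: its tensor product is the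
reflection of the tensor product of ind-Banach spaces, so that morphisms out of `V ⊗ W` are the
bounded bilinear maps. -/
instance : MonoidalCategory (CBorn F) :=
  inferInstanceAs (MonoidalCategory
    (LocalizedMonoidal (reflector F) (reflLocal F) (reflectorUnitIso F)))

instance : SymmetricCategory (CBorn F) :=
  inferInstanceAs (SymmetricCategory
    (LocalizedMonoidal (reflector F) (reflLocal F) (reflectorUnitIso F)))

instance : (reflector F).Monoidal :=
  inferInstanceAs (Localization.Monoidal.toMonoidalCategory (reflector F) (reflLocal F)
    (reflectorUnitIso F)).Monoidal

/-- The inclusion is lax monoidal, as a right adjoint of a strongly monoidal functor; its structure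
map is the projection from the tensor product of ind-Banach spaces to its reflection. -/
instance : (diss F).LaxMonoidal := (reflAdj F).rightAdjointLaxMonoidal

/-- The functor `V ↦ V̲` from complete bornological spaces over `F` to ind-Banach modules over `F̲`,
with its canonical lax monoidal structure. -/
abbrev cbornToUnderline (π : PseudoUniformizer F) : CBorn F ⥤ IndBanUnderline F π :=
  diss F ⋙ toUnderline F π

end

end

end IndBanach

/-! The monoidal statement rests on two facts about lattices. The ring `F°` is a valuation ring, so
its torsion-free modules are flat, and the algebraic tensor product of `π⁻ⁿ V°` and `π⁻ᵐ W°` over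
`F°` embeds into `V ⊗ W`. A pure tensor may be rescaled to `a v ⊗ a⁻¹ w`, so a tensor of small norm
has a presentation by lattice vectors of comparable size. Hence `latticeMul` is bounded below
(`latticeMul_bounded_below`), and every lattice of the completed `V ⊗ W` lies in the image of a
product of lattices (`exists_latticeMul_section`). In the formal colimit this makes `underlineMul`
invertible. As `F̲` is an idempotent monoid, tensoring over `F̲` is tensoring over `F°`, and every
map between `F̲`-modules is linear.

For the reflective embedding, a Banach `F°`-module `N` generates a Banach space: the completion of
`F ⊗ N` for the largest seminorm with `‖r ⊗ x‖ ≤ ‖r‖ min(‖x‖, 1)`. A bounded map from `N` to a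
lattice has bounded image, so it extends uniquely to this space. Applied to each member of an
ind-object, this gives the left adjoint. A lattice `π⁻ⁿ V°` has the same universal property with `V`
itself as the generated space, which gives full faithfulness.

Kernels are preserved because the functor is a right adjoint. For cokernels in a strictly short
exact sequence, `p` is compared with its coimage, the formal colimit of the quotients of members of
`Y` by kernels of representatives of `p`. Lattice vectors in such a quotient lift, with norm at most
doubled, to a larger lattice upstairs. A map that kills `X̲` is represented by maps vanishing on
these kernels, and so it descends.

For complete bornological spaces, the point is that completed tensor products over `F` preserve
injective bounded maps (`BanMod.tensorMap_injective`). Then a tensor product of monomorphic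
ind-objects is monomorphic, the reflector does not change it, and the inclusion into ind-Banach
spaces is strongly monoidal. The injectivity is proved by passing to a closed subspace of countable
type in the second factor. There, almost orthogonal complements give finite-rank projections of
uniformly bounded norm, and slicing with functionals reduces the claim to the injectivity of the
given map. Strong left exactness holds because the composite is a right adjoint. -/

namespace IndBanach

noncomputable section

/-! ### Criteria for equality and invertibility of morphisms of ind-objects. -/

namespace IndObj

variable {C : Type w} [Category.{v} C]

/-- A morphism of ind-objects is an isomorphism if postcomposition with it is injective and every
member of the target lifts through it. -/
lemma isIso_of_post {X Y : IndObj C} (φ : X ⟶ Y)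
    (hinj : ∀ A : C, Function.Injective (HomTo.post (A := A) φ))
    (hlift : ∀ q : Y.J, ∃ y : HomTo (Y.diag.obj q) X, HomTo.post φ y = HomTo.mk q (𝟙 _)) :
    IsIso φ := by
  choose y hy using hlift
  -- The chosen lifts of the identities are compatible because this may be tested after composing
  -- with `φ`, which is injective on classes.
  let ψ : Y ⟶ X := homMk y fun {q q'} a => hinj _ (by
    refine (HomTo.pre_post (Y := X) (Z := Y) (Y.diag.map a) φ (y q')).symm.trans ?_
    rw [hy, hy, HomTo.pre_mk, Category.comp_id, ← Category.id_comp (Y.diag.map a), HomTo.mk_map])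
  have h : ψ ≫ φ = 𝟙 Y := hom_ext hy
  refine ⟨ψ, hom_ext fun i => hinj _ ?_, h⟩
  change app ((φ ≫ ψ) ≫ φ) i = app (𝟙 X ≫ φ) i
  rw [Category.assoc, h, Category.comp_id, Category.id_comp]

/-- A cofinal pair of members representing both classes at a common index. -/
lemma HomTo.exists_common {A : C} {Y : IndObj C} (x y : HomTo A Y) :
    ∃ (j : Y.J) (f g : A ⟶ Y.diag.obj j), x = HomTo.mk j f ∧ y = HomTo.mk j g := by
  obtain ⟨i, f, rfl⟩ := x.exists_mk
  obtain ⟨j, g, rfl⟩ := y.exists_mk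
  exact ⟨IsFiltered.max i j, f ≫ Y.diag.map (IsFiltered.leftToMax i j),
    g ≫ Y.diag.map (IsFiltered.rightToMax i j), (HomTo.mk_map _ _).symm, (HomTo.mk_map _ _).symm⟩

/-- Two different transition maps that witness the equality can be coequalized further along the
filtered diagram, so one transition map suffices. -/
lemma HomTo.mk_eq_mk_same {A : C} {Y : IndObj C} {j : Y.J} {f g : A ⟶ Y.diag.obj j} :
    HomTo.mk j f = HomTo.mk j g ↔ ∃ (k : Y.J) (a : j ⟶ k), f ≫ Y.diag.map a = g ≫ Y.diag.map a := by
  refine HomTo.mk_eq_mk.trans ⟨?_, fun ⟨k, a, h⟩ => ⟨k, a, a, h⟩⟩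
  rintro ⟨k, a, b, h⟩
  refine ⟨_, a ≫ IsFiltered.coeqHom a b, ?_⟩
  conv_rhs => rw [IsFiltered.coeq_condition a b]
  rw [Functor.map_comp, Functor.map_comp, reassoc_of% h]

end IndObj

section

variable {C : Type*} [Category* C] [Limits.HasZeroMorphisms C]
variable {D : Type*} [Category* D] [Limits.HasZeroMorphisms D]

/-- A right adjoint preserves kernels. -/
lemma isStronglyLeftExact_of_isRightAdjoint (G : C ⥤ D) [G.IsRightAdjoint] :
    IsStronglyLeftExact G := by
  rintro X Y Z i f ⟨h, ⟨hl⟩⟩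
  have h' : G.map i ≫ G.map f = 0 := by rw [← G.map_comp, h, Functor.map_zero]
  refine ⟨h', ⟨?_⟩⟩
  exact Limits.KernelFork.isLimitMapConeEquiv _ _ (Limits.isLimitOfPreserves G hl)

end

/-! ### Maps that are bounded below, and dense algebraic tensors. -/

namespace BanMod

variable {R : Type u} [NormedCommRing R]

lemma injective_of_norm_le {A B : BanMod R} (f : A ⟶ B) {C : ℝ} (h : ∀ x, ‖x‖ ≤ C * ‖lin f x‖) :
    Function.Injective (lin f) := by
  rw [injective_iff_map_eq_zero]
  intro x hx
  have := h x
  rw [hx, norm_zero, mul_zero] at this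
  exact norm_le_zero_iff.1 this

/-- The source is complete and Cauchy sequences in the image lift to it. This is used to keep limits
of algebraic tensors inside the image of `latticeMul`. -/
lemma isClosed_range_of_norm_le {A B : BanMod R} (f : A ⟶ B) {C : ℝ}
    (h : ∀ x, ‖x‖ ≤ C * ‖lin f x‖) : IsClosed (Set.range (lin f)) := by
  have h1 : AntilipschitzWith C.toNNReal (lin f) :=
    AddMonoidHomClass.antilipschitz_of_bound (lin f) fun x => (h x).trans (by
      gcongr
      exact Real.le_coe_toNNReal C)
  exact h1.isClosed_range (uniformContinuous_addMonoidHom_of_continuous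
    (f := (lin f).toAddMonoidHom) (continuous_lin f))

/-- A morphism with values in the range of a morphism that is bounded below factors through it. -/
lemma exists_factor {A B D : BanMod R} (f : A ⟶ B) {C : ℝ} (h : ∀ x, ‖x‖ ≤ C * ‖lin f x‖)
    (g : D ⟶ B) (hg : ∀ d, ∃ a, lin f a = lin g d) : ∃ k : D ⟶ A, k ≫ f = g := by
  choose k hk using hg
  have hinj := injective_of_norm_le f h
  let l : D →ₗ[R] A :=
    { toFun := k
      map_add' := fun x y => hinj (by rw [hk, map_add, map_add, hk, hk])
      map_smul' := fun r x => hinj (by rw [hk, RingHom.id_apply, map_smul, map_smul, hk]) }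
  obtain ⟨K, hK, hb⟩ := exists_bound g
  refine ⟨ofLin l ⟨|C| * K, fun x => ?_⟩, hom_ext hk⟩
  calc ‖k x‖ ≤ C * ‖lin f (k x)‖ := h _
    _ = C * ‖lin g x‖ := by rw [hk]
    _ ≤ |C| * (K * ‖x‖) := by gcongr; exacts [le_abs_self C, hb x]
    _ = _ := by ring

lemma denseRange_toTensor (M N : BanMod R) : DenseRange (toTensor M N) :=
  UniformSpace.Completion.denseRange_coe (α := PTensor M N)

lemma norm_toTensor {M N : BanMod R} (t : M ⊗[R] N) :
    ‖toTensor M N t‖ = ptNorm (M := M) (N := N) t :=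
  UniformSpace.Completion.norm_coe (E := PTensor M N) t

/-- Elements of the completed tensor product are limits of algebraic tensors of bounded norm. -/
lemma mem_closure_ptBall {M N : BanMod R} {c : ℝ} {t : tensor M N} (ht : ‖t‖ < c) :
    t ∈ closure (toTensor M N '' (ptBall M N c : Set (PTensor M N))) := by
  refine Metric.mem_closure_iff.2 fun e he => ?_
  -- An approximation closer than `c - ‖t‖` still has norm less than `c`.
  obtain ⟨s, hs⟩ := (denseRange_toTensor M N).exists_dist_lt t (lt_min he (sub_pos.2 ht))
  refine ⟨_, ⟨s, mem_ptBall_of_lt ((norm_toTensor s).symm.trans_lt ?_), rfl⟩,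
    hs.trans_le (min_le_left _ _)⟩
  have h2 : ‖t - toTensor M N s‖ < c - ‖t‖ :=
    (dist_eq_norm t (toTensor M N s)).symm.trans_lt (hs.trans_le (min_le_right _ _))
  calc ‖toTensor M N s‖ = ‖t - (t - toTensor M N s)‖ := by rw [sub_sub_cancel]
    _ ≤ ‖t‖ + ‖t - toTensor M N s‖ := norm_sub_le _ _
    _ < c := by linarith

end BanMod

/-! ### Tensor products of lattices: flatness, rescaling and invertibility of the multiplication. -/

section

variable {F : Type u} [NontriviallyNormedField F] [IsUltrametricDist F]

/-- Of two elements, the one of smaller norm is a multiple of the other. This is the source of all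
flatness below. -/
instance : ValuationRing (unitBall F) where
  toPreValuationRing := ⟨fun a b => by
    wlog h : ‖(b : F)‖ ≤ ‖(a : F)‖ generalizing a b
    · obtain ⟨c, hc⟩ := this b a (le_of_not_ge h)
      exact ⟨c, hc.symm⟩
    by_cases ha : (a : F) = 0
    · have hb : (b : F) = 0 := by simpa [ha] using h
      exact ⟨0, Or.inl (Subtype.ext (by simp [hb]))⟩
    · refine ⟨⟨b / a, ?_⟩, Or.inl (Subtype.ext (mul_div_cancel₀ (b : F) ha))⟩
      change ‖(b / a : F)‖ ≤ 1
      rw [norm_div]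
      exact div_le_one_of_le₀ h (norm_nonneg _)⟩

variable {π : PseudoUniformizer F}

instance {V : Type*} [AddCommGroup V] [Module F V] : Module.IsTorsionFree (unitBall F) V :=
  ⟨fun r hr => by
    intro x y h
    have h0 : (r : F) ≠ 0 := fun h => hr.ne_zero (Subtype.ext h)
    exact smul_right_injective V h0 h⟩

/-- A valuation ring is a Bézout domain, and over such a ring flat means torsion-free; lattices sit
inside vector spaces. -/
instance (V : BanMod F) (n : ℕ) : Module.Flat (unitBall F) (lattice π V n) := by
  rw [Module.Flat.flat_iff_torsion_eq_bot_of_isBezout, ← Submodule.isTorsionFree_iff_torsion_eq_bot]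
  infer_instance

instance {V : Type*} [AddCommGroup V] [Module F V] : Module.Flat (unitBall F) V := by
  rw [Module.Flat.flat_iff_torsion_eq_bot_of_isBezout, ← Submodule.isTorsionFree_iff_torsion_eq_bot]
  infer_instance

/-- Each scalar or its inverse is integral, so a tensor balanced over `F°` is balanced over `F`.
Tensor products of vector spaces over the two rings therefore agree. -/
instance {V W : Type*} [AddCommGroup V] [Module F V] [AddCommGroup W] [Module F W] :
    CompatibleSMul (unitBall F) F V W :=
  ⟨fun r v w => by
    by_cases h : ‖r‖ ≤ 1
    · exact TensorProduct.smul_tmul (R := unitBall F) (⟨r, h⟩ : unitBall F) v w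
    · have hr : r ≠ 0 := fun h0 => h (by simp [h0])
      let s : unitBall F := ⟨r⁻¹, by
        change ‖r⁻¹‖ ≤ 1
        rw [norm_inv]
        exact inv_le_one_of_one_le₀ (le_of_not_ge h)⟩
      have h1 : s • r • v = v := inv_smul_smul₀ hr v
      have h2 : s • r • w = w := inv_smul_smul₀ hr w
      conv_lhs => rw [← h2]
      conv_rhs => rw [← h1]
      exact (TensorProduct.smul_tmul s (r • v) (r • w)).symm⟩

variable (π) in
/-- The map `π⁻ⁿ V° ⊗ π⁻ᵐ W° → V ⊗ W` of algebraic tensor products. -/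
def latticeTensor (V W : BanMod F) (n m : ℕ) :
    latticeObj π V n ⊗[unitBall F] latticeObj π W m →+ V ⊗[F] W :=
  ((TensorProduct.equivOfCompatibleSMul F (unitBall F) (unitBall F) V W).toLinearMap ∘ₗ
    TensorProduct.map (lattice π V n).subtype (lattice π W m).subtype).toAddMonoidHom

/-- The factors are enlarged one at a time: the first uses flatness of the lattice in `W`, the
second uses flatness of `V`. -/
lemma latticeTensor_injective (V W : BanMod F) (n m : ℕ) :
    Function.Injective (latticeTensor π V W n m) := by
  have h : Function.Injective
      (TensorProduct.map (lattice π V n).subtype (lattice π W m).subtype) := by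
    rw [← LinearMap.lTensor_comp_rTensor]
    exact (Module.Flat.lTensor_preserves_injective_linearMap _ Subtype.val_injective).comp
      (Module.Flat.rTensor_preserves_injective_linearMap _ Subtype.val_injective)
  exact (TensorProduct.equivOfCompatibleSMul F (unitBall F) (unitBall F) V W).injective.comp h

lemma coe_latticeMul_toTensor [CompleteSpace F] {V W : BanMod F} {n m : ℕ}
    (t : latticeObj π V n ⊗[unitBall F] latticeObj π W m) :
    coe (BanMod.lin (latticeMul V W n m) (BanMod.toTensor _ _ t)) =
      BanMod.toTensor V W (latticeTensor π V W n m t) := by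
  induction t with
  | zero => simp only [map_zero, coe_zero]
  | tmul v w => exact coe_latticeMul v w
  | add x y hx hy => simp only [map_add, coe_add, hx, hy]

variable (π) in
/-- The inclusion of `π⁻ⁿ V°` into `π⁻ᵐ V°`. -/
def latticeIncl (V : BanMod F) {n m : ℕ} (h : n ≤ m) : latticeObj π V n ⟶ latticeObj π V m :=
  latticeMap (𝟙 V) fun _ hv => lattice_mono π V h hv

lemma coe_latticeIncl {V : BanMod F} {n m : ℕ} (h : n ≤ m) (v : latticeObj π V n) :
    coe (BanMod.lin (latticeIncl π V h) v) = coe v := rfl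

/-- Lattices are neighbourhoods of zero. The radius absorbs the constant of scalar multiplication;
the added `1` keeps the denominator positive. -/
lemma exists_ball_lattice (V : BanMod F) (n : ℕ) :
    ∃ ε : ℝ, 0 < ε ∧ ∀ v : V, ‖v‖ ≤ ε → v ∈ lattice π V n := by
  obtain ⟨C, hC, h⟩ := V.exists_smul_bound
  refine ⟨(C + 1)⁻¹, by positivity, fun v hv r hr => ?_⟩
  calc ‖(r * π.val ^ n) • v‖ ≤ C * ‖r * π.val ^ n‖ * ‖v‖ := h _ _
    _ ≤ C * 1 * (C + 1)⁻¹ := by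
        rw [norm_mul, norm_pow]
        gcongr
        exact mul_le_one₀ hr (by positivity) (pow_le_one₀ (norm_nonneg _) π.norm_lt_one.le)
    _ ≤ 1 := by
        rw [mul_one, ← div_eq_mul_inv]
        exact div_le_one_of_le₀ (by linarith) (by positivity)

/-- A pure tensor `v ⊗ w` of small norm equals `a v ⊗ a⁻¹ w` with both `a v` and `a⁻¹ w` small. -/
lemma exists_rescale (π : PseudoUniformizer F) (V W : BanMod F) :
    ∃ C : ℝ, 0 < C ∧ ∀ (ε δ : ℝ), 0 < ε → 0 < δ → ∀ (v : V) (w : W), C * (‖v‖ * ‖w‖) ≤ ε * δ →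
      ∃ (v' : V) (w' : W), v' ⊗ₜ[F] w' = v ⊗ₜ[F] w ∧ ‖v'‖ ≤ ε ∧ ‖w'‖ ≤ δ ∧
        ‖v'‖ * ‖w'‖ ≤ C * (‖v‖ * ‖w‖) := by
  obtain ⟨A, hA, hV⟩ := V.exists_smul_bound
  obtain ⟨B, hB, hW⟩ := W.exists_smul_bound
  have hp : 0 < ‖π.val‖ := norm_pos_iff.2 π.ne_zero
  -- The factors `A + 1` and `B + 1` account for scalar multiplication on `V` and `W`. The factor
  -- `‖π‖⁻¹` is the loss from scaling only by powers of `π`.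
  refine ⟨(A + 1) * (B + 1) * ‖π.val‖⁻¹, by positivity, fun ε δ hε hδ v w h => ?_⟩
  by_cases hv : v = 0
  · exact ⟨0, 0, by simp [hv], by simpa using hε.le, by simpa using hδ.le,
      by simp only [norm_zero, zero_mul]; positivity⟩
  have hv0 : 0 < ‖v‖ := norm_pos_iff.2 hv
  -- The scalar is `π ^ (k + 1)`. The upper end of the interval makes the scaled `v` at most `ε`;
  -- the lower end bounds the inverse scalar, hence the scaled `w`.
  obtain ⟨k, hk1, hk2⟩ := exists_mem_Ico_zpow (x := ε⁻¹ * ((A + 1) * ‖v‖)) (y := ‖π.val‖⁻¹)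
    (by positivity) ((one_lt_inv₀ hp).2 π.norm_lt_one)
  have ha : π.val ^ (k + 1) ≠ 0 := zpow_ne_zero _ π.ne_zero
  have e1 : ‖π.val ^ (k + 1) • v‖ ≤ (A + 1) * ‖π.val‖ ^ (k + 1) * ‖v‖ := by
    refine (hV _ _).trans ?_
    rw [norm_zpow]
    gcongr
    linarith
  have e2 : ‖(π.val ^ (k + 1))⁻¹ • w‖ ≤ (B + 1) * (‖π.val‖ ^ (k + 1))⁻¹ * ‖w‖ := by
    refine (hW _ _).trans ?_
    rw [norm_inv, norm_zpow]
    gcongr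
    linarith
  have hq : 0 < ‖π.val‖ ^ (k + 1) := by positivity
  have hk3 : (A + 1) * ‖v‖ * ‖π.val‖ ^ (k + 1) ≤ ε := by
    have h3 : ε⁻¹ * ((A + 1) * ‖v‖) ≤ (‖π.val‖ ^ (k + 1))⁻¹ := by
      rw [← inv_zpow]
      exact hk2.le
    rw [inv_mul_le_iff₀ hε, ← div_eq_mul_inv, le_div_iff₀ hq] at h3
    exact h3
  have hk4 : (‖π.val‖ ^ (k + 1))⁻¹ ≤ ‖π.val‖⁻¹ * (ε⁻¹ * ((A + 1) * ‖v‖)) := by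
    rw [← inv_zpow, zpow_add_one₀ (by positivity), mul_comm]
    gcongr
  refine ⟨π.val ^ (k + 1) • v, (π.val ^ (k + 1))⁻¹ • w, ?_, e1.trans (by linarith), e2.trans ?_, ?_⟩
  · rw [TensorProduct.smul_tmul, smul_inv_smul₀ ha]
  · calc (B + 1) * (‖π.val‖ ^ (k + 1))⁻¹ * ‖w‖
        ≤ (B + 1) * (‖π.val‖⁻¹ * (ε⁻¹ * ((A + 1) * ‖v‖))) * ‖w‖ := by gcongr
      _ = ε⁻¹ * ((A + 1) * (B + 1) * ‖π.val‖⁻¹ * (‖v‖ * ‖w‖)) := by ring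
      _ ≤ ε⁻¹ * (ε * δ) := by gcongr
      _ = δ := by rw [inv_mul_cancel_left₀ hε.ne']
  · calc _ ≤ ((A + 1) * ‖π.val‖ ^ (k + 1) * ‖v‖) * ((B + 1) * (‖π.val‖ ^ (k + 1))⁻¹ * ‖w‖) := by
          gcongr
      _ = (A + 1) * (B + 1) * (‖v‖ * ‖w‖) * (‖π.val‖ ^ (k + 1) * (‖π.val‖ ^ (k + 1))⁻¹) := by ring
      _ = (A + 1) * (B + 1) * 1 * (‖v‖ * ‖w‖) := by rw [mul_inv_cancel₀ hq.ne']; ring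
      _ ≤ _ := by
          gcongr
          exact (one_lt_inv₀ hp).2 π.norm_lt_one |>.le

/-- A tensor of small norm is the image of a tensor of comparable norm over the ring of integers. -/
lemma exists_latticeTensor_eq (V W : BanMod F) :
    ∃ C : ℝ, 0 < C ∧ ∀ (n m : ℕ) (ε δ : ℝ), 0 < ε → 0 < δ →
      (∀ v : V, ‖v‖ ≤ ε → v ∈ lattice π V n) → (∀ w : W, ‖w‖ ≤ δ → w ∈ lattice π W m) →
      ∀ c : ℝ, C * c ≤ ε * δ → ∀ t ∈ BanMod.ptBall V W c,
        ∃ s ∈ BanMod.ptBall (latticeObj π V n) (latticeObj π W m) (C * c),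
          latticeTensor π V W n m s = t := by
  obtain ⟨C, hC, h⟩ := exists_rescale π V W
  refine ⟨C, hC, fun n m ε δ hε hδ hn hm c hc t ht => ?_⟩
  have hle : BanMod.ptBall V W c ≤
      (BanMod.ptBall (latticeObj π V n) (latticeObj π W m) (C * c)).map
        (latticeTensor π V W n m) := by
    refine (AddSubgroup.closure_le _).2 ?_
    rintro _ ⟨v, w, hvw, rfl⟩
    have hcc : C * (‖v‖ * ‖w‖) ≤ C * c := by gcongr
    obtain ⟨v', w', he, hv', hw', hle⟩ := h ε δ hε hδ v w (hcc.trans hc)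
    exact ⟨(⟨v', hn v' hv'⟩ : latticeObj π V n) ⊗ₜ (⟨w', hm w' hw'⟩ : latticeObj π W m),
      AddSubgroup.subset_closure ⟨_, _, hle.trans hcc, rfl⟩, he⟩
  exact hle ht

variable [CompleteSpace F]

/-- An algebraic lattice tensor whose image has small norm gets, by rescaling, a lattice preimage of
comparable norm, and `latticeTensor_injective` says that this preimage is the given tensor. If the
image is not small, there is nothing to do, since all lattice tensors are uniformly bounded. -/
lemma latticeMul_bounded_below (V W : BanMod F) (n m : ℕ) :
    ∃ C : ℝ, ∀ x, ‖x‖ ≤ C * ‖BanMod.lin (latticeMul (π := π) V W n m) x‖ := by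
  obtain ⟨ε, hε, hn⟩ := exists_ball_lattice (π := π) V n
  obtain ⟨δ, hδ, hm⟩ := exists_ball_lattice (π := π) W m
  obtain ⟨C, hC, h⟩ := exists_latticeTensor_eq (π := π) V W
  obtain ⟨a, ha⟩ := bounded_lattice π V n
  obtain ⟨b, hb⟩ := bounded_lattice π W m
  have ha0 : 0 ≤ a := (norm_nonneg _).trans (ha 0 (zero_mem _))
  have hall (s : BanMod.PTensor (latticeObj π V n) (latticeObj π W m)) : ‖s‖ ≤ a * b := by
    have hb0 : 0 ≤ b := (norm_nonneg _).trans (hb 0 (zero_mem _))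
    refine BanMod.ptNorm_le (by positivity) ?_
    refine TensorProduct.induction_on (motive := fun s => s ∈ BanMod.ptBall _ _ (a * b)) s
      (zero_mem _) (fun v w => AddSubgroup.subset_closure ⟨v, w, ?_, rfl⟩)
      (fun x y hx hy => add_mem hx hy)
    exact mul_le_mul (ha _ (coe_mem v)) (hb _ (coe_mem w)) (norm_nonneg _) ha0
  have hb0 : 0 ≤ b := (norm_nonneg _).trans (hb 0 (zero_mem _))
  -- The first entry serves images of small norm, the second those of norm at least about `C⁻¹ ε δ`,
  -- where `a * b` bounds the source.
  let K := max C (a * b / (C⁻¹ * (ε * δ)))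
  have hK : 0 < K := lt_max_of_lt_left hC
  refine ⟨K, fun x => ?_⟩
  -- Both sides are continuous, so algebraic tensors suffice.
  refine UniformSpace.Completion.induction_on
    (α := BanMod.PTensor (latticeObj π V n) (latticeObj π W m)) x
    (isClosed_le continuous_norm
      (continuous_const.mul (BanMod.continuous_lin (latticeMul V W n m)).norm)) fun s => ?_
  have h1 : ‖BanMod.lin (latticeMul V W n m) (BanMod.toTensor _ _ s)‖ =
      ‖(show BanMod.PTensor V W from latticeTensor π V W n m s)‖ :=
    (congrArg norm (coe_latticeMul_toTensor s)).trans
      (UniformSpace.Completion.norm_coe (E := BanMod.PTensor V W) _)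
  have h2 : ‖BanMod.toTensor (latticeObj π V n) (latticeObj π W m) s‖ = ‖s‖ :=
    UniformSpace.Completion.norm_coe (E := BanMod.PTensor _ _) s
  refine h2.trans_le (le_of_le_of_eq ?_ (congrArg (K * ·) h1).symm)
  refine le_of_forall_gt_imp_ge_of_dense fun d hd => ?_
  have hd' : ‖(show BanMod.PTensor V W from latticeTensor π V W n m s)‖ < d / K := by
    rwa [lt_div_iff₀' hK]
  have hdK : 0 < d / K := (norm_nonneg _).trans_lt hd'
  have hd0 : 0 < d := by simpa [div_pos_iff_of_pos_right hK] using hdK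
  by_cases hc : C * (d / K) ≤ ε * δ
  · obtain ⟨s', hs', he⟩ := h n m ε δ hε hδ hn hm _ hc _ (BanMod.mem_ptBall_of_lt hd')
    obtain rfl := latticeTensor_injective V W n m he
    refine (BanMod.ptNorm_le (by positivity) hs').trans ?_
    rw [mul_div_assoc', div_le_iff₀ hK, mul_comm d]
    gcongr
    exact le_max_left _ _
  · refine (hall s).trans ?_
    have h3 : C⁻¹ * (ε * δ) ≤ d / K := by
      rw [inv_mul_le_iff₀ hC]
      exact (lt_of_not_ge hc).le
    have h4 : a * b ≤ K * (C⁻¹ * (ε * δ)) := by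
      rw [← div_le_iff₀ (by positivity)]
      exact le_max_right _ _
    calc a * b ≤ K * (C⁻¹ * (ε * δ)) := h4
      _ ≤ K * (d / K) := by gcongr
      _ = d := mul_div_cancel₀ _ hK.ne'

lemma coe_latticeMul_injective (V W : BanMod F) (n m : ℕ) :
    Function.Injective fun x => coe (BanMod.lin (latticeMul (π := π) V W n m) x) := by
  obtain ⟨C, hC⟩ := latticeMul_bounded_below (π := π) V W n m
  exact coe_injective.comp (BanMod.injective_of_norm_le _ hC)

/-- Each `π⁻ᵏ (V ⊗ W)°` maps to some `π⁻ⁿ V° ⊗ π⁻ᵐ W°`, inversely to the multiplication. -/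
lemma exists_latticeMul_section (V W : BanMod F) (k : ℕ) :
    ∃ (n m : ℕ) (g : latticeObj π (BanMod.tensor V W) k ⟶
      BanMod.tensor (latticeObj π V n) (latticeObj π W m)),
      ∀ t, coe (BanMod.lin (latticeMul V W n m) (BanMod.lin g t)) = coe t := by
  obtain ⟨C, hC, h⟩ := exists_latticeTensor_eq (π := π) V W
  obtain ⟨c, hc⟩ := bounded_lattice π (BanMod.tensor V W) k
  have hc0 : 0 ≤ c := (norm_nonneg _).trans (hc 0 (zero_mem _))
  -- Elements of the `k`-th lattice are limits of tensors in the ball of radius `c + 1`. Rescaling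
  -- them to radii `C * (c + 1)` in `V` and `1` in `W` meets the condition on `ε * δ` with equality.
  obtain ⟨n₀, hn₀⟩ := exists_mem_lattice π V (C * (c + 1))
  obtain ⟨m, hm⟩ := exists_mem_lattice π W 1
  -- Taking `n ≥ k` puts the `k`-th lattice inside the target of `latticeMul`, so the factorization
  -- can take place there.
  let n := max n₀ k
  have hkn : k ≤ n + m := (le_max_right n₀ k).trans (Nat.le_add_right _ _)
  obtain ⟨K, hK⟩ := latticeMul_bounded_below (π := π) V W n m
  have hcl : IsClosed (Set.range (BanMod.lin (latticeMul (π := π) V W n m))) :=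
    BanMod.isClosed_range_of_norm_le _ hK
  have hcl' : IsClosed (coe '' Set.range (BanMod.lin (latticeMul (π := π) V W n m))) :=
    (isClosed_lattice π (BanMod.tensor V W) (n + m)).isClosedMap_subtype_val _ hcl
  -- The approximating algebraic tensors lie in the image, which is closed because `latticeMul` is
  -- bounded below and lattices are closed.
  have key (t : BanMod.tensor V W) (ht : ‖t‖ ≤ c) :
      t ∈ coe '' Set.range (BanMod.lin (latticeMul (π := π) V W n m)) := by
    rw [← hcl'.closure_eq]
    refine closure_mono ?_ (BanMod.mem_closure_ptBall (ht.trans_lt (lt_add_one c)))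
    rintro _ ⟨s, hs, rfl⟩
    obtain ⟨s', -, rfl⟩ := h n m (C * (c + 1)) 1 (by positivity) one_pos
      (fun v hv => lattice_mono π V (le_max_left n₀ k) (hn₀ v hv)) hm (c + 1) (by rw [mul_one]) s hs
    exact ⟨_, ⟨BanMod.toTensor _ _ s', rfl⟩, coe_latticeMul_toTensor s'⟩
  obtain ⟨g, hg⟩ := BanMod.exists_factor (latticeMul (π := π) V W n m) hK
    (latticeIncl π (BanMod.tensor V W) hkn) (fun d => by
      obtain ⟨_, ⟨a, rfl⟩, ha⟩ := key (coe d) (hc _ (coe_mem d))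
      exact ⟨a, coe_injective (ha.trans (coe_latticeIncl hkn d).symm)⟩)
  refine ⟨n, m, g, fun t => Eq.trans ?_ (coe_latticeIncl hkn t)⟩
  rw [← hg, BanMod.lin_comp]

lemma coe_latticeMul_tensorMap {V W V' W' : BanMod F} {n m n' m' : ℕ} (f : V ⟶ V')
    (hf : ∀ v ∈ lattice π V n, BanMod.lin f v ∈ lattice π V' n') (g : W ⟶ W')
    (hg : ∀ v ∈ lattice π W m, BanMod.lin g v ∈ lattice π W' m') (x) :
    coe (BanMod.lin (latticeMul V' W' n' m')
      (BanMod.lin (BanMod.tensorMap (latticeMap f hf) (latticeMap g hg)) x)) =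
    BanMod.lin (BanMod.tensorMap f g) (coe (BanMod.lin (latticeMul V W n m) x)) := by
  obtain ⟨l, hl⟩ := exists_map_lattice π (BanMod.tensorMap f g) (n + m)
  exact latticeMul_natural f hf g hg hl x

/-- Products that agree in the colimit agree in some `X_{i'} ⊗ Y_{j'}`. Lattice multiplication is
injective there, so the factors already agree in a tensor product of lattices of `X_{i'}` and
`Y_{j'}`. -/
lemma post_underlineMul_injective (X Y : IndObj (BanMod F)) (A : BanMod (unitBall F)) :
    Function.Injective (IndObj.HomTo.post (A := A) (underlineMul π X Y)) := by
  intro x y h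
  obtain ⟨⟨⟨i, n⟩, ⟨j, m⟩⟩, f, g, rfl, rfl⟩ := IndObj.HomTo.exists_common x y
  have h' : IndObj.HomTo.mk (Y := underline π (IndObj.tensor X Y)) ⟨(i, j), n + m⟩
      (f ≫ latticeMul (X.diag.obj i) (Y.diag.obj j) n m) =
    IndObj.HomTo.mk (Y := underline π (IndObj.tensor X Y)) ⟨(i, j), n + m⟩
      (g ≫ latticeMul (X.diag.obj i) (Y.diag.obj j) n m) := h
  obtain ⟨⟨⟨i', j'⟩, l⟩, ⟨⟨a, b⟩, hab⟩, hu⟩ := IndObj.HomTo.mk_eq_mk_same.1 h'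
  obtain ⟨n', hn⟩ := exists_map_lattice π (X.diag.map a) n
  obtain ⟨m', hm⟩ := exists_map_lattice π (Y.diag.map b) m
  refine IndObj.HomTo.mk_eq_mk_same.2 ⟨(⟨i', n'⟩, ⟨j', m'⟩), (⟨a, hn⟩, ⟨b, hm⟩), ?_⟩
  refine BanMod.hom_ext fun z => coe_latticeMul_injective _ _ n' m' ?_
  refine (coe_latticeMul_tensorMap (X.diag.map a) hn (Y.diag.map b) hm (BanMod.lin f z)).trans
    (Eq.trans ?_ (coe_latticeMul_tensorMap (X.diag.map a) hn (Y.diag.map b) hm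
      (BanMod.lin g z)).symm)
  exact congrArg (fun k => coe (BanMod.lin k z)) hu

/-- The lifts required by `IndObj.isIso_of_post` are the sections from `exists_latticeMul_section`.
They change the lattice index, so the inverse exists only in the formal colimit. -/
instance (X Y : IndObj (BanMod F)) : IsIso (underlineMul π X Y) :=
  IndObj.isIso_of_post _ (post_underlineMul_injective X Y) fun ⟨⟨i, j⟩, k⟩ => by
    obtain ⟨n, m, g, hg⟩ := exists_latticeMul_section (π := π) (X.diag.obj i) (Y.diag.obj j) k
    refine ⟨IndObj.HomTo.mk (Y := IndObj.tensor (underline π X) (underline π Y))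
      (⟨i, n⟩, ⟨j, m⟩) g, ?_⟩
    exact homTo_underline_eq_same (X := IndObj.tensor X Y) (i := (i, j))
      (g ≫ latticeMul (X.diag.obj i) (Y.diag.obj j) n m) (𝟙 _) hg

end

/-! ### Passage from `F°`-linear to `F̲`-linear structure maps. -/

section

variable {C : Type w} [Category.{v} C] [MonoidalCategory C] [SymmetricCategory C]
variable {A : C} [MonObj A] [RelTensor.IsIdempotent A]

variable {V : Type w} [Category.{v} V] [MonoidalCategory V] [SymmetricCategory V]
variable (G : V ⥤ C) [G.LaxBraided] [RelTensor.IsIdempotent (LaxToMod.base G)]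

/-- The underlying map is the identity of `base G`. -/
instance LaxToMod.isIso_ε : IsIso (Functor.LaxMonoidal.ε (LaxToMod.toMod G)) :=
  (RelTensor.mkIso (M := Mod.regular (LaxToMod.base G)) (N := LaxToMod.toModObj G (𝟙_ V))
    (Iso.refl (LaxToMod.base G))).isIso_hom

/-- Over an idempotent monoid the projection `pr` to the relative tensor product is invertible, so
the relative and absolute structure maps differ by an isomorphism. -/
lemma LaxToMod.isIso_μ (X Y : V) [IsIso (Functor.LaxMonoidal.μ G X Y)] :
    IsIso (Functor.LaxMonoidal.μ (LaxToMod.toMod G) X Y) :=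
  let e : (RelTensor.tensor (LaxToMod.toModObj G X) (LaxToMod.toModObj G Y)).X ≅ G.obj (X ⊗ Y) :=
    (asIso (LaxToMod.pr G X Y)).symm ≪≫ asIso (Functor.LaxMonoidal.μ G X Y)
  (RelTensor.mkIso (M := RelTensor.tensor (LaxToMod.toModObj G X) (LaxToMod.toModObj G Y))
    (N := LaxToMod.toModObj G (X ⊗ Y)) e).isIso_hom

end

section

variable {F : Type u} [NontriviallyNormedField F] [IsUltrametricDist F] [CompleteSpace F]
variable (π : PseudoUniformizer F)

instance isIso_μ_toUnderline (X Y : IndObj (BanMod F)) :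
    IsIso (Functor.LaxMonoidal.μ (toUnderline F π) X Y) := by
  have : IsIso (Functor.LaxMonoidal.μ (underlineFunctor π) X Y) :=
    inferInstanceAs (IsIso (underlineMul π X Y))
  exact LaxToMod.isIso_μ (underlineFunctor π) X Y

end

/-! ### The Banach space generated by a Banach module over `F°`. -/

namespace BanMod

variable {R : Type u} [NormedCommRing R]

/-- The completion of a seminormed ultrametric module as a Banach module. -/
def compl (E : Type u) [SeminormedAddCommGroup E] [IsUltrametricDist E] [Module R E]
    [UniformContinuousConstSMul R E]
    (h : ∃ C : ℝ, 0 ≤ C ∧ ∀ (r : R) (t : E), ‖r • t‖ ≤ C * ‖r‖ * ‖t‖) : BanMod R where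
  carrier := UniformSpace.Completion E
  ultra := ultra_completion _
  smul_bound := smul_completion _ h

section

variable {E : Type u} [SeminormedAddCommGroup E] [IsUltrametricDist E] [Module R E]
  [UniformContinuousConstSMul R E]
  {h : ∃ C : ℝ, 0 ≤ C ∧ ∀ (r : R) (t : E), ‖r • t‖ ≤ C * ‖r‖ * ‖t‖}

/-- The canonical map to the completion. -/
def toCompl (h : ∃ C : ℝ, 0 ≤ C ∧ ∀ (r : R) (t : E), ‖r • t‖ ≤ C * ‖r‖ * ‖t‖) :
    E →ₗ[R] compl E h where
  toFun := UniformSpace.Completion.coe'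
  map_add' := UniformSpace.Completion.coe_add
  map_smul' := UniformSpace.Completion.coe_smul

lemma norm_toCompl (t : E) : ‖toCompl h t‖ = ‖t‖ := UniformSpace.Completion.norm_coe t

lemma denseRange_toCompl : DenseRange (toCompl h) := UniformSpace.Completion.denseRange_coe

lemma compl_ext {V : BanMod R} {f g : compl E h ⟶ V}
    (H : ∀ t, lin f (toCompl h t) = lin g (toCompl h t)) : f = g :=
  hom_ext fun x => congrFun (denseRange_toCompl.equalizer (continuous_lin f) (continuous_lin g)
    (funext H)) x

/-- The extension by continuity inherits linearity and the bound from the dense image of `E`. -/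
lemma exists_complLift {V : BanMod R} (f : E →ₗ[R] V) (hf : ∃ C : ℝ, ∀ t, ‖f t‖ ≤ C * ‖t‖) :
    ∃ g : compl E h ⟶ V, ∀ t, lin g (toCompl h t) = f t := by
  have hc : Continuous f.toAddMonoidHom := continuous_of_bound _ hf
  let e : compl E h →+ V := AddMonoidHom.extension f.toAddMonoidHom hc
  have he (t : E) : e (toCompl h t) = f t := AddMonoidHom.extension_coe f.toAddMonoidHom hc t
  have hcont : Continuous e := AddMonoidHom.continuous_extension f.toAddMonoidHom hc
  have hsmul (r : R) (x : compl E h) : e (r • x) = r • e x := by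
    refine denseRange_toCompl.induction_on (p := fun x => e (r • x) = r • e x) x
      (isClosed_eq (hcont.comp (continuous_const_smul r)) (hcont.const_smul r)) fun t => ?_
    rw [← map_smul, he, he, map_smul]
  obtain ⟨C, hC⟩ := hf
  refine ⟨ofLin { e with map_smul' := hsmul } ⟨C, fun x => ?_⟩, he⟩
  have hcl : IsClosed {x : compl E h | ‖e x‖ ≤ C * ‖x‖} :=
    isClosed_le hcont.norm (continuous_const.mul continuous_norm)
  refine denseRange_toCompl.induction_on (p := fun x => ‖e x‖ ≤ C * ‖x‖) x hcl fun t => ?_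
  rw [he, norm_toCompl]
  exact hC t

end

end BanMod

section

variable {F : Type u} [NontriviallyNormedField F] [IsUltrametricDist F]

/-- The `F`-vector space generated by a module over the ring of integers. -/
def Generic (N : BanMod (unitBall F)) : Type u := F ⊗[unitBall F] N

namespace Generic

variable {N : BanMod (unitBall F)}

instance : AddCommGroup (Generic N) := inferInstanceAs (AddCommGroup (F ⊗[unitBall F] N))
instance : Module F (Generic N) := inferInstanceAs (Module F (F ⊗[unitBall F] N))

/-- The element `r ⊗ x`. -/
def mk (r : F) (x : N) : Generic N := r ⊗ₜ[unitBall F] x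

lemma smul_mk (s r : F) (x : N) : s • mk r x = mk (s * r) x := rfl

lemma mk_add (r : F) (x y : N) : mk r (x + y) = mk r x + mk r y := TensorProduct.tmul_add r x y

lemma mk_smul (r : unitBall F) (x : N) : mk (1 : F) (r • x) = (r : F) • mk (1 : F) x := by
  rw [smul_mk]
  exact (TensorProduct.smul_tmul r (1 : F) x).symm

lemma induction {p : Generic N → Prop} (t : Generic N) (h0 : p 0) (hmk : ∀ r x, p (mk r x))
    (hadd : ∀ s t, p s → p t → p (s + t)) : p t :=
  TensorProduct.induction_on (motive := p) t h0 hmk hadd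

variable (N) in
/-- The subgroup of those `∑ rᵢ ⊗ xᵢ` with `‖rᵢ‖ min(‖xᵢ‖, 1) ≤ c` for all `i`. -/
def ball (c : ℝ) : AddSubgroup (Generic N) :=
  AddSubgroup.closure {t | ∃ (r : F) (x : N), ‖r‖ * min ‖x‖ 1 ≤ c ∧ t = mk r x}

lemma ball_mono {c d : ℝ} (h : c ≤ d) : ball N c ≤ ball N d :=
  AddSubgroup.closure_mono (by
    rintro _ ⟨r, x, hrx, rfl⟩
    exact ⟨r, x, hrx.trans h, rfl⟩)

lemma exists_mem_ball (t : Generic N) : ∃ c : ℝ, 0 ≤ c ∧ t ∈ ball N c := by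
  refine induction (p := fun t => ∃ c : ℝ, 0 ≤ c ∧ t ∈ ball N c) t ⟨0, le_rfl, zero_mem _⟩ (fun r x => ?_) ?_
  · exact ⟨‖r‖ * min ‖x‖ 1, by positivity, AddSubgroup.subset_closure ⟨r, x, le_rfl, rfl⟩⟩
  · rintro x y ⟨c, hc, hx⟩ ⟨d, hd, hy⟩
    exact ⟨max c d, le_max_of_le_left hc, add_mem (ball_mono (le_max_left _ _) hx)
      (ball_mono (le_max_right _ _) hy)⟩

/-- The largest seminorm with `‖r ⊗ x‖ ≤ ‖r‖ min(‖x‖, 1)`. -/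
def gnorm (t : Generic N) : ℝ := sInf {c : ℝ | 0 ≤ c ∧ t ∈ ball N c}

lemma gnorm_nonneg (t : Generic N) : 0 ≤ gnorm t := Real.sInf_nonneg fun _ h => h.1

lemma gnorm_le {t : Generic N} {c : ℝ} (hc : 0 ≤ c) (h : t ∈ ball N c) : gnorm t ≤ c :=
  csInf_le ⟨0, fun _ h => h.1⟩ ⟨hc, h⟩

lemma mem_ball_of_lt {t : Generic N} {c : ℝ} (h : gnorm t < c) : t ∈ ball N c := by
  obtain ⟨d, hd, hdc⟩ := exists_lt_of_csInf_lt (exists_mem_ball t) h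
  exact ball_mono hdc.le hd.2

lemma gnorm_add_le (s t : Generic N) : gnorm (s + t) ≤ max (gnorm s) (gnorm t) := by
  refine le_of_forall_gt fun c hc => ?_
  obtain ⟨d, hd, hdc⟩ := exists_between hc
  have hd0 : 0 ≤ d := (gnorm_nonneg s).trans ((le_max_left _ _).trans hd.le)
  exact (gnorm_le hd0 (add_mem (mem_ball_of_lt ((le_max_left _ _).trans_lt hd))
    (mem_ball_of_lt ((le_max_right _ _).trans_lt hd)))).trans_lt hdc

variable (N) in
/-- The seminorm as a seminorm of groups. -/
def seminorm : AddGroupSeminorm (Generic N) where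
  toFun := gnorm
  map_zero' := le_antisymm (gnorm_le le_rfl (zero_mem _)) (gnorm_nonneg _)
  add_le' s t := (gnorm_add_le s t).trans
    (max_le_add_of_nonneg (gnorm_nonneg s) (gnorm_nonneg t))
  neg' t := by simp only [gnorm, neg_mem_iff]

instance : SeminormedAddCommGroup (Generic N) := (seminorm N).toSeminormedAddCommGroup

instance : IsUltrametricDist (Generic N) :=
  IsUltrametricDist.isUltrametricDist_of_forall_norm_add_le_max_norm gnorm_add_le

lemma norm_mk_le (r : F) (x : N) : ‖mk r x‖ ≤ ‖r‖ * min ‖x‖ 1 :=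
  gnorm_le (by positivity) (AddSubgroup.subset_closure ⟨r, x, le_rfl, rfl⟩)

/-- A linear map is bounded if it is bounded on the generators. -/
lemma norm_le_of_mk {V : BanMod F} (f : Generic N →ₗ[F] V) {C : ℝ} (hC : 0 ≤ C)
    (h : ∀ r x, ‖f (mk r x)‖ ≤ C * (‖r‖ * min ‖x‖ 1)) (t : Generic N) : ‖f t‖ ≤ C * ‖t‖ := by
  have key : ∀ c : ℝ, ‖t‖ < c → ‖f t‖ ≤ C * c := by
    intro c hc
    have hc0 : 0 ≤ c := (norm_nonneg t).trans hc.le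
    refine AddSubgroup.closure_induction (p := fun t _ => ‖f t‖ ≤ C * c) ?_ ?_ ?_ ?_
      (mem_ball_of_lt hc)
    · rintro _ ⟨r, x, hrx, rfl⟩
      exact (h r x).trans (by gcongr)
    · rw [map_zero, norm_zero]
      positivity
    · intro x y _ _ hx hy
      rw [map_add]
      exact (IsUltrametricDist.norm_add_le_max _ _).trans (max_le hx hy)
    · intro x _ hx
      rwa [map_neg, norm_neg]
  refine ge_of_tendsto (f := fun c => C * c) (x := nhdsWithin ‖t‖ (Set.Ioi ‖t‖)) ?_
    (eventually_nhdsWithin_of_forall key)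
  exact ((continuous_const.mul continuous_id).tendsto _).mono_left nhdsWithin_le_nhds

lemma norm_smul_le' (r : F) (t : Generic N) : ‖r • t‖ ≤ ‖r‖ * ‖t‖ := by
  have key : ∀ c : ℝ, ‖t‖ < c → ‖r • t‖ ≤ ‖r‖ * c := by
    intro c hc
    have hc0 : 0 ≤ c := (norm_nonneg t).trans hc.le
    refine gnorm_le (by positivity) ?_
    refine AddSubgroup.closure_induction (p := fun t _ => r • t ∈ ball N (‖r‖ * c)) ?_ ?_ ?_ ?_
      (mem_ball_of_lt hc)
    · rintro _ ⟨s, x, hsx, rfl⟩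
      refine AddSubgroup.subset_closure ⟨r * s, x, ?_, smul_mk r s x⟩
      rw [norm_mul, mul_assoc]
      gcongr
    · rw [smul_zero]; exact zero_mem _
    · intro x y _ _ hx hy; rw [smul_add]; exact add_mem hx hy
    · intro x _ hx; rw [smul_neg]; exact neg_mem hx
  refine ge_of_tendsto (f := fun c => ‖r‖ * c) (x := nhdsWithin ‖t‖ (Set.Ioi ‖t‖)) ?_
    (eventually_nhdsWithin_of_forall key)
  exact ((continuous_const.mul continuous_id).tendsto _).mono_left nhdsWithin_le_nhds

instance : UniformContinuousConstSMul F (Generic N) where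
  uniformContinuous_const_smul r :=
    uniformContinuous_addMonoidHom_of_continuous (f := DistribSMul.toAddMonoidHom (Generic N) r)
      (BanMod.continuous_of_bound _ ⟨‖r‖, fun t => norm_smul_le' r t⟩)

lemma exists_smul_bound (N : BanMod (unitBall F)) :
    ∃ C : ℝ, 0 ≤ C ∧ ∀ (r : F) (t : Generic N), ‖r • t‖ ≤ C * ‖r‖ * ‖t‖ :=
  ⟨1, zero_le_one, fun r t => by rw [one_mul]; exact norm_smul_le' r t⟩

/-- The linear map on `F ⊗ N` induced by a linear map on `N`. -/
def lift {V : Type*} [AddCommGroup V] [Module F V] (f : N →ₗ[unitBall F] V) : Generic N →ₗ[F] V :=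
  f.liftBaseChange F

lemma lift_mk {V : Type*} [AddCommGroup V] [Module F V] (f : N →ₗ[unitBall F] V) (r : F) (x : N) :
    lift f (mk r x) = r • f x := LinearMap.liftBaseChange_tmul F f r x

end Generic

/-- The Banach space over `F` generated by a Banach module `N` over the ring of integers: the
completion of `F ⊗ N` for the largest seminorm bounded by `‖r‖ min(‖x‖, 1)` on `r ⊗ x`. -/
def genericObj (N : BanMod (unitBall F)) : BanMod F :=
  BanMod.compl (Generic N) (Generic.exists_smul_bound N)

variable (π : PseudoUniformizer F)

/-- An element of `V` lying in `π⁻ⁿ V°`, as an element of the Banach module. -/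
def latMk {π : PseudoUniformizer F} {V : BanMod F} {n : ℕ} (v : V) (h : v ∈ lattice π V n) :
    latticeObj π V n := ⟨v, h⟩

/-- The element `1 ⊗ x`. -/
def genericMk {N : BanMod (unitBall F)} (x : N) : genericObj N :=
  BanMod.toCompl (Generic.exists_smul_bound N) (Generic.mk 1 x)

lemma norm_smul_genericMk_le {N : BanMod (unitBall F)} (r : F) (x : N) :
    ‖r • genericMk x‖ ≤ ‖r‖ * min ‖x‖ 1 := by
  have h : r • genericMk x = BanMod.toCompl (Generic.exists_smul_bound N) (Generic.mk r x) := by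
    refine (map_smul (BanMod.toCompl (Generic.exists_smul_bound N)) r (Generic.mk 1 x)).symm.trans ?_
    rw [Generic.smul_mk, mul_one]
  rw [h]
  exact (BanMod.norm_toCompl (h := Generic.exists_smul_bound N) _).trans_le
    (Generic.norm_mk_le r x)

lemma norm_genericMk_le {N : BanMod (unitBall F)} (x : N) : ‖genericMk x‖ ≤ ‖x‖ := by
  have := norm_smul_genericMk_le (1 : F) x
  rw [one_smul, norm_one, one_mul] at this
  exact this.trans (min_le_left _ _)

/-- This is the reason for capping `‖x‖` at `1` in the seminorm: all of `N`, of whatever diameter,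
lands in a single lattice, so that the unit is a map to a member of the ind-object. -/
lemma genericMk_mem {N : BanMod (unitBall F)} (x : N) :
    genericMk x ∈ lattice π (genericObj N) 0 := fun r hr => by
  rw [pow_zero, mul_one]
  exact (norm_smul_genericMk_le r x).trans
    (mul_le_one₀ hr (by positivity) (min_le_right _ _))

lemma genericMk_add {N : BanMod (unitBall F)} (x y : N) :
    genericMk (x + y) = genericMk x + genericMk y := by
  rw [genericMk, Generic.mk_add]
  exact map_add (BanMod.toCompl (Generic.exists_smul_bound N)) _ _

lemma genericMk_smul {N : BanMod (unitBall F)} (r : unitBall F) (x : N) :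
    genericMk (r • x) = (r : F) • genericMk x := by
  rw [genericMk, Generic.mk_smul]
  exact map_smul (BanMod.toCompl (Generic.exists_smul_bound N)) (r : F) _

/-- The map `N ⟶ (F ⊗ N)°`. -/
def genericUnit (N : BanMod (unitBall F)) : N ⟶ latticeObj π (genericObj N) 0 :=
  BanMod.ofLin
    { toFun := fun x => latMk (genericMk x) (genericMk_mem π x)
      map_add' := fun x y => coe_injective (genericMk_add x y)
      map_smul' := fun r x => coe_injective (genericMk_smul r x) }
    ⟨1, fun x => (norm_genericMk_le x).trans_eq (one_mul _).symm⟩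

variable {π}

/-- A bounded map `N ⟶ π⁻ⁿ T°` is generic if bounded maps from `N` to Banach spaces over `F` that
have bounded image extend uniquely along it to `T`. -/
structure IsGeneric {N : BanMod (unitBall F)} {T : BanMod F} {n : ℕ}
    (η : N ⟶ latticeObj π T n) : Prop where
  exists_ext : ∀ {V : BanMod F} {m : ℕ} (g : N ⟶ latticeObj π V m),
    ∃ f : T ⟶ V, ∀ x, BanMod.lin f (coe (BanMod.lin η x)) = coe (BanMod.lin g x)
  ext : ∀ {V : BanMod F} {f g : T ⟶ V}, (∀ x, BanMod.lin f (coe (BanMod.lin η x)) =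
    BanMod.lin g (coe (BanMod.lin η x))) → f = g

/-- A map to a lattice extends linearly to `F ⊗ N` and then to the completion. It is unique because
the elements `r ⊗ x` span a dense subspace. -/
lemma isGeneric_genericUnit (N : BanMod (unitBall F)) : IsGeneric (genericUnit π N) where
  exists_ext {V m} g := by
    let l : N →ₗ[unitBall F] V := (lattice π V m).subtype ∘ₗ BanMod.lin g
    obtain ⟨C, hC, hV⟩ := V.exists_smul_bound
    obtain ⟨K, hK, hg⟩ := BanMod.exists_bound g
    obtain ⟨c, hc⟩ := bounded_lattice π V m
    have hc0 : 0 ≤ c := (norm_nonneg _).trans (hc 0 (zero_mem _))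
    -- Boundedness of `g` controls small `x`, and boundedness of the target lattice controls the
    -- rest; together these are exactly boundedness for the capped seminorm.
    have hl (x : N) : ‖l x‖ ≤ max K c * min ‖x‖ 1 := by
      rcases min_cases ‖x‖ 1 with ⟨h, -⟩ | ⟨h, -⟩
      · rw [h]
        exact (hg x).trans (by gcongr; exact le_max_left _ _)
      · rw [h, mul_one]
        exact (hc _ (coe_mem _)).trans (le_max_right _ _)
    obtain ⟨f, hf⟩ := BanMod.exists_complLift (h := Generic.exists_smul_bound N) (Generic.lift l)
      ⟨C * max K c, Generic.norm_le_of_mk _ (by positivity) fun r x => by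
        rw [Generic.lift_mk]
        calc ‖r • l x‖ ≤ C * ‖r‖ * ‖l x‖ := hV _ _
          _ ≤ C * ‖r‖ * (max K c * min ‖x‖ 1) := by gcongr; exact hl x
          _ = _ := by ring⟩
    exact ⟨f, fun x => (hf _).trans ((Generic.lift_mk l 1 x).trans (one_smul F _))⟩
  ext {V f g} h := BanMod.compl_ext fun t => by
    let T : Generic N →ₗ[F] genericObj N := BanMod.toCompl (Generic.exists_smul_bound N)
    refine Generic.induction (p := fun t => BanMod.lin f (T t) = BanMod.lin g (T t)) t
      (by rw [map_zero, map_zero, map_zero]) (fun r x => ?_) (fun s t hs ht => ?_)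
    · have : Generic.mk r x = r • Generic.mk (1 : F) x := by rw [Generic.smul_mk, mul_one]
      rw [this, map_smul, map_smul, map_smul]
      exact congrArg (r • ·) (h x)
    · rw [map_add, map_add, map_add, hs, ht]

/-- The multiples `π ^ t • v` tend to zero and lattices are neighbourhoods of zero. Allowing all
larger exponents lets several vectors share one. -/
lemma exists_smul_mem_lattice (V : BanMod F) (n : ℕ) (v : V) :
    ∃ s : ℕ, ∀ t, s ≤ t → π.val ^ t • v ∈ lattice π V n := by
  obtain ⟨ε, hε, h⟩ := exists_ball_lattice (π := π) V n
  have hlim : Filter.Tendsto (fun t : ℕ => π.val ^ t • v) Filter.atTop (nhds 0) := by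
    obtain ⟨C, hC, hV⟩ := V.exists_smul_bound
    refine squeeze_zero_norm (a := fun t : ℕ => C * ‖π.val‖ ^ t * ‖v‖)
      (fun t => (hV _ _).trans_eq (by rw [norm_pow])) ?_
    simpa using ((tendsto_pow_atTop_nhds_zero_of_lt_one (norm_nonneg _)
      π.norm_lt_one).const_mul C).mul_const ‖v‖
  obtain ⟨s, hs⟩ := Filter.eventually_atTop.1 (hlim.eventually (Metric.closedBall_mem_nhds _ hε))
  exact ⟨s, fun t ht => h _ (by simpa using hs t ht)⟩

lemma coe_smul {V : BanMod F} {n : ℕ} (r : unitBall F) (v : latticeObj π V n) :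
    coe (r • v) = (r : F) • coe v := rfl

/-- A map linear over `F°` respects every scalar of `F` that relates two lattice vectors, since
either the scalar or its inverse is integral. -/
lemma coe_lin_smul {V W : BanMod F} {n m : ℕ} (g : latticeObj π V n ⟶ latticeObj π W m) {a : F}
    {x y : latticeObj π V n} (h : coe x = a • coe y) :
    coe (BanMod.lin g x) = a • coe (BanMod.lin g y) := by
  rcases le_total ‖a‖ 1 with ha | ha
  · have : x = (⟨a, ha⟩ : unitBall F) • y := coe_injective h
    rw [this, map_smul]
    rfl
  · have ha0 : a ≠ 0 := norm_pos_iff.1 (zero_lt_one.trans_le ha)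
    have : y = (⟨a⁻¹, by
        change ‖a⁻¹‖ ≤ 1
        rw [norm_inv]
        exact inv_le_one_of_one_le₀ ha⟩ : unitBall F) • x :=
      coe_injective (by rw [coe_smul, h, inv_smul_smul₀ ha0])
    rw [this, map_smul, coe_smul, smul_inv_smul₀ ha0]

/-- Inverting `π` in a lattice recovers `V`, so `g` extends by `v ↦ π⁻ˢ g(πˢ v)` for any exponent
with `πˢ v` in the lattice. -/
lemma exists_extend_lattice {V W : BanMod F} {n m : ℕ} (g : latticeObj π V n ⟶ latticeObj π W m) :
    ∃ f : V ⟶ W, ∀ x, BanMod.lin f (coe x) = coe (BanMod.lin g x) := by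
  have hp (s : ℕ) : π.val ^ s ≠ 0 := pow_ne_zero s π.ne_zero
  choose s hs using exists_smul_mem_lattice (π := π) V n
  let y (v : V) : latticeObj π V n := latMk _ (hs v _ le_rfl)
  have hy (v : V) : coe (y v) = π.val ^ s v • v := rfl
  let ev (v : V) : W := (π.val ^ s v)⁻¹ • coe (BanMod.lin g (y v))
  -- The value does not depend on the scalar that moves `v` into the lattice. Additivity and
  -- linearity follow by computing with a common exponent.
  have hev {a : F} {v : V} {x : latticeObj π V n} (h : coe x = a • v) :
      coe (BanMod.lin g x) = a • ev v := by
    refine (coe_lin_smul g (a := a * (π.val ^ s v)⁻¹) (y := y v) ?_).trans (mul_smul _ _ _)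
    rw [h, hy, mul_smul, inv_smul_smul₀ (hp _)]
  let l : V →ₗ[F] W :=
    { toFun := ev
      map_add' := fun v w => by
        let t := max (s v) (max (s w) (s (v + w)))
        let x := latMk _ (hs v t (le_max_left _ _))
        let x' := latMk _ (hs w t ((le_max_left _ _).trans (le_max_right _ _)))
        have h : coe (x + x') = π.val ^ t • (v + w) := (smul_add _ _ _).symm
        refine smul_right_injective _ (hp t) ?_
        change π.val ^ t • _ = π.val ^ t • (_ + _)
        rw [smul_add, ← hev h, ← hev (x := x) rfl, ← hev (x := x') rfl, map_add, coe_add]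
      map_smul' := fun r v => by
        refine smul_right_injective _ (hp (s (r • v))) ?_
        change π.val ^ s (r • v) • _ = π.val ^ s (r • v) • r • _
        rw [← hev (hy _), ← mul_smul, ← hev]
        rw [hy, mul_smul] }
  obtain ⟨C, hC, hW⟩ := W.exists_smul_bound
  obtain ⟨D, hD, hV⟩ := V.exists_smul_bound
  obtain ⟨K, hK, hg⟩ := BanMod.exists_bound g
  refine ⟨BanMod.ofLin l ⟨C * K * D, fun v => ?_⟩,
    fun x => ((hev (one_smul F (coe x)).symm).trans (one_smul F _)).symm⟩
  have ha : 0 < ‖π.val ^ s v‖ := norm_pos_iff.2 (hp _)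
  -- The norms of `πˢ` and its inverse cancel, so the bound is uniform although `s` depends on `v`.
  calc ‖l v‖ ≤ C * ‖(π.val ^ s v)⁻¹‖ * ‖coe (BanMod.lin g (y v))‖ := hW _ _
    _ ≤ C * ‖(π.val ^ s v)⁻¹‖ * (K * ‖π.val ^ s v • v‖) := by gcongr; exact hg _
    _ ≤ C * ‖(π.val ^ s v)⁻¹‖ * (K * (D * ‖π.val ^ s v‖ * ‖v‖)) := by gcongr; exact hV _ _
    _ = C * K * D * ‖v‖ * (‖π.val ^ s v‖⁻¹ * ‖π.val ^ s v‖) := by rw [norm_inv]; ring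
    _ = C * K * D * ‖v‖ := by rw [inv_mul_cancel₀ ha.ne', mul_one]

lemma hom_ext_lattice {V W : BanMod F} {n : ℕ} {f g : V ⟶ W}
    (h : ∀ x : latticeObj π V n, BanMod.lin f (coe x) = BanMod.lin g (coe x)) : f = g :=
  BanMod.hom_ext fun v => by
    obtain ⟨s, hs⟩ := exists_smul_mem_lattice (π := π) V n v
    have h1 : BanMod.lin f (π.val ^ s • v) = BanMod.lin g (π.val ^ s • v) := h (latMk _ (hs s le_rfl))
    rw [map_smul, map_smul] at h1
    exact smul_right_injective _ (pow_ne_zero s π.ne_zero) h1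

/-- With this, full faithfulness and the adjunction follow from one statement,
`IsGeneric.bijective`. -/
lemma isGeneric_id (V : BanMod F) (n : ℕ) : IsGeneric (𝟙 (latticeObj π V n)) where
  exists_ext g := exists_extend_lattice g
  ext h := hom_ext_lattice h

end

/-! ### Full faithfulness and the left adjoint. -/

section

variable {F : Type u} [NontriviallyNormedField F] [IsUltrametricDist F]
variable {π : PseudoUniformizer F}

lemma homToRestrict_post {V : BanMod F} {Y Z : IndObj (BanMod F)} (n : ℕ) (g : Y ⟶ Z)
    (y : IndObj.HomTo V Y) : homToRestrict (π := π) n (IndObj.HomTo.post g y) =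
      IndObj.HomTo.post (underlineMap π g) (homToRestrict n y) := by
  obtain ⟨j, f, rfl⟩ := y.exists_mk
  obtain ⟨m, hm⟩ := exists_map_lattice π f n
  rw [homToRestrict_mk f hm]
  exact (pre_homToRestrict f hm (IndObj.app g j)).symm

namespace IsGeneric

variable {N : BanMod (unitBall F)} {T : BanMod F} {n : ℕ} {η : N ⟶ latticeObj π T n}

/-- Bounded maps from `T` to members of `Y` are the same as bounded maps from `N` to members of
`Y̲`. -/
lemma bijective (h : IsGeneric η) (Y : IndObj (BanMod F)) :
    Function.Bijective fun y : IndObj.HomTo T Y =>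
      IndObj.HomTo.pre (Y := underline π Y) η (homToRestrict n y) := by
  constructor
  · intro x y hxy
    obtain ⟨j, f, g, rfl, rfl⟩ := x.exists_common y
    obtain ⟨m, hm⟩ := exists_map_lattice π f n
    obtain ⟨m', hm'⟩ := exists_map_lattice π g n
    have hf := homToRestrict_mk (Y := Y) (m := max m m') f
      (fun v hv => lattice_mono π _ (le_max_left _ _) (hm v hv))
    have hg := homToRestrict_mk (Y := Y) (m := max m m') g
      (fun v hv => lattice_mono π _ (le_max_right _ _) (hm' v hv))
    obtain ⟨k, a, hk⟩ := IndObj.HomTo.mk_eq_mk_same.1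
      ((congrArg (IndObj.HomTo.pre η) hf).symm.trans (hxy.trans (congrArg (IndObj.HomTo.pre η) hg)))
    refine IndObj.HomTo.mk_eq_mk_same.2 ⟨k.fst, a.1, h.ext fun x => ?_⟩
    exact congrArg coe (congrArg (fun k => BanMod.lin k x) hk)
  · intro z
    obtain ⟨⟨j, m⟩, g, rfl⟩ := z.exists_mk
    obtain ⟨f, hf⟩ := h.exists_ext (V := Y.diag.obj j) (m := m) g
    refine ⟨IndObj.HomTo.mk j f, ?_⟩
    obtain ⟨l, hl⟩ := exists_map_lattice π f n
    exact (congrArg (IndObj.HomTo.pre η) (homToRestrict_mk f hl)).trans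
      (homTo_underline_eq_same (X := Y) _ _ hf)

end IsGeneric

lemma bijective_homToRestrict (V : BanMod F) (Y : IndObj (BanMod F)) (n : ℕ) :
    Function.Bijective (homToRestrict (π := π) n : IndObj.HomTo V Y → _) := by
  convert (isGeneric_id (π := π) V n).bijective Y using 2 with y
  exact (IndObj.HomTo.pre_id _).symm

lemma underlineFunctor_map_injective (X Y : IndObj (BanMod F)) :
    Function.Injective (underlineMap π : (X ⟶ Y) → _) := fun _ _ h =>
  IndObj.hom_ext fun i => (bijective_homToRestrict (π := π) _ Y 0).1
    (congrArg (fun k : underline π X ⟶ underline π Y => IndObj.app k ⟨i, 0⟩) h)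

/-- The component of `ψ` at the lattice `(i, 0)` already determines a class of maps out of `X_i`,
and these classes form the preimage. -/
lemma underlineFunctor_map_surjective (X Y : IndObj (BanMod F)) :
    Function.Surjective (underlineMap π : (X ⟶ Y) → _) := fun ψ => by
  choose φ hφ using fun i : X.J =>
    (bijective_homToRestrict (π := π) (X.diag.obj i) Y 0).2 (IndObj.app ψ ⟨i, 0⟩)
  -- The component at `(i, n)` also comes from a class on `X_i`. The two classes have the same
  -- restriction to the lattice with index `0`, and that restriction is injective.
  have hn (i : X.J) (n : ℕ) : homToRestrict n (φ i) = IndObj.app ψ ⟨i, n⟩ := by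
    obtain ⟨y, hy⟩ := (bijective_homToRestrict (π := π) (X.diag.obj i) Y n).2 (IndObj.app ψ ⟨i, n⟩)
    have h0 : ∀ v ∈ lattice π (X.diag.obj i) 0,
        BanMod.lin (X.diag.map (𝟙 i)) v ∈ lattice π (X.diag.obj i) n := fun v hv => by
      rw [X.diag.map_id]
      exact lattice_mono π _ (Nat.zero_le n) hv
    have h1 := (pre_homToRestrict (Y := Y) _ h0 y).symm.trans
      ((congrArg (IndObj.HomTo.pre _) hy).trans
        (IndObj.pre_app ψ (i := ⟨i, 0⟩) (i' := ⟨i, n⟩) ⟨𝟙 i, h0⟩))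
    have h2 := (bijective_homToRestrict (π := π) _ Y 0).1 (h1.trans (hφ i).symm)
    rw [X.diag.map_id, IndObj.HomTo.pre_id] at h2
    rw [← h2, hy]
  refine ⟨IndObj.homMk φ fun {i i'} a => (bijective_homToRestrict (π := π) _ Y 0).1 ?_,
    IndObj.hom_ext fun ⟨i, n⟩ => hn i n⟩
  obtain ⟨m, hm⟩ := exists_map_lattice π (X.diag.map a) 0
  rw [← pre_homToRestrict _ hm, hn, hn]
  exact IndObj.pre_app ψ (i := ⟨i, 0⟩) (i' := ⟨i', m⟩) ⟨a, hm⟩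

instance : (underlineFunctor π).Full := ⟨fun ψ => underlineFunctor_map_surjective _ _ ψ⟩

instance : (underlineFunctor π).Faithful := ⟨fun h => underlineFunctor_map_injective _ _ h⟩

variable (π) in
/-- The map of Banach spaces generated by a map of Banach modules. -/
def genericMap {N N' : BanMod (unitBall F)} (f : N ⟶ N') : genericObj N ⟶ genericObj N' :=
  ((isGeneric_genericUnit (π := π) N).exists_ext (f ≫ genericUnit π N')).choose

lemma genericMap_genericMk {N N' : BanMod (unitBall F)} (f : N ⟶ N') (x : N) :
    BanMod.lin (genericMap π f) (genericMk x) = genericMk (BanMod.lin f x) :=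
  ((isGeneric_genericUnit (π := π) N).exists_ext (f ≫ genericUnit π N')).choose_spec x

variable (π) in
/-- The Banach space generated by a Banach module over the ring of integers, as a functor. -/
def genericFunctor : BanMod (unitBall F) ⥤ BanMod F where
  obj := genericObj
  map := genericMap π
  map_id N := (isGeneric_genericUnit (π := π) N).ext fun x => genericMap_genericMk (π := π) _ x
  map_comp f g := (isGeneric_genericUnit (π := π) _).ext fun x => by
    refine (genericMap_genericMk (π := π) _ x).trans (Eq.symm ?_)
    refine (congrArg (BanMod.lin (genericMap π g)) (genericMap_genericMk (π := π) f x)).trans ?_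
    exact genericMap_genericMk (π := π) _ _

/-- The map `colim_j Hom(F ⊗ N, Y_j) → colim_{(j, m)} Hom(N, π⁻ᵐ Y_j°)`. -/
def genericRestrict (N : BanMod (unitBall F)) (Y : IndObj (BanMod F))
    (y : IndObj.HomTo (genericObj N) Y) : IndObj.HomTo N (underline π Y) :=
  IndObj.HomTo.pre (genericUnit π N) (homToRestrict 0 y)

lemma bijective_genericRestrict (N : BanMod (unitBall F)) (Y : IndObj (BanMod F)) :
    Function.Bijective (genericRestrict (π := π) N Y) :=
  (isGeneric_genericUnit N).bijective Y

lemma genericRestrict_mk {N : BanMod (unitBall F)} {Y : IndObj (BanMod F)} {j : Y.J} {m : ℕ}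
    (f : genericObj N ⟶ Y.diag.obj j)
    (h : ∀ v ∈ lattice π (genericObj N) 0, BanMod.lin f v ∈ lattice π _ m) :
    genericRestrict N Y (IndObj.HomTo.mk j f) =
      IndObj.HomTo.mk (Y := underline π Y) ⟨j, m⟩ (genericUnit π N ≫ latticeMap f h) :=
  congrArg (IndObj.HomTo.pre (genericUnit π N)) (homToRestrict_mk f h)

lemma genericRestrict_pre {N N' : BanMod (unitBall F)} (f : N ⟶ N') (Y : IndObj (BanMod F))
    (y : IndObj.HomTo (genericObj N') Y) :
    genericRestrict (π := π) N Y (IndObj.HomTo.pre (genericMap π f) y) =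
      IndObj.HomTo.pre f (genericRestrict N' Y y) := by
  obtain ⟨j, g, rfl⟩ := y.exists_mk
  obtain ⟨m, hm⟩ := exists_map_lattice π g 0
  obtain ⟨l, hl⟩ := exists_map_lattice π (genericMap π f ≫ g) 0
  refine (genericRestrict_mk (Y := Y) _ hl).trans
    (Eq.trans ?_ (congrArg (IndObj.HomTo.pre f) (genericRestrict_mk g hm)).symm)
  exact homTo_underline_eq_same (X := Y) _ _ fun x =>
    congrArg (BanMod.lin g) (genericMap_genericMk (π := π) f x)

lemma genericRestrict_post {N : BanMod (unitBall F)} {Y Z : IndObj (BanMod F)} (g : Y ⟶ Z)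
    (y : IndObj.HomTo (genericObj N) Y) :
    genericRestrict (π := π) N Z (IndObj.HomTo.post g y) =
      IndObj.HomTo.post (underlineMap π g) (genericRestrict N Y y) := by
  refine (congrArg (IndObj.HomTo.pre _) (homToRestrict_post 0 g y)).trans ?_
  exact IndObj.HomTo.pre_post (Y := underline π Y) (Z := underline π Z) (genericUnit π N)
    (underlineMap π g) (homToRestrict 0 y)

variable (π) in
/-- The ind-Banach space over `F` generated by an ind-Banach module over the ring of integers. -/
def genericInd (M : IndObj (BanMod (unitBall F))) : IndObj (BanMod F) where
  J := M.J
  diag := M.diag ⋙ genericFunctor π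

variable (π) in
/-- The morphism `M ⟶ Y̲` corresponding to a morphism from the ind-Banach space generated by `M`
to `Y`. -/
def genericHom (M : IndObj (BanMod (unitBall F))) (Y : IndObj (BanMod F))
    (φ : genericInd π M ⟶ Y) : M ⟶ underline π Y :=
  IndObj.homMk (fun i => genericRestrict (M.diag.obj i) Y (IndObj.app φ i)) fun {_ i'} a =>
    (genericRestrict_pre (M.diag.map a) Y (IndObj.app φ i')).symm.trans
      (congrArg (genericRestrict _ Y) (IndObj.pre_app φ a))

/-- The bijections for the members of `M` are natural, so they pass to the limit over `M.J`. -/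
lemma bijective_genericHom (M : IndObj (BanMod (unitBall F))) (Y : IndObj (BanMod F)) :
    Function.Bijective (genericHom π M Y) := by
  constructor
  · intro f g h
    exact IndObj.hom_ext fun i => (bijective_genericRestrict (π := π) _ Y).1
      (congrArg (fun k : M ⟶ underline π Y => IndObj.app k i) h)
  · intro ψ
    choose φ hφ using fun i : M.J =>
      (bijective_genericRestrict (π := π) (M.diag.obj i) Y).2 (IndObj.app ψ i)
    refine ⟨IndObj.homMk (X := genericInd π M) φ fun {i i'} a =>
      (bijective_genericRestrict (π := π) _ Y).1 ?_, IndObj.hom_ext hφ⟩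
    refine (genericRestrict_pre (M.diag.map a) Y (φ i')).trans ?_
    exact (congrArg (IndObj.HomTo.pre _) (hφ i')).trans ((IndObj.pre_app ψ a).trans (hφ i).symm)

variable (π) in
/-- Morphisms from the ind-Banach space generated by `M` to `Y` are morphisms from `M` to `Y̲`. -/
def genericEquiv (M : IndObj (BanMod (unitBall F))) (Y : IndObj (BanMod F)) :
    (genericInd π M ⟶ Y) ≃ (M ⟶ (underlineFunctor π).obj Y) :=
  Equiv.ofBijective (genericHom π M Y) (bijective_genericHom M Y)

lemma genericEquiv_comp (M : IndObj (BanMod (unitBall F))) {Y Z : IndObj (BanMod F)}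
    (φ : genericInd π M ⟶ Y) (g : Y ⟶ Z) : genericEquiv π M Z (φ ≫ g) =
      genericEquiv π M Y φ ≫ (underlineFunctor π).map g :=
  IndObj.hom_ext fun i => genericRestrict_post g (IndObj.app φ i)

end

section

variable {V : Type w} [Category.{v} V] [MonoidalCategory V] [SymmetricCategory V]
variable {C : Type w} [Category.{v} C] [MonoidalCategory C] [SymmetricCategory C]
variable (G : V ⥤ C) [G.LaxBraided] [RelTensor.IsIdempotent (LaxToMod.base G)]

namespace LaxToMod

instance [G.Full] : (toMod G).Full :=
  ⟨fun f => ⟨G.preimage f.hom, Mod.hom_ext _ _ (G.map_preimage f.hom)⟩⟩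

instance [G.Faithful] : (toMod G).Faithful :=
  ⟨fun h => G.map_injective (congrArg (fun k => k.hom) h)⟩

end LaxToMod

end

section

variable {F : Type u} [NontriviallyNormedField F] [IsUltrametricDist F] [CompleteSpace F]
variable (π : PseudoUniformizer F)

/-- Morphisms from the ind-Banach space generated by `M` to `Y` are morphisms of `F̲`-modules from
`M` to `Y̲`. -/
def modGenericEquiv (M : IndBanUnderline F π) (Y : IndObj (BanMod F)) :
    (genericInd π M.X ⟶ Y) ≃ (M ⟶ (toUnderline F π).obj Y) :=
  (genericEquiv π M.X Y).trans
    -- Linearity is automatic because `F̲` is idempotent, so module maps are just maps of the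
    -- underlying ind-objects.
    { toFun := fun f => RelTensor.mkHom (N := (toUnderline F π).obj Y) f
      invFun := fun f => f.hom
      left_inv := fun _ => rfl
      right_inv := fun _ => rfl }

lemma modGenericEquiv_comp (M : IndBanUnderline F π) {Y Z : IndObj (BanMod F)} (g : Y ⟶ Z)
    (φ : genericInd π M.X ⟶ Y) : modGenericEquiv π M Z (φ ≫ g) =
      modGenericEquiv π M Y φ ≫ (toUnderline F π).map g :=
  Mod.hom_ext _ _ (genericEquiv_comp M.X φ g)

/-- The functor `V ↦ V̲` is a reflective embedding. -/
instance reflectiveToUnderline : Reflective (toUnderline F π) where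
  L := Adjunction.leftAdjointOfEquiv (modGenericEquiv π) fun M _ _ g φ => modGenericEquiv_comp π M g φ
  adj := Adjunction.adjunctionOfEquivLeft _ _

end

/-! ### Representatives of a morphism of ind-objects as a filtered index category. -/

namespace IndObj

variable {C : Type w} [Category.{v} C]

/-- Representatives of the components of a morphism of ind-objects. -/
structure Level {Y Z : IndObj C} (p : Y ⟶ Z) : Type v where
  src : Y.J
  tgt : Z.J
  hom : Y.diag.obj src ⟶ Z.diag.obj tgt
  eq : app p src = HomTo.mk tgt hom

namespace Level

variable {Y Z : IndObj C} {p : Y ⟶ Z}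

/-- Morphisms of representatives: pairs of transition maps forming a commutative square. -/
@[ext]
structure Hom (q q' : Level p) : Type v where
  src : q.src ⟶ q'.src
  tgt : q.tgt ⟶ q'.tgt
  comm : Y.diag.map src ≫ q'.hom = q.hom ≫ Z.diag.map tgt

instance : SmallCategory (Level p) where
  Hom := Hom
  id q := ⟨𝟙 _, 𝟙 _, by simp⟩
  comp f g := ⟨f.src ≫ g.src, f.tgt ≫ g.tgt, by
    rw [Functor.map_comp, Functor.map_comp, Category.assoc, g.comm, reassoc_of% f.comm]⟩
  id_comp _ := Hom.ext (Category.id_comp _) (Category.id_comp _)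
  comp_id _ := Hom.ext (Category.comp_id _) (Category.comp_id _)
  assoc _ _ _ := Hom.ext (Category.assoc _ _ _) (Category.assoc _ _ _)

/-- Compatibility of the components of `p` holds only in the colimit over `Z`; moving both targets
further along turns it into a genuine commutative square. -/
lemma exists_square {j j' : Y.J} (a : j ⟶ j') {k k' : Z.J} {f : Y.diag.obj j ⟶ Z.diag.obj k}
    {f' : Y.diag.obj j' ⟶ Z.diag.obj k'} (hf : app p j = HomTo.mk k f)
    (hf' : app p j' = HomTo.mk k' f') :
    ∃ (l : Z.J) (b : k ⟶ l) (c : k' ⟶ l),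
      Y.diag.map a ≫ f' ≫ Z.diag.map c = f ≫ Z.diag.map b := by
  have h := pre_app p a
  rw [hf, hf', HomTo.pre_mk] at h
  obtain ⟨l, c, b, hl⟩ := HomTo.mk_eq_mk.1 h
  exact ⟨l, b, c, by rw [← hl, Category.assoc]⟩

/-- The target of a representative can be moved along the diagram. -/
def move {j : Y.J} {k l : Z.J} {f : Y.diag.obj j ⟶ Z.diag.obj k} (hf : app p j = HomTo.mk k f)
    (b : k ⟶ l) : Level p :=
  ⟨j, l, f ≫ Z.diag.map b, hf.trans (HomTo.mk_map _ _).symm⟩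

/-- Source arrows come from filteredness of `Y.J`. The squares they should form commute only after
moving the target, which replaces a representative by another of the same component. -/
instance : IsFiltered (Level p) where
  nonempty := by
    obtain ⟨k, f, h⟩ := (app p (Classical.arbitrary Y.J)).exists_mk
    exact ⟨⟨_, k, f, h⟩⟩
  cocone_objs q q' := by
    obtain ⟨k₀, f, hf⟩ := (app p (IsFiltered.max q.src q'.src)).exists_mk
    obtain ⟨k, b, c, h⟩ := exists_square (IsFiltered.leftToMax q.src q'.src) q.eq hf
    obtain ⟨k', b', c', h'⟩ := exists_square (IsFiltered.rightToMax q.src q'.src) q'.eq hf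
    obtain ⟨l, d, d', hd⟩ := IsFiltered.span c c'
    let u : q ⟶ move hf (c ≫ d) := ⟨IsFiltered.leftToMax q.src q'.src, b ≫ d, by
      simp only [move, Functor.map_comp]
      rw [reassoc_of% h]⟩
    let u' : q' ⟶ move hf (c ≫ d) := ⟨IsFiltered.rightToMax q.src q'.src, b' ≫ d', by
      simp only [move, hd, Functor.map_comp]
      rw [reassoc_of% h']⟩
    exact ⟨_, u, u', ⟨⟩⟩
  cocone_maps q q' u v := by
    obtain ⟨k₀, f, hf⟩ := (app p (IsFiltered.coeq u.src v.src)).exists_mk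
    obtain ⟨k, b, c, h⟩ := exists_square (IsFiltered.coeqHom u.src v.src) q'.eq hf
    -- The target arrow has to complete the square over the coequalizing source arrow and also
    -- coequalize `u.tgt` and `v.tgt`. Factoring through `l` achieves both.
    obtain ⟨l, d, e, hd⟩ := IsFiltered.span (IsFiltered.coeqHom u.tgt v.tgt) b
    let w : q' ⟶ move hf (c ≫ e) := ⟨IsFiltered.coeqHom u.src v.src, b ≫ e, by
      simp only [move, Functor.map_comp]
      rw [reassoc_of% h]⟩
    refine ⟨_, w, Hom.ext (IsFiltered.coeq_condition u.src v.src) ?_⟩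
    change u.tgt ≫ b ≫ e = v.tgt ≫ b ≫ e
    rw [← hd, IsFiltered.coeq_condition_assoc]

end Level

end IndObj

/-! ### Kernels, cokernels and the coimage of a morphism of ind-Banach spaces. -/

section

variable {C : Type*} [Category* C] [Limits.HasZeroMorphisms C]

lemma isCokernelOf_of_existsUnique {X Y Z : C} {p : Y ⟶ Z} {f : X ⟶ Y} (h : f ≫ p = 0)
    (H : ∀ {M : C} (g : Y ⟶ M), f ≫ g = 0 → ∃! k, p ≫ k = g) : IsCokernelOf p f :=
  ⟨h, ⟨Limits.CokernelCofork.IsColimit.ofπ p h (fun g hg => (H g hg).choose)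
    (fun g hg => (H g hg).choose_spec.1) fun g hg k hk => (H g hg).choose_spec.2 k hk⟩⟩

lemma IsCokernelOf.existsUnique {X Y Z M : C} {p : Y ⟶ Z} {f : X ⟶ Y} (h : IsCokernelOf p f)
    (g : Y ⟶ M) (hg : f ≫ g = 0) : ∃! k, p ≫ k = g := by
  obtain ⟨h0, ⟨hl⟩⟩ := h
  obtain ⟨k, hk⟩ := Limits.CokernelCofork.IsColimit.desc' hl g hg
  exact ⟨k, hk, fun k' hk' => Limits.Cofork.IsColimit.hom_ext hl (hk'.trans hk.symm)⟩

lemma IsCokernelOf.epi {X Y Z : C} {p : Y ⟶ Z} {f : X ⟶ Y} (h : IsCokernelOf p f) : Epi p :=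
  ⟨fun a b hab => (h.existsUnique (p ≫ b)
    (by rw [reassoc_of% h.1, Limits.zero_comp])).unique hab rfl⟩

lemma IsKernelOf.exists_lift {X Y Z M : C} {i : X ⟶ Y} {f : Y ⟶ Z} (h : IsKernelOf i f)
    (g : M ⟶ Y) (hg : g ≫ f = 0) : ∃ k, k ≫ i = g := by
  obtain ⟨h0, ⟨hl⟩⟩ := h
  obtain ⟨k, hk⟩ := Limits.KernelFork.IsLimit.lift' hl g hg
  exact ⟨k, hk⟩

end

namespace BanMod

variable {R : Type u} [NormedCommRing R]

/-- A closed submodule of a Banach module. -/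
def sub (V : BanMod R) (N : Submodule R V) (h : IsClosed (N : Set V)) : BanMod R where
  carrier := N
  ultra := ⟨fun x y z => dist_triangle_max (x : V) y z⟩
  complete := h.completeSpace_coe
  smul_bound := by
    obtain ⟨C, hC⟩ := V.smul_bound
    exact ⟨C, fun r v => hC r v⟩

/-- The inclusion of a closed submodule. -/
def subι (V : BanMod R) (N : Submodule R V) (h : IsClosed (N : Set V)) : sub V N h ⟶ V :=
  ofLin (M := sub V N h) N.subtype ⟨1, fun _ => (one_mul _).symm.le⟩

/-- The kernel of a morphism of Banach modules. -/
abbrev kernel {V W : BanMod R} (f : V ⟶ W) : BanMod R := sub V (LinearMap.ker (lin f)) (isClosed_ker f)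

/-- The inclusion of the kernel of a morphism. -/
abbrev kernelι {V W : BanMod R} (f : V ⟶ W) : kernel f ⟶ V := subι V _ _

lemma kernelι_comp {V W : BanMod R} (f : V ⟶ W) : kernelι f ≫ f = 0 :=
  hom_ext fun v => LinearMap.mem_ker.1 v.2

/-- The quotient by the kernel of a morphism. -/
abbrev coimage {V W : BanMod R} (f : V ⟶ W) : BanMod R :=
  quot V (LinearMap.ker (lin f)) (isClosed_ker f)

/-- The projection to the quotient by the kernel. -/
abbrev coimageMk {V W : BanMod R} (f : V ⟶ W) : V ⟶ coimage f :=
  quotMk V (LinearMap.ker (lin f)) (isClosed_ker f)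

end BanMod

section

variable {F : Type u} [NontriviallyNormedField F]
variable {X Y Z : IndObj (BanMod F)} {i : X ⟶ Y} {p : Y ⟶ Z}

/-- The transition maps between the quotients of members of `Y` by kernels of representatives. -/
def coimageMap {q q' : IndObj.Level p} (a : q ⟶ q') :
    BanMod.coimage q.hom ⟶ BanMod.coimage q'.hom :=
  BanMod.quotLift (Y.diag.map a.src ≫ BanMod.coimageMk q'.hom) fun x hx => by
    refine LinearMap.mem_ker.2 ((BanMod.lin_comp _ _ x).trans (BanMod.quotMk_eq_zero.2 ?_))
    have h := congrArg (fun k => BanMod.lin k x) a.comm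
    exact LinearMap.mem_ker.2 (h.trans ((congrArg (BanMod.lin (Z.diag.map a.tgt)) hx).trans
      (map_zero _)))

lemma coimageMk_coimageMap {q q' : IndObj.Level p} (a : q ⟶ q') :
    BanMod.coimageMk q.hom ≫ coimageMap a = Y.diag.map a.src ≫ BanMod.coimageMk q'.hom :=
  BanMod.quotMk_quotLift _ _

variable (p) in
/-- The coimage of a morphism of ind-Banach spaces: the formal colimit of the quotients of members of
`Y` by kernels of representatives. -/
def indCoimage : IndObj (BanMod F) where
  J := IndObj.Level p
  diag :=
    { obj := fun q => BanMod.coimage q.hom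
      map := coimageMap
      map_id := fun q => BanMod.quot_ext (by
        rw [coimageMk_coimageMap, Category.comp_id]
        exact (congrArg (· ≫ _) (Y.diag.map_id q.src)).trans (Category.id_comp _))
      map_comp := fun {q q' q''} a b => BanMod.quot_ext (by
        rw [coimageMk_coimageMap, ← Category.assoc, coimageMk_coimageMap, Category.assoc,
          coimageMk_coimageMap, ← Category.assoc]
        exact congrArg (· ≫ _) (Y.diag.map_comp a.src b.src)) }

/-- An arrow of sources becomes an arrow of representatives once the target of `q'` is moved. Hence
the class of the projection depends neither on the representative nor on transition maps. -/
lemma mk_coimageMk_eq {q q' : IndObj.Level p} (a : q.src ⟶ q'.src) :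
    IndObj.HomTo.mk (Y := indCoimage p) q (BanMod.coimageMk q.hom) =
      IndObj.HomTo.mk (Y := indCoimage p) q' (Y.diag.map a ≫ BanMod.coimageMk q'.hom) := by
  obtain ⟨k, b, c, h⟩ := IndObj.Level.exists_square a q.eq q'.eq
  let u : q ⟶ IndObj.Level.move q'.eq c := ⟨a, b, h⟩
  let v : q' ⟶ IndObj.Level.move q'.eq c := ⟨𝟙 q'.src, c,
    (congrArg (· ≫ _) (Y.diag.map_id q'.src)).trans (Category.id_comp _)⟩
  refine IndObj.HomTo.mk_eq_mk.2 ⟨_, u, v, (coimageMk_coimageMap u).trans ?_⟩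
  refine Eq.trans ?_ (Category.assoc _ _ _).symm
  refine congrArg (_ ≫ ·) (Eq.trans ?_ (coimageMk_coimageMap v).symm)
  exact ((congrArg (· ≫ _) (Y.diag.map_id _)).trans (Category.id_comp _)).symm

/-- A representative with given source. -/
def someLevel (p : Y ⟶ Z) (j : Y.J) : IndObj.Level p :=
  ⟨j, _, _, (IndObj.app p j).exists_mk.choose_spec.choose_spec⟩

variable (p) in
/-- The projection from `Y` to the coimage. -/
def indCoimageMk : Y ⟶ indCoimage p :=
  IndObj.homMk (fun j => IndObj.HomTo.mk (Y := indCoimage p) (someLevel p j)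
    (BanMod.coimageMk (someLevel p j).hom)) fun {j j'} a =>
      (mk_coimageMk_eq (q := someLevel p j) (q' := someLevel p j') a).symm

lemma app_indCoimageMk (q : IndObj.Level p) : IndObj.app (indCoimageMk p) q.src =
    IndObj.HomTo.mk (Y := indCoimage p) q (BanMod.coimageMk q.hom) := by
  refine (mk_coimageMk_eq (q := someLevel p q.src) (q' := q) (𝟙 q.src)).trans ?_
  exact congrArg (IndObj.HomTo.mk _) ((congrArg (· ≫ _) (Y.diag.map_id _)).trans
    (Category.id_comp _))

variable (p) in
/-- The map from the coimage to the target. -/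
def indCoimageDesc : indCoimage p ⟶ Z :=
  IndObj.levelHom (X := indCoimage p) (fun q => q.tgt) (fun a => a.tgt)
    (fun q => BanMod.quotLift q.hom le_rfl) fun {q q'} a => BanMod.quot_ext (by
      have h := a.comm
      refine (Category.assoc _ _ _).symm.trans ?_
      refine (congrArg (· ≫ _) (coimageMk_coimageMap a)).trans ?_
      refine (Category.assoc _ _ _).trans ?_
      refine (congrArg (_ ≫ ·) (BanMod.quotMk_quotLift _ _)).trans ?_
      refine h.trans ?_
      exact (congrArg (· ≫ _) (BanMod.quotMk_quotLift _ _).symm).trans (Category.assoc _ _ _))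

lemma indCoimageMk_desc : indCoimageMk p ≫ indCoimageDesc p = p := IndObj.hom_ext fun j => by
  refine (IndObj.app_comp_of_eq (indCoimageMk p) (indCoimageDesc p)
    (app_indCoimageMk (someLevel p j))).trans ?_
  refine Eq.trans ?_ (someLevel p j).eq.symm
  exact congrArg (IndObj.HomTo.mk _) (BanMod.quotMk_quotLift _ _)

/-- A representative of `i ≫ p` vanishes after moving its target. The moved representative of `p` is
again an index of the coimage, and its kernel contains the image of `f`. -/
lemma comp_indCoimageMk (h : i ≫ p = 0) : i ≫ indCoimageMk p = 0 := IndObj.hom_ext fun j => by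
  obtain ⟨k, f, hf⟩ := (IndObj.app i j).exists_mk
  let q := someLevel p k
  have h1 : IndObj.HomTo.mk q.tgt (f ≫ q.hom) = IndObj.HomTo.mk q.tgt 0 := by
    rw [← IndObj.app_zero (X := X) (Y := Z) j q.tgt, ← h, IndObj.app_comp_of_eq _ _ hf]
    exact (congrArg (IndObj.HomTo.pre f) q.eq).symm
  obtain ⟨l, b, hb⟩ := IndObj.HomTo.mk_eq_mk_same.1 h1
  rw [IndObj.app_comp_of_eq _ _ hf, IndObj.app_zero j (IndObj.Level.move q.eq b)]
  refine (congrArg (IndObj.HomTo.pre f) (app_indCoimageMk (IndObj.Level.move q.eq b))).trans ?_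
  refine congrArg (IndObj.HomTo.mk _) (BanMod.hom_ext fun x => ?_)
  refine BanMod.quotMk_eq_zero.2 (LinearMap.mem_ker.2 ?_)
  exact (congrArg (fun k => BanMod.lin k x) hb).trans (map_zero (BanMod.lin (Z.diag.map b)))

/-- The kernels of representatives of `p` factor through the kernel of `p`. -/
lemma exists_kernelι_lift (h : IsKernelOf i p) (q : IndObj.Level p) :
    ∃ x : IndObj.HomTo (BanMod.kernel q.hom) X,
      IndObj.HomTo.post i x = IndObj.HomTo.mk q.src (BanMod.kernelι q.hom) := by
  let g : IndObj.const (BanMod.kernel q.hom) ⟶ Y :=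
    IndObj.homMk (fun _ => IndObj.HomTo.mk q.src (BanMod.kernelι q.hom)) fun _ =>
      congrArg (IndObj.HomTo.mk _) (Category.id_comp _)
  have hg : g ≫ p = 0 := IndObj.hom_ext fun s => by
    refine (congrArg (IndObj.HomTo.pre _) q.eq).trans ?_
    refine Eq.trans ?_ (IndObj.app_zero s q.tgt).symm
    exact congrArg (IndObj.HomTo.mk _) (BanMod.kernelι_comp q.hom)
  obtain ⟨k, hk⟩ := h.exists_lift g hg
  exact ⟨IndObj.app k ⟨⟨⟩⟩, congrArg (fun k : IndObj.const (BanMod.kernel q.hom) ⟶ Y =>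
    IndObj.app k ⟨⟨⟩⟩) hk⟩

end

/-! ### Exactness: descending maps along quotients of lattices. -/

section

variable {F : Type u} [NontriviallyNormedField F] [IsUltrametricDist F]
variable {π : PseudoUniformizer F}

/-- Elements of `π⁻ⁿ (V / N)°` lift to elements of some `π⁻ᵐ V°`. -/
lemma exists_lift_lattice (V : BanMod F) (N : Submodule F V) (h : IsClosed (N : Set V)) (n : ℕ) :
    ∃ (m : ℕ) (s : latticeObj π (BanMod.quot V N h) n → latticeObj π V m),
      ∀ y, BanMod.lin (BanMod.quotMk V N h) (coe (s y)) = coe y ∧ ‖s y‖ ≤ 2 * ‖y‖ := by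
  obtain ⟨c, hc⟩ := bounded_lattice π (BanMod.quot V N h) n
  obtain ⟨m, hm⟩ := exists_mem_lattice π V (2 * c)
  -- The quotient norm is an infimum, so the factor `2` leaves room to attain it up to `‖y‖` when `y
  -- ≠ 0`; zero is lifted to zero.
  have key (y : latticeObj π (BanMod.quot V N h) n) :
      ∃ v : V, BanMod.lin (BanMod.quotMk V N h) v = coe y ∧ ‖v‖ ≤ 2 * ‖y‖ := by
    rcases eq_or_ne y 0 with rfl | hy
    · exact ⟨0, (map_zero _).trans coe_zero.symm, by simp⟩
    · have hy : 0 < ‖y‖ := norm_pos_iff.2 hy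
      obtain ⟨v, hv, hv'⟩ := BanMod.exists_norm_quotMk (coe y) hy
      exact ⟨v, hv, hv'.le.trans (two_mul ‖y‖).ge⟩
  choose v hv hv' using key
  exact ⟨m, fun y => latMk (v y) (hm _ ((hv' y).trans (by gcongr; exact hc _ (coe_mem y)))),
    fun y => ⟨hv y, hv' y⟩⟩

/-- A map on `π⁻ᵐ V°` that vanishes on `N` descends along a bounded lift. -/
lemma exists_descend {V : BanMod F} {N : Submodule F V} {h : IsClosed (N : Set V)} {n m : ℕ}
    {s : latticeObj π (BanMod.quot V N h) n → latticeObj π V m}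
    (hs : ∀ y, BanMod.lin (BanMod.quotMk V N h) (coe (s y)) = coe y ∧ ‖s y‖ ≤ 2 * ‖y‖)
    {M : BanMod (unitBall F)} (γ : latticeObj π V m ⟶ M)
    (hγ : ∀ v, coe v ∈ N → BanMod.lin γ v = 0) :
    ∃ α : latticeObj π (BanMod.quot V N h) n ⟶ M, ∀ y, BanMod.lin α y = BanMod.lin γ (s y) := by
  -- The lift `s` is only a function; since `γ` vanishes on `N`, it does not see the failure of `s`
  -- to be linear.
  have hzero {v w : latticeObj π V m} (hvw : BanMod.lin (BanMod.quotMk V N h) (coe v) =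
      BanMod.lin (BanMod.quotMk V N h) (coe w)) : BanMod.lin γ v = BanMod.lin γ w := by
    rw [← sub_eq_zero, ← map_sub]
    refine hγ _ ((BanMod.quotMk_eq_zero (h := h)).1 ?_)
    exact (map_sub (BanMod.lin (BanMod.quotMk V N h)) _ _).trans (sub_eq_zero.2 hvw)
  obtain ⟨C, hC, hb⟩ := BanMod.exists_bound γ
  refine ⟨BanMod.ofLin
    { toFun := fun y => BanMod.lin γ (s y)
      map_add' := fun y z => by
        rw [← map_add]
        refine hzero ?_
        rw [(hs _).1, coe_add, coe_add, map_add, (hs _).1, (hs _).1]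
      map_smul' := fun r y => by
        rw [RingHom.id_apply, ← map_smul]
        refine hzero ?_
        rw [(hs _).1, coe_smul, coe_smul, map_smul, (hs _).1] } ⟨C * 2, fun y => ?_⟩, fun y => rfl⟩
  rw [mul_assoc]
  exact (hb _).trans (by gcongr; exact (hs y).2)

variable {X Y Z : IndObj (BanMod F)} {i : X ⟶ Y} {p : Y ⟶ Z}

lemma app_underlineMap_indCoimageMk (q : IndObj.Level p) {n m : ℕ}
    (h : ∀ v ∈ lattice π (Y.diag.obj q.src) n,
      BanMod.lin (BanMod.coimageMk q.hom) v ∈ lattice π (BanMod.coimage q.hom) m) :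
    IndObj.app (underlineMap π (indCoimageMk p)) ⟨q.src, n⟩ =
      IndObj.HomTo.mk (Y := underline π (indCoimage p)) ⟨q, m⟩
        (latticeMap (BanMod.coimageMk q.hom) h) :=
  app_underlineMap π (Y := indCoimage p) (indCoimageMk p) (app_indCoimageMk q) h

/-- A morphism out of the coimage is determined by its composite with the projection, also on the
level of lattices. -/
lemma underlineMap_indCoimageMk_cancel {M : IndObj (BanMod (unitBall F))}
    {u v : underline π (indCoimage p) ⟶ M}
    (h : underlineMap π (indCoimageMk p) ≫ u = underlineMap π (indCoimageMk p) ≫ v) : u = v := by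
  refine IndObj.hom_ext fun ⟨q, n⟩ => ?_
  -- The projection need not be onto at a fixed lattice index, but every vector of the `n`-th
  -- lattice of the quotient comes from the `m`-th lattice of `Y`, where `u` and `v` can be
  -- compared.
  obtain ⟨m, s, hs⟩ := exists_lift_lattice (π := π) _ _ (BanMod.isClosed_ker q.hom) n
  obtain ⟨k, hk⟩ := exists_map_lattice π (BanMod.coimageMk q.hom) m
  have hk' : ∀ v ∈ lattice π (Y.diag.obj q.src) m,
      BanMod.lin (BanMod.coimageMk q.hom) v ∈ lattice π (BanMod.coimage q.hom) (max n k) :=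
    fun v hv => lattice_mono π _ (le_max_right _ _) (hk v hv)
  have h1 (w : underline π (indCoimage p) ⟶ M) :
      IndObj.app (underlineMap π (indCoimageMk p) ≫ w) ⟨q.src, m⟩ =
      IndObj.HomTo.pre (latticeMap (BanMod.coimageMk q.hom) hk') (IndObj.app w ⟨q, max n k⟩) :=
    IndObj.app_comp_of_eq _ w (app_underlineMap_indCoimageMk q hk')
  obtain ⟨l, f, g, hf, hg⟩ := IndObj.HomTo.exists_common (IndObj.app u ⟨q, max n k⟩)
    (IndObj.app v ⟨q, max n k⟩)
  have h2 := (h1 u).symm.trans ((congrArg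
    (fun k : underline π Y ⟶ M => IndObj.app k ⟨q.src, m⟩) h).trans (h1 v))
  rw [hf, hg] at h2
  obtain ⟨l', a, ha⟩ := IndObj.HomTo.mk_eq_mk_same.1 h2
  have hn : ∀ v ∈ lattice π (BanMod.coimage q.hom) n,
      BanMod.lin ((indCoimage p).diag.map (𝟙 q)) v ∈ lattice π (BanMod.coimage q.hom) (max n k) :=
    fun v hv => by
      rw [(indCoimage p).diag.map_id]
      exact lattice_mono π _ (le_max_left _ _) hv
  have h3 (w : underline π (indCoimage p) ⟶ M) : IndObj.app w ⟨q, n⟩ =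
      IndObj.HomTo.pre (latticeMap ((indCoimage p).diag.map (𝟙 q)) hn)
        (IndObj.app w ⟨q, max n k⟩) :=
    (IndObj.pre_app w (i := ⟨q, n⟩) (i' := ⟨q, max n k⟩) ⟨𝟙 q, hn⟩).symm
  rw [h3 u, h3 v, hf, hg]
  refine IndObj.HomTo.mk_eq_mk_same.2 ⟨l', a, BanMod.hom_ext fun y => ?_⟩
  have h4 := congrArg (fun k => BanMod.lin k (s y)) ha
  have h5 : BanMod.lin (latticeMap (BanMod.coimageMk q.hom) hk') (s y) =
      BanMod.lin (latticeMap ((indCoimage p).diag.map (𝟙 q)) hn) y := coe_injective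
    ((hs y).1.trans (congrArg (fun k => BanMod.lin k (coe y)) ((indCoimage p).diag.map_id q)).symm)
  have h6 := congrArg (fun z => BanMod.lin (M.diag.map a) (BanMod.lin f z)) h5
  have h7 := congrArg (fun z => BanMod.lin (M.diag.map a) (BanMod.lin g z)) h5
  exact h6.symm.trans (h4.trans h7)

section

variable {M : IndObj (BanMod (unitBall F))} {g : underline π Y ⟶ M}

/-- A morphism that vanishes on the kernel of `p` is represented by maps that vanish on kernels of
representatives of `p`. -/
lemma exists_vanishing (h : IsKernelOf i p) (hg : underlineMap π i ≫ g = 0)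
    (q : IndObj.Level p) (m : ℕ) :
    ∃ (l : M.J) (γ : latticeObj π (Y.diag.obj q.src) m ⟶ M.diag.obj l),
      IndObj.app g ⟨q.src, m⟩ = IndObj.HomTo.mk l γ ∧
        ∀ v, BanMod.lin q.hom (coe v) = 0 → BanMod.lin γ v = 0 := by
  obtain ⟨x, hx⟩ := exists_kernelι_lift h q
  obtain ⟨l, γ, hγ⟩ := (IndObj.app g ⟨q.src, m⟩).exists_mk
  have hm : ∀ v ∈ lattice π (BanMod.kernel q.hom) m,
      BanMod.lin (BanMod.kernelι q.hom) v ∈ lattice π (Y.diag.obj q.src) m := fun v hv => hv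
  -- The inclusion of the kernel of `q.hom` factors through `X`, and `g` vanishes on `X̲`; so `g` is
  -- zero on the lattice of this kernel, as a class.
  have h1 : IndObj.HomTo.pre (latticeMap (BanMod.kernelι q.hom) hm)
      (IndObj.app g ⟨q.src, m⟩) = IndObj.HomTo.mk l 0 := by
    have h2 : IndObj.HomTo.post g (homToRestrict m (IndObj.HomTo.post i x)) =
        IndObj.HomTo.pre (latticeMap (BanMod.kernelι q.hom) hm) (IndObj.app g ⟨q.src, m⟩) := by
      rw [hx, homToRestrict_mk _ hm]
      rfl
    rw [← h2, homToRestrict_post]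
    obtain ⟨r, b, hb⟩ := (homToRestrict (π := π) m x).exists_mk
    rw [hb]
    refine (IndObj.HomTo.pre_post (Y := underline π Y) (Z := M) b g
      (IndObj.app (underlineMap π i) r)).symm.trans ?_
    refine (congrArg (fun k => IndObj.HomTo.pre b (IndObj.app k r)) hg).trans ?_
    refine (congrArg (IndObj.HomTo.pre b) (IndObj.app_zero r l)).trans ?_
    exact congrArg (IndObj.HomTo.mk l) Limits.comp_zero
  rw [hγ] at h1
  -- One transition map of `M` turns vanishing of the class into vanishing of the representative on
  -- the whole kernel lattice.
  obtain ⟨l', a, ha⟩ := IndObj.HomTo.mk_eq_mk_same.1 h1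
  refine ⟨l', γ ≫ M.diag.map a, hγ.trans (IndObj.HomTo.mk_map _ _).symm, fun v hv => ?_⟩
  let w : latticeObj π (BanMod.kernel q.hom) m := latMk ⟨coe v, LinearMap.mem_ker.2 hv⟩ (coe_mem v)
  have h3 := congrArg (fun k => BanMod.lin k w) ha
  exact h3.trans (map_zero (BanMod.lin (M.diag.map a)))

/-- Representatives of `g` agree on elements of `Y` whose difference lies in the kernel of a
representative of `p`. -/
lemma exists_agree (h : IsKernelOf i p) (hg : underlineMap π i ≫ g = 0)
    {q q' : IndObj.Level p} (u : q.src ⟶ q'.src) {m m' : ℕ} {A : Type*}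
    (s : A → latticeObj π (Y.diag.obj q.src) m) (s' : A → latticeObj π (Y.diag.obj q'.src) m')
    (hs : ∀ x, BanMod.lin q'.hom (BanMod.lin (Y.diag.map u) (coe (s x))) =
      BanMod.lin q'.hom (coe (s' x)))
    {l l' : M.J} {γ : latticeObj π (Y.diag.obj q.src) m ⟶ M.diag.obj l}
    {γ' : latticeObj π (Y.diag.obj q'.src) m' ⟶ M.diag.obj l'}
    (hγ : IndObj.app g ⟨q.src, m⟩ = IndObj.HomTo.mk l γ)
    (hγ' : IndObj.app g ⟨q'.src, m'⟩ = IndObj.HomTo.mk l' γ') :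
    ∃ (k : M.J) (a : l ⟶ k) (b : l' ⟶ k), ∀ x, BanMod.lin (M.diag.map a) (BanMod.lin γ (s x)) =
      BanMod.lin (M.diag.map b) (BanMod.lin γ' (s' x)) := by
  obtain ⟨e, he⟩ := exists_map_lattice π (Y.diag.map u) m
  have he1 : ∀ v ∈ lattice π (Y.diag.obj q.src) m,
      BanMod.lin (Y.diag.map u) v ∈ lattice π (Y.diag.obj q'.src) (max e m') :=
    fun v hv => lattice_mono π _ (le_max_left _ _) (he v hv)
  have he2 : ∀ v ∈ lattice π (Y.diag.obj q'.src) m',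
      BanMod.lin (Y.diag.map (𝟙 q'.src)) v ∈ lattice π (Y.diag.obj q'.src) (max e m') :=
    fun v hv => by
      rw [Y.diag.map_id]
      exact lattice_mono π _ (le_max_right _ _) hv
  -- Both representatives are compared with `δ` on a common lattice. The transported vectors differ
  -- by an element of the kernel of `q'.hom`, on which `δ` vanishes.
  obtain ⟨t, δ, hδ, hker⟩ := exists_vanishing h hg q' (max e m')
  have h1 := IndObj.pre_app g (i := ⟨q.src, m⟩) (i' := ⟨q'.src, max e m'⟩) ⟨u, he1⟩
  have h2 := IndObj.pre_app g (i := ⟨q'.src, m'⟩) (i' := ⟨q'.src, max e m'⟩) ⟨𝟙 q'.src, he2⟩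
  rw [hδ] at h1 h2
  obtain ⟨k, a, b, hab⟩ := IndObj.HomTo.mk_eq_mk.1 (h1.trans hγ)
  obtain ⟨k', a', b', hab'⟩ := IndObj.HomTo.mk_eq_mk.1 (h2.trans hγ')
  obtain ⟨r, c, c', hc⟩ := IsFiltered.span a a'
  refine ⟨r, b ≫ c, b' ≫ c', fun x => ?_⟩
  let y := BanMod.lin (latticeMap (Y.diag.map u) he1) (s x)
  let y' := BanMod.lin (latticeMap (Y.diag.map (𝟙 q'.src)) he2) (s' x)
  have h3 : BanMod.lin (M.diag.map b) (BanMod.lin γ (s x)) =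
      BanMod.lin (M.diag.map a) (BanMod.lin δ y) := congrArg (fun k => BanMod.lin k (s x)) hab.symm
  have h4 : BanMod.lin (M.diag.map b') (BanMod.lin γ' (s' x)) =
      BanMod.lin (M.diag.map a') (BanMod.lin δ y') :=
    congrArg (fun k => BanMod.lin k (s' x)) hab'.symm
  have h5 : BanMod.lin δ y = BanMod.lin δ y' := by
    rw [← sub_eq_zero, ← map_sub]
    refine hker _ ((map_sub (BanMod.lin q'.hom) (coe y) (coe y')).trans (sub_eq_zero.2 ?_))
    refine (hs x).trans (congrArg (BanMod.lin q'.hom) ?_)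
    exact (congrArg (fun k => BanMod.lin k (coe (s' x))) (Y.diag.map_id q'.src)).symm
  have h6 (z : M.diag.obj t) : BanMod.lin (M.diag.map c) (BanMod.lin (M.diag.map a) z) =
      BanMod.lin (M.diag.map c') (BanMod.lin (M.diag.map a') z) := by
    have h := congrArg (fun k => BanMod.lin (M.diag.map k) z) hc
    simp only [M.diag.map_comp] at h
    exact h
  rw [M.diag.map_comp, M.diag.map_comp, BanMod.lin_comp, BanMod.lin_comp, h3, h4, h5]
  exact h6 _

/-- A morphism that vanishes on the kernel of `p` factors through the coimage of `p`, also on the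
level of lattices. -/
lemma exists_factor_indCoimage (h : IsKernelOf i p) (hg : underlineMap π i ≫ g = 0) :
    ∃ g' : underline π (indCoimage p) ⟶ M, underlineMap π (indCoimageMk p) ≫ g' = g := by
  -- On each lattice of the coimage, the map `α` is computed by lifting to `Y` and applying a
  -- representative of `g` that vanishes on the kernel.
  have key (r : (underline π (indCoimage p)).J) : ∃ (m : ℕ)
      (s : latticeObj π (BanMod.coimage r.fst.hom) r.snd →
        latticeObj π (Y.diag.obj r.fst.src) m)
      (l : M.J) (γ : latticeObj π (Y.diag.obj r.fst.src) m ⟶ M.diag.obj l)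
      (α : latticeObj π (BanMod.coimage r.fst.hom) r.snd ⟶ M.diag.obj l),
      IndObj.app g ⟨r.fst.src, m⟩ = IndObj.HomTo.mk l γ ∧
      (∀ y, BanMod.lin (BanMod.coimageMk r.fst.hom) (coe (s y)) = coe y) ∧
      ∀ y, BanMod.lin α y = BanMod.lin γ (s y) := by
    obtain ⟨q, n⟩ := r
    obtain ⟨m, s, hs⟩ := exists_lift_lattice (π := π) _ _ (BanMod.isClosed_ker q.hom) n
    obtain ⟨l, γ, hγ, hker⟩ := exists_vanishing h hg q m
    obtain ⟨α, hα⟩ := exists_descend hs γ hker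
    exact ⟨m, s, l, γ, α, hγ, fun y => (hs y).1, hα⟩
  choose m s l γ α hγ hs hα using key
  have hq (q : IndObj.Level p) {v w : Y.diag.obj q.src}
      (h : BanMod.lin (BanMod.coimageMk q.hom) v = BanMod.lin (BanMod.coimageMk q.hom) w) :
      BanMod.lin q.hom v = BanMod.lin q.hom w := by
    rw [← BanMod.quotMk_quotLift (h := BanMod.isClosed_ker q.hom) q.hom le_rfl,
      BanMod.lin_comp, BanMod.lin_comp, h]
  refine ⟨IndObj.homMk (X := underline π (indCoimage p)) (fun r => IndObj.HomTo.mk (l r) (α r)) ?_,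
    IndObj.hom_ext ?_⟩
  · intro r r' u
    obtain ⟨k, a, b, hk⟩ := exists_agree h hg u.1.src (s r)
      (fun y => s r' (BanMod.lin ((underline π (indCoimage p)).diag.map u) y)) (fun y => by
        refine hq r'.fst ?_
        refine Eq.trans ?_ (hs r' _).symm
        refine (congrArg (fun k => BanMod.lin k (coe (s r y))) (coimageMk_coimageMap u.1)).symm.trans ?_
        exact congrArg (BanMod.lin (coimageMap u.1)) (hs r y)) (hγ r) (hγ r')
    refine IndObj.HomTo.mk_eq_mk.2 ⟨k, b, a, BanMod.hom_ext fun y => ?_⟩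
    refine (congrArg (BanMod.lin (M.diag.map b)) (hα r' _)).trans ((hk y).symm.trans ?_)
    exact (congrArg (BanMod.lin (M.diag.map a)) (hα r y)).symm
  · rintro ⟨j, n⟩
    let q := someLevel p j
    obtain ⟨t, ht⟩ := exists_map_lattice π (BanMod.coimageMk q.hom) n
    obtain ⟨d, δ, hδ⟩ := (IndObj.app g ⟨j, n⟩).exists_mk
    -- A vector of `Y` is compared with the chosen lift of its class in the coimage; the two have
    -- the same image under `q.hom`.
    obtain ⟨k, a, b, hk⟩ := exists_agree h hg (q := q) (q' := q) (𝟙 j) (fun y => y)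
      (fun y => s ⟨q, t⟩ (BanMod.lin (latticeMap (BanMod.coimageMk q.hom) ht) y)) (fun y => by
        refine hq q ?_
        refine Eq.trans ?_ (hs ⟨q, t⟩ _).symm
        exact congrArg (fun k => BanMod.lin (BanMod.coimageMk q.hom) (BanMod.lin k (coe y)))
          (Y.diag.map_id j)) hδ (hγ ⟨q, t⟩)
    refine (IndObj.app_comp_of_eq _ _ (app_underlineMap_indCoimageMk q ht)).trans ?_
    refine Eq.trans ?_ hδ.symm
    refine IndObj.HomTo.mk_eq_mk.2 ⟨k, b, a, BanMod.hom_ext fun y => ?_⟩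
    exact (congrArg (BanMod.lin (M.diag.map b)) (hα ⟨q, t⟩ _)).trans (hk y).symm

end

/-- The functor `V ↦ V̲` preserves the cokernels in strictly short exact sequences. -/
lemma existsUnique_of_isStrictShortExact (h : IsStrictShortExact i p)
    {M : IndObj (BanMod (unitBall F))} (g : underline π Y ⟶ M) (hg : underlineMap π i ≫ g = 0) :
    ∃! k, underlineMap π p ≫ k = g := by
  obtain ⟨hi, hp⟩ := h
  have := hp.epi
  -- The projection to the coimage kills `i`, so it factors through the cokernel `p`. The resulting
  -- `r` is split by `indCoimageDesc p`, which transfers the factorization from the coimage to `Z`.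
  obtain ⟨r, hr, -⟩ := hp.existsUnique (indCoimageMk p) (comp_indCoimageMk hi.1)
  have hmap {A B D : IndObj (BanMod F)} (a : A ⟶ B) (b : B ⟶ D) :
      underlineMap π (a ≫ b) = underlineMap π a ≫ underlineMap π b :=
    (underlineFunctor π).map_comp a b
  have hrs : r ≫ indCoimageDesc p = 𝟙 Z := by
    rw [← cancel_epi p, reassoc_of% hr, indCoimageMk_desc, Category.comp_id]
  obtain ⟨g', hg'⟩ := exists_factor_indCoimage hi hg
  refine ⟨underlineMap π r ≫ g', ?_, fun k hk => ?_⟩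
  · change underlineMap π p ≫ underlineMap π r ≫ g' = g
    rw [← Category.assoc, ← hmap, hr, hg']
  · have h1 : underlineMap π (indCoimageDesc p) ≫ k = g' := by
      refine underlineMap_indCoimageMk_cancel ?_
      rw [← Category.assoc, ← hmap, indCoimageMk_desc, hk, hg']
    rw [← h1, ← Category.assoc, ← hmap, hrs]
    exact ((congrArg (· ≫ k) ((underlineFunctor π).map_id Z)).trans (Category.id_comp k)).symm

variable [CompleteSpace F]

/-- The kernel half uses only the left adjoint. In the cokernel half, factorizations in ind-Banach
`F°`-modules are automatically `F̲`-linear. -/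
lemma isExact_toUnderline : IsExact (toUnderline F π) := by
  intro X Y Z i p h
  refine ⟨isStronglyLeftExact_of_isRightAdjoint (toUnderline F π) i p h.1, ?_⟩
  refine isCokernelOf_of_existsUnique ?_ fun {M} g hg => ?_
  · rw [← Functor.map_comp, h.1.1, Functor.map_zero]
  · obtain ⟨k, hk, huniq⟩ := existsUnique_of_isStrictShortExact (π := π) h g.hom
      (congrArg (fun k => k.hom) hg)
    exact ⟨RelTensor.mkHom (M := (toUnderline F π).obj Z) k, Mod.hom_ext _ _ hk,
      fun k' hk' => Mod.hom_ext _ _ (huniq k'.hom (congrArg (fun k => k.hom) hk'))⟩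

end

/-! ### Almost orthogonal complements in non-Archimedean normed spaces. -/

section Orthogonal

variable {F : Type*} [NontriviallyNormedField F] {U : Type*} [NormedAddCommGroup U]
  [IsUltrametricDist U] [NormedSpace F U]

/-- A vector can be changed by an element of a closed subspace so as to become almost orthogonal to
it. -/
lemma exists_almost_orthogonal (D : Submodule F U) (hD : IsClosed (D : Set U)) (w : U) {ρ : ℝ}
    (hρ : 1 < ρ) : ∃ y, w - y ∈ D ∧ ∀ d ∈ D, ∀ a : F, ‖d‖ ≤ ρ * ‖d + a • y‖ := by
  have hne : (D : Set U).Nonempty := ⟨0, zero_mem D⟩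
  rcases (Metric.infDist_nonneg (x := w) (s := (D : Set U))).eq_or_lt with h0 | h0
  · have hw : w ∈ D := (hD.mem_iff_infDist_zero hne).2 h0.symm
    refine ⟨0, by simpa using hw, fun d _ a => ?_⟩
    rw [smul_zero, add_zero]
    exact le_mul_of_one_le_left (norm_nonneg d) hρ.le
  · obtain ⟨d₀, hd₀, hlt⟩ := (Metric.infDist_lt_iff hne).1
      (lt_mul_of_one_lt_left h0 hρ)
    rw [dist_eq_norm] at hlt
    refine ⟨w - d₀, by simpa using hd₀, fun d hd a => ?_⟩
    rcases eq_or_ne a 0 with rfl | ha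
    · rw [zero_smul, add_zero]
      exact le_mul_of_one_le_left (norm_nonneg d) hρ.le
    -- The sum is `a` times the difference of `w` and an element of `D`, so its norm is at least
    -- `‖a‖` times the distance. The ultrametric inequality then bounds `d` as well.
    have h1 : ‖a • (w - d₀)‖ ≤ ρ * ‖d + a • (w - d₀)‖ := by
      have h2 : Metric.infDist w D ≤ ‖w - (d₀ - a⁻¹ • d)‖ := by
        rw [← dist_eq_norm]
        exact Metric.infDist_le_dist_of_mem (sub_mem hd₀ (D.smul_mem _ hd))
      have h3 : d + a • (w - d₀) = a • (w - (d₀ - a⁻¹ • d)) := by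
        rw [sub_sub_eq_add_sub, add_sub_right_comm, smul_add, smul_inv_smul₀ ha, add_comm]
      rw [h3, norm_smul, norm_smul, mul_left_comm]
      gcongr
      exact hlt.le.trans (by gcongr)
    calc ‖d‖ = ‖(d + a • (w - d₀)) - a • (w - d₀)‖ := by rw [add_sub_cancel_right]
      _ ≤ max ‖d + a • (w - d₀)‖ ‖a • (w - d₀)‖ := by
        rw [sub_eq_add_neg]
        exact (IsUltrametricDist.norm_add_le_max _ _).trans_eq (by rw [norm_neg])
      _ ≤ _ := max_le (le_mul_of_one_le_left (norm_nonneg _) hρ.le) h1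

variable [CompleteSpace F]

/-- Complements that are almost orthogonal to a finite-dimensional subspace. -/
lemma exists_almost_orthogonal_complement (E : Submodule F U) [FiniteDimensional F E] (u : ℕ → U) :
    ∃ Y : Submodule F U, (∀ n, u n ∈ E ⊔ Y) ∧ ∀ e ∈ E, ∀ y ∈ Y, ‖e‖ ≤ 2 * ‖e + y‖ := by
  let D (n : ℕ) : Submodule F U := E ⊔ Submodule.span F (u '' Set.Iio n)
  have hfin (n : ℕ) : FiniteDimensional F (D n) := by
    have := FiniteDimensional.span_of_finite F ((Set.finite_Iio n).image u)
    infer_instance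
  -- These constants increase from `1` and stay below `2`. Step `n` may lose the factor `M (n + 1) /
  -- M n > 1`, and the losses telescope.
  let M (n : ℕ) : ℝ := 2 - (1 / 2) ^ n
  have hM (n : ℕ) : 1 ≤ M n := by
    have : (1 / 2 : ℝ) ^ n ≤ 1 := pow_le_one₀ (by norm_num) (by norm_num)
    change 1 ≤ 2 - (1 / 2 : ℝ) ^ n
    linarith
  have hM0 (n : ℕ) : 0 < M n := zero_lt_one.trans_le (hM n)
  have hρ (n : ℕ) : 1 < M (n + 1) / M n := by
    rw [one_lt_div (hM0 n)]
    have : (0 : ℝ) < (1 / 2) ^ n := by positivity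
    change 2 - (1 / 2 : ℝ) ^ n < 2 - (1 / 2 : ℝ) ^ (n + 1)
    rw [pow_succ]
    linarith
  choose y hy hyd using fun n =>
    exists_almost_orthogonal (D n) (Submodule.closed_of_finiteDimensional _) (u n) (hρ n)
  let Yn (n : ℕ) : Submodule F U := Submodule.span F (y '' Set.Iio n)
  have hsucc (z : ℕ → U) (n : ℕ) : Submodule.span F (z '' Set.Iio (n + 1)) =
      Submodule.span F (z '' Set.Iio n) ⊔ Submodule.span F {z n} := by
    rw [← Submodule.span_union, ← Set.image_singleton, ← Set.image_union]
    congr 2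
    ext k
    simp
  -- Each `y n` differs from `u n` by an element of `D n`, so the exchange does not change the span
  -- together with `E`.
  have hDY (n : ℕ) : D n = E ⊔ Yn n := by
    induction n with
    | zero => simp [D, Yn]
    | succ n ih =>
      have h1 : D (n + 1) = D n ⊔ Submodule.span F {u n} := by
        change E ⊔ _ = (E ⊔ _) ⊔ _
        rw [hsucc, sup_assoc]
      have h2 : E ⊔ Yn (n + 1) = D n ⊔ Submodule.span F {y n} := by
        rw [ih]
        change E ⊔ Submodule.span F (y '' Set.Iio (n + 1)) = _
        rw [hsucc, sup_assoc]
      rw [h1, h2]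
      refine le_antisymm (sup_le le_sup_left ?_) (sup_le le_sup_left ?_)
      · rw [Submodule.span_singleton_le_iff_mem, ← sub_add_cancel (u n) (y n)]
        exact add_mem (le_sup_left (a := D n) (hy n))
          (le_sup_right (a := D n) (Submodule.mem_span_singleton_self _))
      · rw [Submodule.span_singleton_le_iff_mem, ← sub_sub_cancel (u n) (y n)]
        exact sub_mem (le_sup_right (a := D n) (Submodule.mem_span_singleton_self _))
          (le_sup_left (a := D n) (hy n))
  have hbound (n : ℕ) : ∀ e ∈ E, ∀ z ∈ Yn n, ‖e‖ ≤ M n * ‖e + z‖ := by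
    induction n with
    | zero =>
      intro e _ z hz
      have : z = 0 := by simpa [Yn] using hz
      rw [this, add_zero]
      exact le_mul_of_one_le_left (norm_nonneg e) (hM 0)
    | succ n ih =>
      intro e he z hz
      obtain ⟨z', hz', z'', hz'', rfl⟩ := Submodule.mem_sup.1 ((hsucc y n).le hz)
      obtain ⟨a, rfl⟩ := Submodule.mem_span_singleton.1 hz''
      have h1 := hyd n (e + z') ((hDY n).ge (add_mem (Submodule.mem_sup_left he)
        (Submodule.mem_sup_right hz'))) a
      calc ‖e‖ ≤ M n * ‖e + z'‖ := ih e he z' hz'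
        _ ≤ M n * (M (n + 1) / M n * ‖e + z' + a • y n‖) := by
          have := (hM0 n).le
          gcongr
        _ = M (n + 1) * ‖e + (z' + a • y n)‖ := by
          rw [← mul_assoc, mul_div_cancel₀ _ (hM0 n).ne', add_assoc]
  refine ⟨⨆ n, Yn n, fun n => ?_, fun e he z hz => ?_⟩
  · have h1 : u n ∈ D (n + 1) :=
      Submodule.mem_sup_right (Submodule.subset_span ⟨n, Nat.lt_succ_self n, rfl⟩)
    rw [hDY] at h1
    exact sup_le_sup_left (le_iSup Yn (n + 1)) E h1
  · have hmono : Monotone Yn := fun a b hab =>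
      Submodule.span_mono (Set.image_mono (Set.Iio_subset_Iio hab))
    obtain ⟨n, hn⟩ := (Submodule.mem_iSup_of_directed Yn hmono.directed_le).1 hz
    refine (hbound n e he z hn).trans ?_
    gcongr
    exact sub_le_self 2 (by positivity)

/-- A finite-dimensional subspace of a space of countable type is the image of a projection of norm
at most two. -/
lemma exists_projection (E : Submodule F U) [FiniteDimensional F E] (u : ℕ → U)
    (hu : Dense (Submodule.span F (Set.range u) : Set U)) :
    ∃ T : U →L[F] E, (∀ e : E, T e = e) ∧ ∀ w, ‖T w‖ ≤ 2 * ‖w‖ := by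
  obtain ⟨Y, hY, hb⟩ := exists_almost_orthogonal_complement E u
  -- The orthogonality estimate with `y = -e` shows that `E` meets `Y` only in zero, so there is an
  -- algebraic projection of `E + Y` to `E` along `Y`.
  have hdisj : LinearMap.ker (Y.mkQ ∘ₗ E.subtype) = ⊥ := by
    refine LinearMap.ker_eq_bot'.2 fun e he => ?_
    have h1 : (e : U) ∈ Y := (Submodule.Quotient.mk_eq_zero Y).1 he
    have h2 := hb e e.2 (-e) (neg_mem h1)
    rw [add_neg_cancel, norm_zero, mul_zero] at h2
    exact Subtype.ext (norm_le_zero_iff.1 h2)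
  obtain ⟨g, hg⟩ := LinearMap.exists_leftInverse_of_injective _ hdisj
  have hgE (e : E) : g (Y.mkQ e) = e := LinearMap.congr_fun hg e
  let D : Submodule F U := E ⊔ Y
  let P : D →ₗ[F] E := (g ∘ₗ Y.mkQ) ∘ₗ D.subtype
  have hP (d : D) : ‖P d‖ ≤ 2 * ‖D.subtype d‖ := by
    obtain ⟨d, hd⟩ := d
    obtain ⟨e, he, y, hy, rfl⟩ := Submodule.mem_sup.1 hd
    have h1 : Y.mkQ (e + y) = Y.mkQ e := by
      have h0 : Y.mkQ y = 0 := (Submodule.Quotient.mk_eq_zero Y).2 hy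
      rw [map_add, h0, add_zero]
    have h2 : P ⟨e + y, hd⟩ = ⟨e, he⟩ := by
      change g (Y.mkQ (e + y)) = _
      rw [h1]
      exact hgE ⟨e, he⟩
    rw [h2]
    exact hb e he y hy
  -- `E + Y` contains all `u n`, so the projection, bounded by `2`, extends to `U`.
  have hdense : DenseRange D.subtype := by
    have : Set.range D.subtype = D := Subtype.range_coe
    rw [DenseRange, this]
    refine hu.mono (Submodule.span_le.2 ?_)
    rintro _ ⟨n, rfl⟩
    exact hY n
  have := FiniteDimensional.complete F E
  refine ⟨P.extendOfNorm D.subtype, fun e => ?_,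
    LinearMap.norm_extendOfNorm_apply_le hdense 2 hP⟩
  have he : (e : U) ∈ D := Submodule.mem_sup_left e.2
  exact (LinearMap.extendOfNorm_eq hdense ⟨2, hP⟩ ⟨e, he⟩).trans (hgE e)

end Orthogonal

/-! ### Homogeneous norms and finite-rank projections on Banach spaces of countable type. -/

section

variable {F : Type u} [NontriviallyNormedField F]

/-- A Banach space over `F`, to be equipped with an equivalent homogeneous norm. -/
def Homog (W : BanMod F) : Type u := W

namespace Homog

variable (W : BanMod F)

instance : AddCommGroup (Homog W) := inferInstanceAs (AddCommGroup W)
instance : Module F (Homog W) := inferInstanceAs (Module F W)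

/-- The identity map to the space with homogeneous norm. -/
def equiv : W ≃ₗ[F] Homog W := LinearEquiv.refl F W

/-- The norm `sup ‖r • w‖ / ‖r‖`. -/
def hnorm (w : Homog W) : ℝ := ⨆ r : {r : F // r ≠ 0}, ‖r.1 • (equiv W).symm w‖ / ‖r.1‖

instance : Nonempty {r : F // r ≠ 0} := ⟨⟨1, one_ne_zero⟩⟩

variable {W}

/-- The norm of a Banach module is homogeneous only up to a constant. This bound makes the defining
supremum finite and the new norm equivalent to the old one. -/
lemma exists_hnorm_le : ∃ C : ℝ, 0 ≤ C ∧ ∀ (w : Homog W) (r : {r : F // r ≠ 0}),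
    ‖r.1 • (equiv W).symm w‖ / ‖r.1‖ ≤ C * ‖(equiv W).symm w‖ := by
  obtain ⟨C, hC, h⟩ := W.exists_smul_bound
  refine ⟨C, hC, fun w r => ?_⟩
  rw [div_le_iff₀ (norm_pos_iff.2 r.2), mul_right_comm]
  exact h _ _

lemma bddAbove (w : Homog W) :
    BddAbove (Set.range fun r : {r : F // r ≠ 0} => ‖r.1 • (equiv W).symm w‖ / ‖r.1‖) := by
  obtain ⟨C, -, h⟩ := exists_hnorm_le (W := W)
  refine ⟨C * ‖(equiv W).symm w‖, ?_⟩
  rintro _ ⟨r, rfl⟩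
  exact h w r

lemma le_hnorm (w : Homog W) (r : F) (hr : r ≠ 0) :
    ‖r • (equiv W).symm w‖ / ‖r‖ ≤ hnorm W w := le_ciSup (bddAbove w) ⟨r, hr⟩

lemma norm_le_hnorm (w : Homog W) : ‖(equiv W).symm w‖ ≤ hnorm W w := by
  simpa using le_hnorm w 1 one_ne_zero

lemma hnorm_add_le (v w : Homog W) : hnorm W (v + w) ≤ max (hnorm W v) (hnorm W w) := by
  refine ciSup_le fun r => ?_
  have hr : 0 < ‖r.1‖ := norm_pos_iff.2 r.2
  rw [map_add, smul_add]
  refine (div_le_div_of_nonneg_right (IsUltrametricDist.norm_add_le_max _ _) hr.le).trans ?_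
  rw [← max_div_div_right hr.le]
  exact max_le_max (le_hnorm v r.1 r.2) (le_hnorm w r.1 r.2)

lemma hnorm_nonneg (w : Homog W) : 0 ≤ hnorm W w := (norm_nonneg _).trans (norm_le_hnorm w)

lemma hnorm_smul_le (a : F) (w : Homog W) : hnorm W (a • w) ≤ ‖a‖ * hnorm W w := by
  refine ciSup_le fun r => ?_
  have hr : 0 < ‖r.1‖ := norm_pos_iff.2 r.2
  rcases eq_or_ne a 0 with rfl | ha
  · simp
  have h := le_hnorm w (r.1 * a) (mul_ne_zero r.2 ha)
  rw [norm_mul, div_le_iff₀ (mul_pos hr (norm_pos_iff.2 ha))] at h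
  rw [map_smul, smul_smul, div_le_iff₀ hr]
  exact h.trans_eq (by ring)

variable (W) in
/-- The homogeneous norm as a norm of groups. -/
def groupNorm : AddGroupNorm (Homog W) where
  toFun := hnorm W
  map_zero' := by simp [hnorm]
  add_le' v w := (hnorm_add_le v w).trans (max_le_add_of_nonneg (hnorm_nonneg v) (hnorm_nonneg w))
  neg' w := by simp [hnorm]
  eq_zero_of_map_eq_zero' w h := (equiv W).symm.map_eq_zero_iff.1
    (norm_le_zero_iff.1 ((norm_le_hnorm w).trans h.le))

instance : NormedAddCommGroup (Homog W) := (groupNorm W).toNormedAddCommGroup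

instance : NormedSpace F (Homog W) where
  norm_smul_le := hnorm_smul_le

instance : IsUltrametricDist (Homog W) :=
  IsUltrametricDist.isUltrametricDist_of_forall_norm_add_le_max_norm hnorm_add_le

lemma exists_norm_equiv_le (W : BanMod F) : ∃ C : ℝ, 0 ≤ C ∧ ∀ w : W, ‖equiv W w‖ ≤ C * ‖w‖ := by
  obtain ⟨C, hC, h⟩ := exists_hnorm_le (W := W)
  exact ⟨C, hC, fun w => ciSup_le (h (equiv W w))⟩

lemma norm_le (w : W) : ‖w‖ ≤ ‖equiv W w‖ := norm_le_hnorm (equiv W w)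

end Homog

variable [IsUltrametricDist F] [CompleteSpace F]

/-- Finite-dimensional subspaces of a Banach space of countable type are images of uniformly bounded
projections of finite rank. -/
lemma exists_projection_sum (W : BanMod F) (u : ℕ → W)
    (hu : Dense (Submodule.span F (Set.range u) : Set W)) :
    ∃ K : ℝ, 0 ≤ K ∧ ∀ (E : Submodule F W) [FiniteDimensional F E],
      ∃ (n : ℕ) (l : Fin n → (W ⟶ BanMod.unit F)) (b : Fin n → W),
        (∀ e ∈ E, ∑ j, (show F from BanMod.lin (l j) e) • b j = e) ∧
        ∀ w, ‖∑ j, (show F from BanMod.lin (l j) w) • b j‖ ≤ K * ‖w‖ := by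
  obtain ⟨C, hC, hle⟩ := Homog.exists_norm_equiv_le W
  -- The factor `2` comes from the projection and `C` from passing to the homogeneous norm; passing
  -- back costs nothing by `Homog.norm_le`.
  refine ⟨2 * C, by positivity, fun E _ => ?_⟩
  let e := Homog.equiv W
  have hcont : Continuous e := BanMod.continuous_of_bound e.toLinearMap.toAddMonoidHom ⟨C, hle⟩
  have hdense : Dense (Submodule.span F (Set.range (e ∘ u)) : Set (Homog W)) := by
    rw [Set.range_comp, ← LinearEquiv.coe_coe, Submodule.span_image, Submodule.map_coe]
    exact e.surjective.denseRange.dense_image hcont hu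
  obtain ⟨T, hT, hb⟩ := exists_projection (E.map e.toLinearMap) (e ∘ u) hdense
  let b := Module.finBasis F (E.map e.toLinearMap)
  let l (j) : Homog W →L[F] F := (LinearMap.toContinuousLinearMap (b.coord j)).comp T
  have hsum (w : W) : ∑ j, l j (e w) • e.symm (b j) = e.symm (T (e w)) := by
    let L : E.map e.toLinearMap →ₗ[F] W := e.symm.toLinearMap ∘ₗ (E.map e.toLinearMap).subtype
    have h := congrArg L (b.sum_repr (T (e w)))
    rw [map_sum] at h
    exact (Finset.sum_congr rfl fun j _ => (map_smul L _ _).symm).trans h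
  refine ⟨_, fun j => BanMod.ofLin (N := BanMod.unit F) ((l j).toLinearMap ∘ₗ e.toLinearMap)
    ⟨‖l j‖ * C, fun w => ?_⟩, fun j => e.symm (b j), fun x hx => ?_, fun w => ?_⟩
  · rw [mul_assoc]
    exact ((l j).le_opNorm (e w)).trans (by gcongr; exact hle w)
  · refine (hsum x).trans ?_
    have h := hT ⟨e x, x, hx, rfl⟩
    rw [h]
    exact e.symm_apply_apply x
  · refine (congrArg norm (hsum w)).trans_le ((Homog.norm_le _).trans ?_)
    rw [mul_assoc]
    refine Eq.trans_le ?_ ((hb (e w)).trans (by gcongr; exact hle w))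
    exact congrArg norm (e.apply_symm_apply _)

end

/-! ### Slice maps, and injectivity when the second factor has countable type. -/

namespace BanMod

variable {F : Type u} [NontriviallyNormedField F]

lemma tensorMap_toTensor {V V' W W' : BanMod F} (f : V ⟶ V') (g : W ⟶ W') (t : V ⊗[F] W) :
    lin (tensorMap f g) (toTensor V W t) = toTensor V' W' (TensorProduct.map (lin f) (lin g) t) := by
  induction t using TensorProduct.induction_on with
  | zero => simp
  | tmul v w => exact tensorMap_tmul f g v w
  | add s t hs ht => rw [map_add, map_add, hs, ht, map_add, map_add]

lemma norm_tensorMap_le {V W W' : BanMod F} (g : W ⟶ W') {K : ℝ} (hK : 0 ≤ K)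
    (h : ∀ w, ‖lin g w‖ ≤ K * ‖w‖) (x : tensor V W) :
    ‖lin (tensorMap (𝟙 V) g) x‖ ≤ K * ‖x‖ :=
  norm_lift_le _ _ hK (fun v w => (norm_tmul_le _ _).trans (by
    refine (mul_le_mul_of_nonneg_left (h w) (norm_nonneg _)).trans_eq ?_
    rw [lin_id]
    ring)) x

/-- An algebraic tensor is fixed by maps that fix a finite-dimensional subspace. -/
lemma exists_fixed {V W : BanMod F} (t : V ⊗[F] W) : ∃ E : Submodule F W,
    FiniteDimensional F E ∧ ∀ g : W ⟶ W, (∀ e ∈ E, lin g e = e) →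
      lin (tensorMap (𝟙 V) g) (toTensor V W t) = toTensor V W t := by
  induction t using TensorProduct.induction_on with
  | zero => exact ⟨⊥, inferInstance, fun g _ => by rw [map_zero, map_zero]⟩
  | tmul v w =>
    refine ⟨Submodule.span F {w}, inferInstance, fun g hg => ?_⟩
    refine (tensorMap_tmul _ _ v w).trans ?_
    rw [hg w (Submodule.mem_span_singleton_self w)]
    rfl
  | add s t hs ht =>
    obtain ⟨E, _, hs⟩ := hs
    obtain ⟨E', _, ht⟩ := ht
    refine ⟨E ⊔ E', inferInstance, fun g hg => ?_⟩
    rw [map_add, map_add, hs g fun e he => hg e (Submodule.mem_sup_left he),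
      ht g fun e he => hg e (Submodule.mem_sup_right he)]

variable [IsUltrametricDist F] [CompleteSpace F]

/-- Application of a functional to the second factor of a tensor product. -/
def evalRight (V : BanMod F) {W : BanMod F} (l : W ⟶ unit F) : tensor V W ⟶ V :=
  tensorMap (𝟙 V) l ≫ swap V (unit F) ≫ leftUnitHom V

lemma evalRight_tmul {V W : BanMod F} (l : W ⟶ unit F) (v : V) (w : W) :
    lin (evalRight V l) (tmul v w) = (show F from lin l w) • v := by
  simp only [evalRight, lin_comp, tensorMap_tmul, lin_id, swap_tmul, leftUnitHom_tmul]

/-- Through this identity, an element killed by `f ⊗ W` has slices killed by `f`. -/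
lemma evalRight_naturality {V V' W : BanMod F} (f : V ⟶ V') (l : W ⟶ unit F) :
    evalRight V l ≫ f = tensorMap f (𝟙 W) ≫ evalRight V' l :=
  tensor_ext fun v w => by
    rw [lin_comp, lin_comp, tensorMap_tmul, lin_id, evalRight_tmul, evalRight_tmul, map_smul]

/-- Finite-rank operators on the second factor act through slices, so an element with vanishing
slices is killed by all of them. -/
lemma tensorMap_sum {V W : BanMod F} {n : ℕ} (l : Fin n → (W ⟶ unit F)) (b : Fin n → W)
    (g : W ⟶ W) (hg : ∀ w, lin g w = ∑ j, (show F from lin (l j) w) • b j) (x : tensor V W) :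
    lin (tensorMap (𝟙 V) g) x = ∑ j, tmul (lin (evalRight V (l j)) x) (b j) := by
  have hcont (j : Fin n) : Continuous fun x : tensor V W => tmul (lin (evalRight V (l j)) x) (b j) := by
    have h : Continuous ((tmulₗ V W).flip (b j)) :=
      continuous_of_bound ((tmulₗ V W).flip (b j)).toAddMonoidHom
        ⟨‖b j‖, fun v => (norm_tmul_le v (b j)).trans_eq (mul_comm _ _)⟩
    exact h.comp (continuous_lin (evalRight V (l j)))
  refine tensor_induction (p := fun x => lin (tensorMap (𝟙 V) g) x =
    ∑ j, tmul (lin (evalRight V (l j)) x) (b j)) (isClosed_eq (continuous_lin _)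
      (continuous_finsetSum _ fun j _ => hcont j)) ?_ (fun s t hs ht => ?_) (fun v w => ?_) x
  · simp [tmul]
  · rw [map_add, hs, ht, ← Finset.sum_add_distrib]
    simp only [map_add, add_tmul]
  · rw [tensorMap_tmul, hg, lin_id]
    refine (map_sum (tmulₗ V W v) _ _).trans (Finset.sum_congr rfl fun j _ => ?_)
    rw [evalRight_tmul, smul_tmul]
    exact tmul_smul _ v (b j)

/-- Tensoring with a Banach space of countable type preserves injectivity. -/
lemma eq_zero_of_countable {V V' W : BanMod F} {f : V ⟶ V'} (hf : Function.Injective (lin f))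
    (u : ℕ → W) (hu : Dense (Submodule.span F (Set.range u) : Set W)) {x : tensor V W}
    (hx : lin (tensorMap f (𝟙 W)) x = 0) : x = 0 := by
  obtain ⟨K, hK, hproj⟩ := exists_projection_sum W u hu
  -- Approximate `x` by an algebraic `t` and take a finite-rank projection `g` fixing `t`. The
  -- slices of `x` vanish, so `V ⊗ g` kills `x` and sends `t - x` to `t`. Thus `t` is small, and so
  -- is `x`; the bound `K` must not depend on `t`.
  have key (ε : ℝ) (hε : 0 < ε) : ‖x‖ ≤ max 1 K * ε := by
    obtain ⟨t, ht⟩ := (denseRange_toTensor V W).exists_dist_lt x hε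
    rw [dist_eq_norm] at ht
    obtain ⟨E, _, hE⟩ := exists_fixed t
    obtain ⟨n, l, b, hfix, hb⟩ := hproj E
    let g : W ⟶ W := ofLin (∑ j, (show W →ₗ[F] F from lin (l j)).smulRight (b j)) ⟨K, fun w => by
      rw [LinearMap.sum_apply]
      exact hb w⟩
    have hg (w : W) : lin g w = ∑ j, (show F from lin (l j) w) • b j := by
      simp [g]
      rfl
    have h0 : lin (tensorMap (𝟙 V) g) x = 0 := by
      rw [tensorMap_sum l b g hg]
      refine Finset.sum_eq_zero fun j _ => ?_
      have h1 : lin (evalRight V (l j)) x = 0 := by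
        refine (injective_iff_map_eq_zero _).1 hf _ ?_
        rw [← lin_comp, evalRight_naturality, lin_comp, hx, map_zero]
      rw [h1]
      simp [tmul]
    have h1 : toTensor V W t = lin (tensorMap (𝟙 V) g) (toTensor V W t - x) := by
      rw [map_sub, h0, sub_zero, hE g fun e he => (hg e).trans (hfix e he)]
    have h2 : ‖toTensor V W t‖ ≤ max 1 K * ε := by
      rw [h1]
      refine (norm_tensorMap_le g hK (fun w => (congrArg norm (hg w)).trans_le (hb w)) _).trans ?_
      rw [norm_sub_rev]
      gcongr
      exact le_max_right _ _
    have h3 : ‖x - toTensor V W t‖ ≤ max 1 K * ε :=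
      ht.le.trans (le_mul_of_one_le_left hε.le (le_max_left _ _))
    calc ‖x‖ = ‖(x - toTensor V W t) + toTensor V W t‖ := by rw [sub_add_cancel]
      _ ≤ max ‖x - toTensor V W t‖ ‖toTensor V W t‖ := IsUltrametricDist.norm_add_le_max _ _
      _ ≤ _ := max_le h3 h2
  have hM : 0 < max 1 K := zero_lt_one.trans_le (le_max_left _ _)
  refine norm_le_zero_iff.1 (le_of_forall_pos_le_add fun e he => ?_)
  refine (key (e / max 1 K) (div_pos he hM)).trans_eq ?_
  rw [mul_div_cancel₀ _ hM.ne', zero_add]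

end BanMod

/-! ### Reduction to countable type, and injectivity in general. -/

namespace BanMod

variable {F : Type u} [NontriviallyNormedField F]

/-- The inclusion of algebraic tensor products with a closed subspace. -/
abbrev lTensorSub (V : BanMod F) {W : BanMod F} (N : Submodule F W) (h : IsClosed (N : Set W)) :
    V ⊗[F] sub W N h →ₗ[F] V ⊗[F] W := LinearMap.lTensor V (lin (subι W N h))

lemma lTensorSub_injective (V : BanMod F) {W : BanMod F} (N : Submodule F W)
    (h : IsClosed (N : Set W)) : Function.Injective (lTensorSub V N h) :=
  Module.Flat.lTensor_preserves_injective_linearMap _ Subtype.val_injective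

/-- A presentation of an algebraic tensor involves only finitely many vectors of the second
factor. -/
lemma exists_ptBall_lift {V W : BanMod F} {c : ℝ} {t : V ⊗[F] W} (ht : t ∈ ptBall V W c) :
    ∃ S : Set W, S.Countable ∧ ∀ (N : Submodule F W) (h : IsClosed (N : Set W)), S ⊆ N →
      ∃ t₁ : V ⊗[F] sub W N h, t₁ ∈ ptBall V (sub W N h) c ∧ lTensorSub V N h t₁ = t := by
  refine AddSubgroup.closure_induction (G := PTensor V W)
    (p := fun t _ => ∃ S : Set W, S.Countable ∧ ∀ (N : Submodule F W) (h : IsClosed (N : Set W)),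
      S ⊆ N → ∃ t₁ : V ⊗[F] sub W N h, t₁ ∈ ptBall V (sub W N h) c ∧
        lTensorSub V N h t₁ = t) ?_ ?_ ?_ ?_ ht
  · rintro _ ⟨v, w, hvw, rfl⟩
    refine ⟨{w}, Set.countable_singleton w, fun N h hN => ?_⟩
    exact ⟨v ⊗ₜ (⟨w, hN rfl⟩ : sub W N h), AddSubgroup.subset_closure ⟨v, _, hvw, rfl⟩, rfl⟩
  · exact ⟨∅, Set.countable_empty, fun N h _ => ⟨0, zero_mem _, map_zero (lTensorSub V N h)⟩⟩
  · rintro s t - - ⟨S, hS, hs⟩ ⟨T, hT, ht⟩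
    refine ⟨S ∪ T, hS.union hT, fun N h hN => ?_⟩
    obtain ⟨s₁, hs₁, rfl⟩ := hs N h (Set.subset_union_left.trans hN)
    obtain ⟨t₁, ht₁, rfl⟩ := ht N h (Set.subset_union_right.trans hN)
    exact ⟨s₁ + t₁, add_mem hs₁ ht₁, map_add (lTensorSub V N h) s₁ t₁⟩
  · rintro t - ⟨S, hS, ht⟩
    refine ⟨S, hS, fun N h hN => ?_⟩
    obtain ⟨t₁, ht₁, rfl⟩ := ht N h hN
    exact ⟨-t₁, neg_mem ht₁, map_neg (lTensorSub V N h) t₁⟩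

lemma norm_toTensor_le {V W : BanMod F} {c : ℝ} (hc : 0 ≤ c) {t : V ⊗[F] W}
    (ht : t ∈ ptBall V W c) : ‖toTensor V W t‖ ≤ c :=
  (norm_toTensor t).trans_le (ptNorm_le hc ht)

lemma mem_ptBall_of_norm_lt {V W : BanMod F} {c : ℝ} {t : V ⊗[F] W} (ht : ‖toTensor V W t‖ < c) :
    t ∈ ptBall V W c :=
  mem_ptBall_of_lt ((norm_toTensor t).symm.trans_lt ht)

/-- The subspace carries the induced topology, so closures in it can be computed in `W`. -/
lemma dense_span_sub {W : BanMod F} {S : Set W} {N : Submodule F W} (h : IsClosed (N : Set W))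
    (hN : N = (Submodule.span F S).topologicalClosure) (u : ℕ → sub W N h)
    (hu : S = Set.range fun n => lin (subι W N h) (u n)) :
    Dense (Submodule.span F (Set.range u) : Set (sub W N h)) := by
  intro x
  have hind : Topology.IsInducing (lin (subι W N h)) := Topology.IsInducing.subtypeVal
  rw [hind.closure_eq_preimage_closure_image, Set.mem_preimage, ← Submodule.map_coe,
    Submodule.map_span, ← Set.range_comp]
  have h1 : lin (subι W N h) x ∈ (Submodule.span F S).topologicalClosure := hN ▸ x.2
  rw [hu] at h1
  exact h1

/-- An element of the kernel of `f ⊗ W` comes from the kernel of `f ⊗ W₁` for a closed subspace `W₁`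
of countable type. -/
lemma exists_countable_lift {V V' W : BanMod F} (f : V ⟶ V') {x : tensor V W}
    (hx : lin (tensorMap f (𝟙 W)) x = 0) :
    ∃ (N : Submodule F W) (h : IsClosed (N : Set W)) (u : ℕ → sub W N h)
      (x₁ : tensor V (sub W N h)), Dense (Submodule.span F (Set.range u) : Set (sub W N h)) ∧
        lin (tensorMap (𝟙 V) (subι W N h)) x₁ = x ∧ lin (tensorMap f (𝟙 _)) x₁ = 0 := by
  let δ (n : ℕ) : ℝ := (1 / 2) ^ n
  have hδ (n : ℕ) : 0 < δ n := by positivity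
  have hδs (n : ℕ) : δ (n + 1) ≤ δ n := by
    change (1 / 2 : ℝ) ^ (n + 1) ≤ (1 / 2) ^ n
    rw [pow_succ]
    linarith [show (0 : ℝ) < (1 / 2) ^ n by positivity]
  have hδ0 : Filter.Tendsto δ Filter.atTop (nhds 0) :=
    tendsto_pow_atTop_nhds_zero_of_lt_one (by norm_num) (by norm_num)
  choose t ht using fun n => (denseRange_toTensor V W).exists_dist_lt x (hδ n)
  have ht' (n : ℕ) : ‖x - toTensor V W (t n)‖ < δ n := (dist_eq_norm _ _).symm.trans_lt (ht n)
  obtain ⟨C, hC, hf⟩ := exists_bound (tensorMap f (𝟙 W))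
  obtain ⟨c₀, -, h₀⟩ := exists_mem_ptBall (M := V) (N := W) (t 0)
  -- Small presentations of the differences are recorded so that the lifted series converges already
  -- in the tensor product with a subspace.
  have hd (n : ℕ) : t (n + 1) - t n ∈ ptBall V W (2 * δ n) := by
    refine mem_ptBall_of_norm_lt ?_
    have h1 : toTensor V W (t (n + 1) - t n) =
        (x - toTensor V W (t n)) - (x - toTensor V W (t (n + 1))) := by
      rw [map_sub]
      abel
    rw [h1]
    refine (norm_sub_le _ _).trans_lt ?_
    linarith [ht' n, ht' (n + 1), hδs n]
  -- Since `x` is killed, the images of its approximations are small. Keeping these presentations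
  -- too ensures that the images remain small when computed with the subspace, whose tensor norm may
  -- be larger.
  have he (n : ℕ) : TensorProduct.map (lin f) (lin (𝟙 W)) (t n) ∈
      ptBall V' W ((C + 1) * δ n) := by
    refine mem_ptBall_of_norm_lt ?_
    rw [← tensorMap_toTensor, ← norm_neg, ← zero_sub, ← hx, ← map_sub]
    refine (hf _).trans_lt ?_
    nlinarith [ht' n, hδ n]
  obtain ⟨S₀, hS₀, hS₀'⟩ := exists_ptBall_lift h₀
  choose S hS hS' using fun n => exists_ptBall_lift (hd n)
  choose T hT hT' using fun n => exists_ptBall_lift (he n)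
  -- All vectors of `W` used in the countably many presentations. The vector `0` makes the set
  -- nonempty, so that it can be enumerated.
  let A : Set W := {0} ∪ S₀ ∪ (⋃ n, S n) ∪ ⋃ n, T n
  have hA : A.Countable := (((Set.countable_singleton 0).union hS₀).union
    (Set.countable_iUnion hS)).union (Set.countable_iUnion hT)
  obtain ⟨a, ha⟩ := hA.exists_eq_range ⟨0, Or.inl (Or.inl (Or.inl rfl))⟩
  let N : Submodule F W := (Submodule.span F A).topologicalClosure
  have hN : IsClosed (N : Set W) := Submodule.isClosed_topologicalClosure _
  have hAN : A ⊆ N := Submodule.subset_span.trans (Submodule.le_topologicalClosure _)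
  obtain ⟨s₀, -, hs₀⟩ := hS₀' N hN fun w hw => hAN (Or.inl (Or.inl (Or.inr hw)))
  choose s hs hst using fun n => hS' n N hN fun w hw =>
    hAN (Or.inl (Or.inr (Set.mem_iUnion.2 ⟨n, hw⟩)))
  choose r hr hrt using fun n => hT' n N hN fun w hw => hAN (Or.inr (Set.mem_iUnion.2 ⟨n, hw⟩))
  let u (n : ℕ) : sub W N hN := ⟨a n, hAN (ha ▸ ⟨n, rfl⟩)⟩
  let y (n : ℕ) : V ⊗[F] sub W N hN := s₀ + ∑ k ∈ Finset.range n, s k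
  have hy (n : ℕ) : lTensorSub V N hN (y n) = t n := by
    induction n with
    | zero => simpa [y] using hs₀
    | succ n ih =>
      have h1 : y (n + 1) = y n + s n := by
        simp only [y]
        rw [Finset.sum_range_succ, add_assoc]
      rw [h1, map_add, ih]
      exact (congrArg (t n + ·) (hst n)).trans (add_sub_cancel _ _)
  have hcauchy : CauchySeq fun n => toTensor V (sub W N hN) (y n) := by
    refine cauchySeq_of_le_geometric (1 / 2) 2 (by norm_num) fun n => ?_
    rw [dist_comm, dist_eq_norm, ← map_sub]
    have h1 : y (n + 1) - y n = s n := by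
      simp only [y]
      rw [Finset.sum_range_succ, add_sub_add_left_eq_sub, add_sub_cancel_left]
    rw [h1]
    exact norm_toTensor_le (by positivity) (hs n)
  obtain ⟨x₁, hx₁⟩ := cauchySeq_tendsto_of_complete hcauchy
  refine ⟨N, hN, u, x₁, dense_span_sub hN rfl u ha, ?_, ?_⟩
  · refine tendsto_nhds_unique (((continuous_lin _).tendsto x₁).comp hx₁) ?_
    have h1 (n : ℕ) : lin (tensorMap (𝟙 V) (subι W N hN)) (toTensor V _ (y n)) =
        toTensor V W (t n) := by
      rw [tensorMap_toTensor, ← hy]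
      rfl
    have h2 : Filter.Tendsto (fun n => toTensor V W (t n)) Filter.atTop (nhds x) :=
      tendsto_iff_dist_tendsto_zero.2 (squeeze_zero (fun _ => dist_nonneg)
        (fun n => (dist_comm _ _).trans_le (ht n).le) hδ0)
    exact h2.congr fun n => (h1 n).symm
  · refine tendsto_nhds_unique (((continuous_lin _).tendsto x₁).comp hx₁) ?_
    -- Both sides become `(f ⊗ W)(t n)` in `V' ⊗ W`, and algebraic tensor products over a field
    -- preserve the inclusion of the subspace.
    have h1 (n : ℕ) : TensorProduct.map (lin f) (lin (𝟙 (sub W N hN))) (y n) = r n := by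
      refine lTensorSub_injective V' N hN (Eq.trans ?_ (hrt n).symm)
      rw [← hy n]
      change LinearMap.lTensor _ _ (TensorProduct.map _ _ _) =
        TensorProduct.map _ _ (LinearMap.lTensor _ _ _)
      rw [← LinearMap.comp_apply, ← LinearMap.comp_apply, LinearMap.lTensor, LinearMap.lTensor,
        ← TensorProduct.map_comp, ← TensorProduct.map_comp]
      rfl
    refine squeeze_zero_norm (a := fun n => (C + 1) * δ n) (fun n => ?_)
      (by simpa using hδ0.const_mul (C + 1))
    have h2 : lin (tensorMap f (𝟙 (sub W N hN))) (toTensor V _ (y n)) = toTensor V' _ (r n) :=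
      (tensorMap_toTensor _ _ _).trans (congrArg _ (h1 n))
    refine (congrArg norm h2).trans_le (norm_toTensor_le ?_ (hr n))
    have := (hδ n).le
    positivity

variable [IsUltrametricDist F] [CompleteSpace F]

/-- Completed tensor products over `F` preserve injective bounded maps. -/
lemma tensorMap_injective {V V' : BanMod F} {f : V ⟶ V'} (hf : Function.Injective (lin f))
    (W : BanMod F) : Function.Injective (lin (tensorMap f (𝟙 W))) := by
  refine (injective_iff_map_eq_zero _).2 fun x hx => ?_
  obtain ⟨N, hN, u, x₁, hu, h1, h2⟩ := exists_countable_lift f hx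
  rw [← h1, eq_zero_of_countable hf u hu h2, map_zero]

/-- The factors are treated one after the other, with the symmetry exchanging their roles. -/
lemma tensorMap_injective' {V V' W W' : BanMod F} {f : V ⟶ V'} {g : W ⟶ W'}
    (hf : Function.Injective (lin f)) (hg : Function.Injective (lin g)) :
    Function.Injective (lin (tensorMap f g)) := by
  have h : tensorMap f g = tensorMap f (𝟙 W) ≫ swap V' W ≫ tensorMap g (𝟙 V') ≫ swap W' V' :=
    tensor_ext (by simp)
  have hs (A B : BanMod F) : Function.Injective (lin (swap A B)) := fun x y hxy => by
    have h1 := congrArg (lin (swap B A)) hxy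
    rw [← lin_comp, ← lin_comp, show swap A B ≫ swap B A = 𝟙 _ from (swapIso A B).hom_inv_id] at h1
    exact h1
  rw [h]
  exact (hs _ _).comp ((tensorMap_injective hg _).comp ((hs _ _).comp (tensorMap_injective hf _)))

end BanMod

/-- Monomorphisms of Banach spaces are the injective maps, and these are stable under completed
tensor products. -/
lemma isMonomorphic_tensor {F : Type u} [NontriviallyNormedField F] [IsUltrametricDist F]
    [CompleteSpace F] {X Y : IndObj (BanMod F)} (hX : IsMonomorphic X) (hY : IsMonomorphic Y) :
    IsMonomorphic (X ⊗ Y) := fun {_ _} a =>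
  BanMod.mono_of_injective _ (BanMod.tensorMap_injective' (f := X.diag.map a.1) (g := Y.diag.map a.2)
    (BanMod.injective_of_mono _ (hX a.1)) (BanMod.injective_of_mono _ (hY a.2)))

lemma essentiallyMonomorphic_tensor {F : Type u} [NontriviallyNormedField F] [IsUltrametricDist F]
    [CompleteSpace F] {X Y : IndObj (BanMod F)} (hX : essentiallyMonomorphic X)
    (hY : essentiallyMonomorphic Y) : essentiallyMonomorphic (X ⊗ Y) := by
  obtain ⟨X', hX', ⟨e⟩⟩ := hX
  obtain ⟨Y', hY', ⟨e'⟩⟩ := hY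
  exact ⟨X' ⊗ Y', isMonomorphic_tensor hX' hY', ⟨e ⊗ᵢ e'⟩⟩

/-! ### The inclusion of complete bornological spaces is strongly monoidal. -/

section

variable (F : Type u) [NontriviallyNormedField F] [IsUltrametricDist F] [CompleteSpace F]

instance : (diss F).IsRightAdjoint := (reflAdj F).isRightAdjoint

variable {F}

lemma isIso_reflAdj_unit_app {E : IndObj (BanMod F)} (h : essentiallyMonomorphic E) :
    IsIso ((reflAdj F).unit.app E) :=
  (reflAdj F).isIso_unit_app_of_iso (X := (⟨E, h⟩ : CBorn F)) (Iso.refl E)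

variable (F) in
instance isIso_ε_diss : IsIso (Functor.LaxMonoidal.ε (diss F)) := by
  have : IsIso ((reflAdj F).unit.app (𝟙_ (IndObj (BanMod F)))) :=
    isIso_reflAdj_unit_app (cbornUnit F).property
  rw [(reflAdj F).rightAdjointLaxMonoidal_ε, Adjunction.homEquiv_unit]
  infer_instance

/-- The structure map is the unit of the reflection at the tensor product of ind-objects, followed
by isomorphisms from the strongly monoidal reflector and the counits. The unit is invertible there
because this tensor product is already essentially monomorphic. -/
instance isIso_μ_diss (V W : CBorn F) : IsIso (Functor.LaxMonoidal.μ (diss F) V W) := by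
  have : IsIso ((reflAdj F).unit.app ((diss F).obj V ⊗ (diss F).obj W)) :=
    isIso_reflAdj_unit_app (essentiallyMonomorphic_tensor V.property W.property)
  rw [(reflAdj F).rightAdjointLaxMonoidal_μ, Adjunction.homEquiv_unit]
  infer_instance

end

end

end IndBanach

theorem proposition2p27 (F : Type u) [NontriviallyNormedField F] [CompleteSpace F]
    [IsUltrametricDist F] (π : IndBanach.PseudoUniformizer F) :
    -- the functor `V ↦ V̲` on ind-Banach spaces is strongly (symmetric) monoidal
    (IsIso (Functor.LaxMonoidal.ε (IndBanach.toUnderline F π)) ∧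
      ∀ V W : IndBanach.IndObj (IndBanach.BanMod F),
        IsIso (Functor.LaxMonoidal.μ (IndBanach.toUnderline F π) V W)) ∧
    -- it is exact
    IndBanach.IsExact (IndBanach.toUnderline F π) ∧
    -- it is a reflective embedding
    Nonempty (Reflective (IndBanach.toUnderline F π)) ∧
    -- its restriction to complete bornological spaces is strongly monoidal on proper spaces
    (IsIso (Functor.LaxMonoidal.ε (IndBanach.cbornToUnderline F π)) ∧
      ∀ V W : IndBanach.CBorn F, IndBanach.IsProper V → IndBanach.IsProper W →
        IsIso (Functor.LaxMonoidal.μ (IndBanach.cbornToUnderline F π) V W)) ∧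
    -- and strongly left exact
    IndBanach.IsStronglyLeftExact (IndBanach.cbornToUnderline F π) := by
  refine ⟨⟨inferInstance, fun V W => inferInstance⟩, IndBanach.isExact_toUnderline, ⟨inferInstance⟩,
    ⟨?_, fun V W _ _ => ?_⟩, IndBanach.isStronglyLeftExact_of_isRightAdjoint _⟩
  -- The structure maps of the composite are built from those of its two factors, all of which are
  -- isomorphisms.
  · rw [Functor.LaxMonoidal.comp_ε]
    infer_instance
  · rw [Functor.LaxMonoidal.comp_μ]
    infer_instance
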